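/- **Setting.** Let $d\in\mathbb N$ and let $\{v_\mu\}_{\mu=1}^{d^2}$ be Hermitian $d\times d$ matrices with ${\rm Tr}(v_\mu v_\nu)=\delta_{\mu\nu}$. Let $\epsilon_\mu\in\mathbb R$, let $h=h^{(re)}+ih^{(im)}$ be a Hermitian $d^2\times d^2$ matrix ($h^{(re)},h^{(im)}$ the entrywise real and imaginary parts), and let $C\ge 0$ be a $d^2\times d^2$ (Kossakowski) matrix. Put $A=\frac12(C+C^{tr})$, $B=\frac12(C-C^{tr})$, $\widetilde B=B+2ih^{(re)}$, $J^\gamma_{\alpha\beta}={\rm Tr}([v_\alpha,v_\beta]v_\gamma)$. Let $\mathcal S\subset\mathbb R^{d^2}$ be the set of vectors $\omega=({\rm Tr}(\rho v_\mu))_\mu$, $\rho$ a density matrix, and for $\omega\in\mathbb R^{d^2}$ define the real matrices $$\sigma_{\mu\nu}(\omega)=-i\sum_\alpha J^\alpha_{\mu\nu}\omega_\alpha,\quad D_{\alpha\beta}(\omega)=\sum_{\mu,\nu}J^\mu_{\alpha\beta}\widetilde B_{\mu\nu}\omega_\nu+i\sum_\mu\epsilon_\mu J^\mu_{\alpha\beta},\quad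 Q(\omega)=-i\sigma(\omega)\widetilde B+D(\omega).$$ For $\omega\in\mathcal S$ let $\omega_t$, $t\ge0$, solve $\dot\omega_t=D(\omega_t)\omega_t$, $\omega_0=\omega$; write $\dot\omega=D(\omega)\omega$. Let $X_t(\omega)$ be the time-ordered exponential, $\dot X_t=Q(\omega_t)X_t$, $X_0=1$, and $Y_t(\omega)=\int_0^tX_{t,s}\,\sigma(\omega_s)A\,\sigma(\omega_s)^{tr}X_{t,s}^{tr}\,ds$ with $X_{t,s}=X_tX_s^{-1}$. Let $\{\mathbb H_\omega\}_{\omega\in\mathcal S}$ be a measurable field of Hilbert spaces carrying a measurable field of regular representations $W_\omega(r)=\exp(i\,r\cdot F(\omega))$, $r\in\mathbb R^{d^2}$, of the Weyl relations $W_\omega(r)^\dagger=W_\omega(-r)$, $W_\omega(r_1)W_\omega(r_2)=W_\omega(r_1+r_2)\,e^{-\frac i2r_1\cdot\sigma(\omega)r_2}$, with $W_\omega(0)=\mathbf 1$, and let $m$ be a measure on $\mathcal S$. For $f:\mathcal S\to\mathbb C$ and $r:\mathcal S\to\mathbb R^{d^2}$ of class $C^1$ (on a neighbourhood of $\mathcal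 S$) let $W^f_r(\omega)=f(\omega)W_\omega(r(\omega))$ and let the extended dynamics be $$(\Phi^{ext}_t[W^f_r])(\omega)=f(\omega_t)\,\Phi^\omega_t[W_\omega(r(\omega_t))],\qquad \Phi^\omega_t[W_\omega(a)]=e^{-\frac12a\cdot Y_t(\omega)a}\,W_\omega(X_t(\omega)^{tr}a).$$ For $\omega\in\mathcal S$ let $d_0=\dim\ker\sigma(\omega)$, $d_1=d^2-d_0$, and let $R=R(\omega)$ be an orthogonal matrix with $R\sigma(\omega)R^{tr}={\rm diag}(0,\sigma^{11})$, $\sigma^{11}$ an invertible $d_1\times d_1$ matrix. Every $d^2\times d^2$ matrix $Z$ is rotated into $RZR^{tr}$ and split into blocks $Z^{00},Z^{01},Z^{10},Z^{11}$ accordingly. Put $G=RF(\omega)$ and $s=Rr(\omega)$; for $\mu\le d_0$ the operator $G_\mu$ commutes with all the $G_\nu$, and $\partial/\partial G_\mu$ is the derivative of $W^f_r(\omega)=f(\omega)\exp(i\,s\cdot G)$ with respect to the commuting variable $G_\mu$. **Theorem.** Such an $R(\omega)$ exists for every $\omega\in\mathcal S$, and, for every choice of $R$, the extended dynamics $\Phi^{ext}_t$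 has a generator of the form $\mathbb L^{ext}=\int^\oplus_{\mathcal S}\mathbb L_\omega$, $\mathbb L_\omega=\mathbb L^{drift}_\omega+\mathbb L^{cc}_\omega+\mathbb L^{cq}_\omega+\mathbb L^{qq}_\omega$, where, with $W=W^f_r(\omega)$, $$\mathbb L^{drift}_\omega[W]=\dot\omega\cdot\partial_\omega W^f_r(\omega)\quad\text{(the label of the Weyl algebra being kept fixed)},$$ $$\mathbb L^{cc}_\omega[W]=\sum_{\mu,\nu=1}^{d_0}D^{00}_{\mu\nu}\,G_\nu\frac{\partial W}{\partial G_\mu},\qquad \mathbb L^{cq}_\omega[W]=\sum_{\mu=1}^{d_0}\sum_{\nu=d_0+1}^{d^2}\frac{D^{01}_{\mu\nu}}2\Big\{G_\nu,\frac{\partial W}{\partial G_\mu}\Big\},$$ $$\mathbb L^{qq}_\omega[W]=i\sum_{\mu=1}^{d_0}\sum_{\nu=d_0+1}^{d^2}(H^{01}_{\mu\nu}+H^{10}_{\nu\mu})\,G_\mu[G_\nu,W]+i\sum_{\mu,\nu=d_0+1}^{d^2}H^{11}_{\mu\nu}[G_\mu G_\nu,W]+\sum_{\mu,\nu=d_0+1}^{d^2}K^{11}_{\mu\nu}\Big(G_\mu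 WG_\nu-\tfrac12\{G_\mu G_\nu,W\}\Big),$$ $$H^{11}=(h^{(re)})^{11}+\tfrac14\{(\sigma^{11})^{-1},D^{11}\},\qquad K^{11}=A^{11}+B^{11}+\tfrac i2[(\sigma^{11})^{-1},D^{11}]=C^{11}+\tfrac i2[(\sigma^{11})^{-1},D^{11}],$$ $$H^{10}=\tfrac12(\sigma^{11})^{-1}D^{10}-\tfrac i2B^{10}+(h^{(re)})^{10},\qquad H^{01}=\tfrac12D^{01}(\sigma^{11})^{-1}+\tfrac i2B^{01}+(h^{(re)})^{01}.$$ This means: (i) for every $\omega\in\mathcal S$ and every $\psi\in\mathbb H_\omega$ for which $a\mapsto W_\omega(a)\psi$ is $C^2$, the right derivative at $t=0$ of $t\mapsto(\Phi^{ext}_t[W^f_r])(\omega)\psi$ is $\mathbb L_\omega[W^f_r(\omega)]\psi$; (ii) for every $\psi\in\int^\oplus_{\mathcal S}\mathbb H_\omega\,dm(\omega)$ all of whose values are such vectors and for which $F_\mu\psi\in\int^\oplus_{\mathcal S}\mathbb H_\omega\,dm(\omega)$ for all $\mu$, the vectors $W^f_r\psi$, $\mathbb L^{ext}[W^f_r]\psi=(\mathbb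 L_\omega[W^f_r(\omega)]\psi(\omega))_\omega$ and, for all small $t>0$, $\Phi^{ext}_t[W^f_r]\psi$ belong to the direct integral, and $\frac1t(\Phi^{ext}_t[W^f_r]-W^f_r)\psi\to\mathbb L^{ext}[W^f_r]\psi$ in norm as $t\downarrow0$. The matrix $K^{11}$ need not be positive semidefinite: there are $d$, a model as above, $\omega\in\mathcal S$ and $R(\omega)$ for which the Hermitian matrix $K^{11}$ is not positive semidefinite. -/

import Mathlib

open Matrix MeasureTheory Filter Topology Set
open scoped ENNReal InnerProductSpace ComplexOrder

namespace HybridFluctuations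

noncomputable section

/-! ## Microscopic data and the matrices built from them -/

/-- Index set of a basis of the `d × d` matrices. -/
abbrev Idx (d : ℕ) : Type := Fin (d ^ 2)

/-- The data of the mean-field dissipative generator of a chain of `d`-level systems: a Hermitian
orthonormal basis `v` of the single-site algebra, the coefficients `ε` and `h` of the linear and of
the bilinear part of the Hamiltonian, and the Kossakowski matrix `C`. -/
structure MeanFieldModel (d : ℕ) where
  v : Idx d → Matrix (Fin d) (Fin d) ℂ
  v_hermitian : ∀ μ, (v μ).IsHermitian
  v_orthonormal : ∀ μ ν, (v μ * v ν).trace = if μ = ν then 1 else 0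
  ε : Idx d → ℝ
  h : Matrix (Idx d) (Idx d) ℂ
  h_hermitian : h.IsHermitian
  C : Matrix (Idx d) (Idx d) ℂ
  C_posSemidef : C.PosSemidef

/-- A real matrix regarded as a complex one. -/
def cplx {m n : Type*} (M : Matrix m n ℝ) : Matrix m n ℂ := M.map (fun x => (x : ℂ))

/-- Entrywise real part. -/
def rePart {m n : Type*} (M : Matrix m n ℂ) : Matrix m n ℝ := M.map Complex.re

lemma cplx_rePart {m n : Type*} (M : Matrix m n ℂ) (hM : ∀ i j, (starRingEnd ℂ) (M i j) = M i j) :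
    cplx (rePart M) = M := by
  ext i j
  exact Complex.conj_eq_iff_re.mp (hM i j)

namespace MeanFieldModel

variable {d : ℕ} (M : MeanFieldModel d)

/-- `h^(re)`, the matrix of the real parts of the entries of `h`. -/
def hRe : Matrix (Idx d) (Idx d) ℂ := cplx (rePart M.h)

/-- Symmetric component of the Kossakowski matrix. -/
def A : Matrix (Idx d) (Idx d) ℂ := (1 / 2 : ℂ) • (M.C + M.Cᵀ)

/-- Anti-symmetric component of the Kossakowski matrix. -/
def B : Matrix (Idx d) (Idx d) ℂ := (1 / 2 : ℂ) • (M.C - M.Cᵀ)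

/-- `B + 2 i h^(re)`. -/
def Btilde : Matrix (Idx d) (Idx d) ℂ := M.B + (2 * Complex.I) • M.hRe

/-- The structure constants: `M.J α β γ = Tr([v_α, v_β] v_γ)`. -/
def J (α β γ : Idx d) : ℂ := ((M.v α * M.v β - M.v β * M.v α) * M.v γ).trace

/-- The symplectic matrix `-i ∑_α J^α_{μν} ω_α`, as a complex matrix. -/
def sigmaC (ω : Idx d → ℝ) : Matrix (Idx d) (Idx d) ℂ :=
  of fun μ ν => -Complex.I * ∑ α, M.J μ ν α * (ω α : ℂ)

/-- The symplectic matrix `σ(ω)`. -/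
def sigma (ω : Idx d → ℝ) : Matrix (Idx d) (Idx d) ℝ := rePart (M.sigmaC ω)

/-- The matrix `∑_{μν} J^μ_{αβ} B̃_{μν} ω_ν + i ∑_μ ε_μ J^μ_{αβ}`, as a complex matrix. -/
def DC (ω : Idx d → ℝ) : Matrix (Idx d) (Idx d) ℂ :=
  of fun α β => (∑ μ, ∑ ν, M.J α β μ * M.Btilde μ ν * (ω ν : ℂ))
    + Complex.I * ∑ μ, (M.ε μ : ℂ) * M.J α β μ

/-- The matrix `D(ω)` of the macroscopic equations of motion. -/
def D (ω : Idx d → ℝ) : Matrix (Idx d) (Idx d) ℝ := rePart (M.DC ω)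

/-- The vector field `ω ↦ D(ω) ω` of the macroscopic equations of motion. -/
def omegaDot (ω : Idx d → ℝ) : Idx d → ℝ := M.D ω *ᵥ ω

/-- The matrix `-i σ(ω) B̃ + D(ω)`, as a complex matrix. -/
def QC (ω : Idx d → ℝ) : Matrix (Idx d) (Idx d) ℂ :=
  (-Complex.I) • (M.sigmaC ω * M.Btilde) + M.DC ω

/-- The matrix `Q(ω)`. -/
def Q (ω : Idx d → ℝ) : Matrix (Idx d) (Idx d) ℝ := rePart (M.QC ω)

/-! The matrices above are real, so that no information is lost by taking real parts. -/

lemma star_J (α β γ : Idx d) : (starRingEnd ℂ) (M.J α β γ) = -M.J α β γ := by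
  have key : (starRingEnd ℂ) (M.J α β γ)
      = ((M.v α * M.v β - M.v β * M.v α) * M.v γ)ᴴ.trace := by
    rw [trace_conjTranspose]; rfl
  rw [key, conjTranspose_mul, conjTranspose_sub, conjTranspose_mul, conjTranspose_mul,
    (M.v_hermitian α).eq, (M.v_hermitian β).eq, (M.v_hermitian γ).eq, J, trace_mul_comm,
    ← trace_neg, ← neg_mul, neg_sub]

lemma star_B (μ ν : Idx d) : (starRingEnd ℂ) (M.B μ ν) = -M.B μ ν := by
  have h1 : (starRingEnd ℂ) (M.C μ ν) = M.C ν μ := M.C_posSemidef.isHermitian.apply ν μ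
  have h2 : (starRingEnd ℂ) (M.C ν μ) = M.C μ ν := M.C_posSemidef.isHermitian.apply μ ν
  simp only [B, Matrix.smul_apply, Matrix.sub_apply, transpose_apply, smul_eq_mul, map_mul, map_sub, h1, h2,
    map_div₀, map_one, Complex.conj_ofNat]
  ring

lemma cplx_A : cplx (rePart M.A) = M.A := by
  refine cplx_rePart _ fun μ ν => ?_
  have h1 : (starRingEnd ℂ) (M.C μ ν) = M.C ν μ := M.C_posSemidef.isHermitian.apply ν μ
  have h2 : (starRingEnd ℂ) (M.C ν μ) = M.C μ ν := M.C_posSemidef.isHermitian.apply μ ν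
  simp only [A, Matrix.smul_apply, Matrix.add_apply, transpose_apply, smul_eq_mul, map_mul,
    map_add, h1, h2, map_div₀, map_one, Complex.conj_ofNat]
  ring

lemma star_Btilde (μ ν : Idx d) : (starRingEnd ℂ) (M.Btilde μ ν) = -M.Btilde μ ν := by
  simp only [Btilde, Matrix.add_apply, map_add, star_B, Matrix.smul_apply, smul_eq_mul, map_mul, hRe, cplx,
    map_apply, Complex.conj_ofReal, Complex.conj_I, Complex.conj_ofNat]
  ring

lemma cplx_sigma (ω : Idx d → ℝ) : cplx (M.sigma ω) = M.sigmaC ω := by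
  refine cplx_rePart _ fun μ ν => ?_
  simp only [sigmaC, of_apply, map_mul, map_neg, map_sum, star_J, Complex.conj_I,
    Complex.conj_ofReal, neg_mul, Finset.sum_neg_distrib]
  ring

lemma cplx_D (ω : Idx d → ℝ) : cplx (M.D ω) = M.DC ω := by
  refine cplx_rePart _ fun μ ν => ?_
  simp only [DC, of_apply, map_add, map_mul, map_sum, star_J, star_Btilde, Complex.conj_I,
    Complex.conj_ofReal, neg_mul, mul_neg, Finset.sum_neg_distrib, neg_neg]

lemma cplx_Q (ω : Idx d → ℝ) : cplx (M.Q ω) = M.QC ω := by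
  refine cplx_rePart _ fun μ ν => ?_
  have hs : ∀ i j, (starRingEnd ℂ) (M.sigmaC ω i j) = M.sigmaC ω i j := fun i j => by
    rw [← M.cplx_sigma ω]; exact Complex.conj_ofReal _
  have hD : ∀ i j, (starRingEnd ℂ) (M.DC ω i j) = M.DC ω i j := fun i j => by
    rw [← M.cplx_D ω]; exact Complex.conj_ofReal _
  simp only [QC, Matrix.add_apply, Matrix.smul_apply, Matrix.mul_apply, smul_eq_mul, map_add, map_mul, map_neg,
    map_sum, hs, hD, star_Btilde, Complex.conj_I, mul_neg, Finset.sum_neg_distrib, neg_mul,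
    neg_neg]

/-- The space `𝒮` of the macroscopic averages: the vectors `ω_μ = Tr(ρ v_μ)`, `ρ` a density
matrix. -/
def averages : Set (Idx d → ℝ) :=
  {ω | ∃ ρ : Matrix (Fin d) (Fin d) ℂ, ρ.PosSemidef ∧ ρ.trace = 1 ∧
    ∀ μ, (ω μ : ℂ) = (ρ * M.v μ).trace}

/-! ## The macroscopic trajectories and the matrices of the mesoscopic dynamics -/

/-- `x` is the trajectory `t ↦ ω_t`, `t ≥ 0`, of the macroscopic averages that starts at `ω`. -/
def IsMacroTrajectory (ω : Idx d → ℝ) (x : ℝ → Idx d → ℝ) : Prop :=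
  x 0 = ω ∧ ∀ t, 0 ≤ t → HasDerivWithinAt x (M.omegaDot (x t)) (Ici 0) t

/-- `X` is the time-ordered exponential of `∫₀ᵗ q(s) ds`, `t ≥ 0` (later times to the left). -/
def IsTimeOrderedExp (q X : ℝ → Matrix (Idx d) (Idx d) ℝ) : Prop :=
  X 0 = 1 ∧ ∀ t, 0 ≤ t → ∀ i j,
    HasDerivWithinAt (fun s => X s i j) ((q t * X t) i j) (Ici 0) t

/-- The matrix `Y_t = ∫₀ᵗ X_{t,s} σ(ω_s) A σ(ω_s)ᵗʳ X_{t,s}ᵗʳ ds`, `X_{t,s} = X_t X_s⁻¹`, along the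
trajectory `x`. -/
def Y (x : ℝ → Idx d → ℝ) (X : ℝ → Matrix (Idx d) (Idx d) ℝ) (t : ℝ) :
    Matrix (Idx d) (Idx d) ℝ :=
  of fun i j => ∫ s in (0 : ℝ)..t,
    ((X t * (X s)⁻¹) * (M.sigma (x s) * rePart M.A * (M.sigma (x s))ᵀ) * (X t * (X s)⁻¹)ᵀ) i j

/-! ## Splitting into commuting and non-commuting degrees of freedom -/

/-- `d₀(ω)`, the dimension of the kernel of `σ(ω)`. -/
def d₀ (ω : Idx d → ℝ) : ℕ := Module.finrank ℝ (LinearMap.ker (Matrix.toLin' (M.sigma ω)))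

/-- `d₁(ω) = d² - d₀(ω)`. -/
def d₁ (ω : Idx d → ℝ) : ℕ := d ^ 2 - M.d₀ ω

/-- Index set after the rotation: the first `d₀(ω)` and the last `d₁(ω)` indices. -/
abbrev BlockIdx (ω : Idx d → ℝ) : Type := Fin (M.d₀ ω) ⊕ Fin (M.d₁ ω)

/-- `R` is an orthogonal matrix that brings `σ(ω)` into the form `diag(0, σ¹¹)` with an invertible
`d₁(ω) × d₁(ω)` matrix `σ¹¹`. -/
def IsBlockRotation (ω : Idx d → ℝ) (R : Matrix (M.BlockIdx ω) (Idx d) ℝ) : Prop :=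
  R * Rᵀ = 1 ∧ Rᵀ * R = 1 ∧
    ∃ τ : Matrix (Fin (M.d₁ ω)) (Fin (M.d₁ ω)) ℝ,
      IsUnit τ.det ∧ R * M.sigma ω * Rᵀ = fromBlocks 0 0 0 τ

variable {M} {ω : Idx d → ℝ} (R : Matrix (M.BlockIdx ω) (Idx d) ℝ)

/-- The rotated matrix `R Z Rᵗʳ`; its blocks `00`, `01`, `10`, `11` are `toBlocks₁₁`, `toBlocks₁₂`,
`toBlocks₂₁`, `toBlocks₂₂`. -/
def rot (Z : Matrix (Idx d) (Idx d) ℂ) : Matrix (M.BlockIdx ω) (M.BlockIdx ω) ℂ :=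
  cplx R * Z * (cplx R)ᵀ

/-- `σ¹¹(ω)` -/
def sigma11 : Matrix (Fin (M.d₁ ω)) (Fin (M.d₁ ω)) ℂ := (rot R (cplx (M.sigma ω))).toBlocks₂₂

/-- `D⁰⁰(ω)` -/
def D00 : Matrix (Fin (M.d₀ ω)) (Fin (M.d₀ ω)) ℂ := (rot R (cplx (M.D ω))).toBlocks₁₁

/-- `D⁰¹(ω)` -/
def D01 : Matrix (Fin (M.d₀ ω)) (Fin (M.d₁ ω)) ℂ := (rot R (cplx (M.D ω))).toBlocks₁₂

/-- `D¹⁰(ω)` -/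
def D10 : Matrix (Fin (M.d₁ ω)) (Fin (M.d₀ ω)) ℂ := (rot R (cplx (M.D ω))).toBlocks₂₁

/-- `D¹¹(ω)` -/
def D11 : Matrix (Fin (M.d₁ ω)) (Fin (M.d₁ ω)) ℂ := (rot R (cplx (M.D ω))).toBlocks₂₂

/-- `H¹¹ = (h^(re))¹¹ + ¼ {(σ¹¹)⁻¹, D¹¹}` -/
def H11 : Matrix (Fin (M.d₁ ω)) (Fin (M.d₁ ω)) ℂ :=
  (rot R M.hRe).toBlocks₂₂
    + (1 / 4 : ℂ) • ((sigma11 R)⁻¹ * D11 R + D11 R * (sigma11 R)⁻¹)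

/-- `H¹⁰ = ½ (σ¹¹)⁻¹ D¹⁰ - (i/2) B¹⁰ + (h^(re))¹⁰` -/
def H10 : Matrix (Fin (M.d₁ ω)) (Fin (M.d₀ ω)) ℂ :=
  (1 / 2 : ℂ) • ((sigma11 R)⁻¹ * D10 R) - (Complex.I / 2) • (rot R M.B).toBlocks₂₁
    + (rot R M.hRe).toBlocks₂₁

/-- `H⁰¹ = ½ D⁰¹ (σ¹¹)⁻¹ + (i/2) B⁰¹ + (h^(re))⁰¹` -/
def H01 : Matrix (Fin (M.d₀ ω)) (Fin (M.d₁ ω)) ℂ :=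
  (1 / 2 : ℂ) • (D01 R * (sigma11 R)⁻¹) + (Complex.I / 2) • (rot R M.B).toBlocks₁₂
    + (rot R M.hRe).toBlocks₁₂

/-- `K¹¹ = A¹¹ + B¹¹ + (i/2) [(σ¹¹)⁻¹, D¹¹]` -/
def K11 : Matrix (Fin (M.d₁ ω)) (Fin (M.d₁ ω)) ℂ :=
  (rot R M.A).toBlocks₂₂ + (rot R M.B).toBlocks₂₂
    + (Complex.I / 2) • ((sigma11 R)⁻¹ * D11 R - D11 R * (sigma11 R)⁻¹)

end MeanFieldModel

/-! ## Direct integrals and the field of Weyl algebras -/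

/-- A measurable field of Hilbert spaces `s ↦ H s`, given by its space of measurable sections. -/
structure MeasurableHilbertField {S : Type*} [MeasurableSpace S] (H : S → Type*)
    [∀ s, NormedAddCommGroup (H s)] [∀ s, InnerProductSpace ℂ (H s)] where
  sections : Submodule ℂ (∀ s, H s)
  measurable_norm : ∀ ξ ∈ sections, Measurable fun s => ‖ξ s‖
  mem_of_measurable_inner : ∀ η : ∀ s, H s,
    (∀ ξ ∈ sections, Measurable fun s => ⟪ξ s, η s⟫_ℂ) → η ∈ sections
  exists_fundamental : ∃ e : ℕ → ∀ s, H s, (∀ n, e n ∈ sections) ∧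
    ∀ s, Dense (Submodule.span ℂ (range fun n => e n s) : Set (H s))

/-- `ξ` represents a vector of the direct integral Hilbert space `∫⊕ H s dm(s)`: it is a measurable
section with `∫ ‖ξ s‖² dm(s) < ∞`. -/
def MeasurableHilbertField.MemDirectIntegral {S : Type*} [MeasurableSpace S] {H : S → Type*}
    [∀ s, NormedAddCommGroup (H s)] [∀ s, InnerProductSpace ℂ (H s)]
    (𝓗 : MeasurableHilbertField H) (m : Measure S) (ξ : ∀ s, H s) : Prop :=
  ξ ∈ 𝓗.sections ∧ ∫⁻ s, ‖ξ s‖ₑ ^ 2 ∂m < ∞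

/-- A measurable field `ω ↦ W_ω(r)`, `ω ∈ 𝒮`, of regular Hilbert space representations of the Weyl
relations with symplectic matrices `σ(ω)`. -/
structure RegularWeylField {d : ℕ} (M : MeanFieldModel d) {H : M.averages → Type*}
    [∀ ω, NormedAddCommGroup (H ω)] [∀ ω, InnerProductSpace ℂ (H ω)] [∀ ω, CompleteSpace (H ω)]
    (𝓗 : MeasurableHilbertField H) where
  W : ∀ ω : M.averages, (Idx d → ℝ) → (H ω →L[ℂ] H ω)
  W_zero : ∀ ω, W ω 0 = 1
  W_adjoint : ∀ ω r, ContinuousLinearMap.adjoint (W ω r) = W ω (-r)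
  W_mul : ∀ ω r₁ r₂, W ω r₁ * W ω r₂ =
    Complex.exp (-(Complex.I / 2) * ((r₁ ⬝ᵥ (M.sigma ω *ᵥ r₂) : ℝ) : ℂ)) • W ω (r₁ + r₂)
  W_regular : ∀ ω r ψ, Continuous fun t : ℝ => W ω (t • r) ψ
  W_measurable : ∀ r, ∀ ξ ∈ 𝓗.sections, (fun ω => W ω r (ξ ω)) ∈ 𝓗.sections

/-- `S T - T S`, for (unbounded) operators written as functions. -/
def comm {E : Type*} [AddCommGroup E] (S T : E → E) : E → E := fun ψ => S (T ψ) - T (S ψ)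

/-- `S T + T S`, for (unbounded) operators written as functions. -/
def anticomm {E : Type*} [AddCommGroup E] (S T : E → E) : E → E := fun ψ => S (T ψ) + T (S ψ)

namespace RegularWeylField

variable {d : ℕ} {M : MeanFieldModel d} {H : M.averages → Type*}
  [∀ ω, NormedAddCommGroup (H ω)] [∀ ω, InnerProductSpace ℂ (H ω)] [∀ ω, CompleteSpace (H ω)]
  {𝓗 : MeasurableHilbertField H} (𝒲 : RegularWeylField M 𝓗)

/-- The fluctuation operator `F_μ(ω)`: the self-adjoint generator of `t ↦ W_ω(t e_μ)`, that is
`W_ω(t e_μ) = exp(i t F_μ(ω))`. It is unbounded; the value is meaningful on its domain, where the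
derivative exists. -/
def F (ω : M.averages) (μ : Idx d) (ψ : H ω) : H ω :=
  (-Complex.I) • deriv (fun t : ℝ => 𝒲.W ω (t • Pi.single μ 1) ψ) 0

/-- The rotated operators `G_α(ω) = ∑_μ R_{αμ} F_μ(ω)`. -/
def G (ω : M.averages) (R : Matrix (M.BlockIdx ω) (Idx d) ℝ) (α : M.BlockIdx (ω : Idx d → ℝ))
    (ψ : H ω) : H ω :=
  ∑ μ, (R α μ : ℂ) • 𝒲.F ω μ ψ

/-- The vectors on which all products of at most two fluctuation operators are defined: `ψ` such
that `r ↦ W_ω(r) ψ` is twice continuously differentiable. -/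
def IsRegularVector (ω : M.averages) (ψ : H ω) : Prop :=
  ContDiff ℝ 2 fun r : Idx d → ℝ => 𝒲.W ω r ψ

/-- The value at `ω` of the operator-valued function `W^f_r`, that is `f(ω) W_ω(r(ω))`. -/
def Wf (f : (Idx d → ℝ) → ℂ) (r : (Idx d → ℝ) → Idx d → ℝ) (ω : M.averages) : H ω →L[ℂ] H ω :=
  f ω • 𝒲.W ω (r ω)

/-! ### The dynamics -/

/-- The mesoscopic map `Φ^ω_t [W_ω(a)] = exp(-½ a · Y_t a) W_ω(X_tᵗʳ a)`, along the trajectory `x`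
that starts at `ω`. -/
def PhiW (ω : M.averages) (x : ℝ → Idx d → ℝ) (X : ℝ → Matrix (Idx d) (Idx d) ℝ) (t : ℝ)
    (a : Idx d → ℝ) : H ω →L[ℂ] H ω :=
  Complex.exp (-(1 / 2) * ((a ⬝ᵥ (M.Y x X t *ᵥ a) : ℝ) : ℂ)) • 𝒲.W ω ((X t)ᵀ *ᵥ a)

/-- The value at `ω` of `Φ^ext_t [W^f_r]`, that is `f(ω_t) Φ^ω_t [W_ω(r(ω_t))]`. -/
def PhiExt (x : M.averages → ℝ → Idx d → ℝ) (X : M.averages → ℝ → Matrix (Idx d) (Idx d) ℝ)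
    (t : ℝ) (f : (Idx d → ℝ) → ℂ) (r : (Idx d → ℝ) → Idx d → ℝ) (ω : M.averages) :
    H ω →L[ℂ] H ω :=
  f (x ω t) • 𝒲.PhiW ω (x ω) (X ω) t (r (x ω t))

/-! ### The components of the generator -/

variable (f : (Idx d → ℝ) → ℂ) (r : (Idx d → ℝ) → Idx d → ℝ) (ω : M.averages)
  (R : Matrix (M.BlockIdx (ω : Idx d → ℝ)) (Idx d) ℝ)

/-- `ω̇ · ∂_ω W^f_r(ω)`: the derivative at `ω`, in the direction `ω̇ = D(ω) ω`, of
`ω' ↦ f(ω') W_ω(r(ω'))`, the label of the Weyl algebra being kept fixed. -/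
def Ldrift (ψ : H ω) : H ω :=
  fderiv ℝ (fun ω' : Idx d → ℝ => f ω' • 𝒲.W ω (r ω') ψ) (ω : Idx d → ℝ) (M.omegaDot ω)

/-- `∂ W^f_r(ω) / ∂ G_μ(ω)` for a classical (commuting) `G_μ(ω)`. As
`W_ω(r) = exp(i ∑_α s_α G_α)` with `s = R r`, replacing the commuting variable `G_μ` by `G_μ + y`
multiplies `W^f_r(ω)` by `exp(i y s_μ)`; this is the derivative in `y` at `y = 0`. -/
def dG (μ : Fin (M.d₀ ω)) : H ω →L[ℂ] H ω :=
  deriv (fun y : ℝ =>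
    Complex.exp (Complex.I * ((y * (R *ᵥ r ω) (Sum.inl μ) : ℝ) : ℂ)) • 𝒲.Wf f r ω) 0

/-- The classical term `∑_{μν} D⁰⁰_{μν} G_ν ∂W/∂G_μ`. -/
def Lcc (ψ : H ω) : H ω :=
  ∑ μ : Fin (M.d₀ ω), ∑ ν : Fin (M.d₀ ω),
    MeanFieldModel.D00 R μ ν • 𝒲.G ω R (Sum.inl ν) (𝒲.dG f r ω R μ ψ)

/-- The mixed classical-quantum term `∑_{μν} ½ D⁰¹_{μν} {G_ν, ∂W/∂G_μ}`. -/
def Lcq (ψ : H ω) : H ω :=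
  ∑ μ : Fin (M.d₀ ω), ∑ ν : Fin (M.d₁ ω),
    (MeanFieldModel.D01 R μ ν / 2) •
      anticomm (𝒲.G ω R (Sum.inr ν)) (𝒲.dG f r ω R μ) ψ

/-- The purely quantum term. -/
def Lqq (ψ : H ω) : H ω :=
  Complex.I • (∑ μ : Fin (M.d₀ ω), ∑ ν : Fin (M.d₁ ω),
      (MeanFieldModel.H01 R μ ν + MeanFieldModel.H10 R ν μ) •
        𝒲.G ω R (Sum.inl μ) (comm (𝒲.G ω R (Sum.inr ν)) (𝒲.Wf f r ω) ψ))
  + Complex.I • (∑ μ : Fin (M.d₁ ω), ∑ ν : Fin (M.d₁ ω),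
      MeanFieldModel.H11 R μ ν •
        comm (𝒲.G ω R (Sum.inr μ) ∘ 𝒲.G ω R (Sum.inr ν)) (𝒲.Wf f r ω) ψ)
  + ∑ μ : Fin (M.d₁ ω), ∑ ν : Fin (M.d₁ ω),
      MeanFieldModel.K11 R μ ν •
        (𝒲.G ω R (Sum.inr μ) (𝒲.Wf f r ω (𝒲.G ω R (Sum.inr ν) ψ))
          - (1 / 2 : ℂ) •
            anticomm (𝒲.G ω R (Sum.inr μ) ∘ 𝒲.G ω R (Sum.inr ν)) (𝒲.Wf f r ω) ψ)

/-- The component at `ω` of the generator, `L_ω [W^f_r(ω)]`. -/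
def L (ψ : H ω) : H ω :=
  𝒲.Ldrift f r ω ψ + 𝒲.Lcc f r ω R ψ + 𝒲.Lcq f r ω R ψ + 𝒲.Lqq f r ω R ψ

/-- The vectors `ψ` of `∫⊕ H ω dm(ω)` with regular values and with `F_μ ψ` in the direct integral
for every `μ`. -/
def IsCore (m : Measure M.averages) (ψ : ∀ ω, H ω) : Prop :=
  (∀ ω, 𝒲.IsRegularVector ω (ψ ω)) ∧ 𝓗.MemDirectIntegral m ψ ∧
    ∀ μ, 𝓗.MemDirectIntegral m fun ω => 𝒲.F ω μ (ψ ω)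

end RegularWeylField

/-- `g` is continuously differentiable on (a neighbourhood of) `s`. -/
def IsC1On {E E' : Type*} [NormedAddCommGroup E] [NormedSpace ℝ E] [NormedAddCommGroup E']
    [NormedSpace ℝ E'] (g : E → E') (s : Set E) : Prop :=
  ∃ U : Set E, IsOpen U ∧ s ⊆ U ∧ ContDiffOn ℝ 1 g U

end

end HybridFluctuations

/-!
Why the theorem holds.

*Weyl algebra.* If `a ↦ W_ω(a) ψ` is differentiable, then `a · F(ω)` acts on `ψ` as `-i` times the
derivative at `0` in the direction `a`, and the Weyl relations give
`[a · F, W_ω(b)] = -(a · σ b) W_ω(b)` and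
`(d/db W_ω(b))(a) ψ = i W_ω(b) (a · F) ψ - (i/2) (a · σ b) W_ω(b) ψ`. Hence every term of the
generator becomes a linear combination of `W ψ` and of the vectors `W G_ν ψ`
(`RegularWeylField.Lcc_add_Lcq_add_Lqq`), and the claim on a single Weyl algebra is the identity of
linear algebra `generator_terms_eq` between the coefficients. The inverse of `σ¹¹` is harmless: it
meets the vector `u = σ¹¹ s₁` of the commutators of the `G_ν` with `W`, the contributions of
`(σ¹¹)⁻¹ D¹¹` to `H¹¹` and `K¹¹` combine, and only `D¹¹ (σ¹¹)⁻¹ u = D¹¹ s₁` is left, as required by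
the summand `D` of `Q`. On the other side, `X₀ = 1` and `Y₀ = 0` make the right derivative at `0` of
`Φ^ext_t [W^f_r] ψ` a sum of the drift term, of `-½ (r · σ A σᵗʳ r) W ψ` from `Y_t`, and of the
derivative of `W ψ` in the direction `Qᵗʳ r` from `X_t`
(`RegularWeylField.hasDerivWithinAt_PhiExt`).

*Direct integral.* The set of the macroscopic averages is compact and `(ω_t, X_t)` solves an
autonomous equation with a `C¹` vector field. So the scalar factor and the argument of the Weyl
operator in `Φ^ext_t [W^f_r]` change at most at a uniform speed for small times
(`MeanFieldModel.exists_small_time_weight_label`). As the local Lipschitz constant of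
`a ↦ W_ω(a) ψ(ω)` is controlled by `‖ψ(ω)‖ + ∑_μ ‖F_μ ψ(ω)‖`, which is square integrable for core
vectors, the difference quotients have a square integrable bound, and dominated convergence turns
pointwise differentiability into differentiability in norm
(`MeasurableHilbertField.tendsto_of_hasDerivWithinAt`).

*Rotation and positivity.* Since `σ` is antisymmetric, orthonormal bases of its kernel and of the
orthogonal complement give a block rotation. For the last claim, `K¹¹` is multiplied by `(σ¹¹)²` on
both sides, which yields an expression in `σ`, `D` and `C` that does not refer to the rotation; it
fails to be positive for a three-level system with a weak depolarizing dissipator, a Hamiltonian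
that couples two levels, and a state with unequal populations
(`NonPositiveModel.exists_K11_not_posSemidef`).
-/

namespace HybridFluctuations

noncomputable section

/-! ### Antisymmetry of the symplectic matrix and of the drift matrix -/

namespace MeanFieldModel

variable {d : ℕ} (M : MeanFieldModel d)

lemma J_swap (α β γ : Idx d) : M.J β α γ = -M.J α β γ := by
  rw [J, J, ← trace_neg, ← neg_mul, neg_sub]

lemma transpose_sigmaC (ω : Idx d → ℝ) : (M.sigmaC ω)ᵀ = -M.sigmaC ω := by
  ext μ ν
  simp only [sigmaC, transpose_apply, of_apply, Matrix.neg_apply, M.J_swap μ ν, neg_mul,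
    Finset.sum_neg_distrib, mul_neg]

lemma transpose_DC (ω : Idx d → ℝ) : (M.DC ω)ᵀ = -M.DC ω := by
  ext μ ν
  simp only [DC, transpose_apply, of_apply, Matrix.neg_apply, M.J_swap μ ν, neg_mul,
    Finset.sum_neg_distrib, mul_neg]
  ring

lemma transpose_sigma (ω : Idx d → ℝ) : (M.sigma ω)ᵀ = -M.sigma ω := by
  ext μ ν
  have := congrFun (congrFun (M.transpose_sigmaC ω) μ) ν
  simpa [sigma, rePart] using congrArg Complex.re this

lemma dotProduct_sigma_swap (ω a b : Idx d → ℝ) :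
    b ⬝ᵥ (M.sigma ω *ᵥ a) = -(a ⬝ᵥ (M.sigma ω *ᵥ b)) := by
  rw [dotProduct_mulVec, ← mulVec_transpose, transpose_sigma, neg_mulVec, neg_dotProduct,
    dotProduct_comm]

lemma dotProduct_sigma_self (ω a : Idx d → ℝ) : a ⬝ᵥ (M.sigma ω *ᵥ a) = 0 := by
  have := M.dotProduct_sigma_swap ω a a
  linarith

end MeanFieldModel

/-! ### Fluctuation operators on differentiable vectors -/

namespace RegularWeylField

variable {d : ℕ} {M : MeanFieldModel d} {H : M.averages → Type*}
  [∀ ω, NormedAddCommGroup (H ω)] [∀ ω, InnerProductSpace ℂ (H ω)] [∀ ω, CompleteSpace (H ω)]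
  {𝓗 : MeasurableHilbertField H} (𝒲 : RegularWeylField M 𝓗) (ω : M.averages)

lemma W_apply_W (a b : Idx d → ℝ) (ψ : H ω) : 𝒲.W ω a (𝒲.W ω b ψ) =
    Complex.exp (-(Complex.I / 2) * ((a ⬝ᵥ (M.sigma ω *ᵥ b) : ℝ) : ℂ)) • 𝒲.W ω (a + b) ψ := by
  have := congrArg (fun T : H ω →L[ℂ] H ω => T ψ) (𝒲.W_mul ω a b)
  simpa using this

lemma norm_W_apply (a : Idx d → ℝ) (ψ : H ω) : ‖𝒲.W ω a ψ‖ = ‖ψ‖ := by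
  have h : ⟪𝒲.W ω a ψ, 𝒲.W ω a ψ⟫_ℂ = ⟪ψ, ψ⟫_ℂ := by
    rw [← ContinuousLinearMap.adjoint_inner_right, 𝒲.W_adjoint, W_apply_W, neg_dotProduct,
      M.dotProduct_sigma_self]
    simp [𝒲.W_zero]
  rw [inner_self_eq_norm_sq_to_K, inner_self_eq_norm_sq_to_K] at h
  have h' : ‖𝒲.W ω a ψ‖ ^ 2 = ‖ψ‖ ^ 2 := by exact_mod_cast h
  exact (pow_left_inj₀ (norm_nonneg _) (norm_nonneg _) two_ne_zero).1 h'

/-- The fluctuation operator `a · F(ω)` smeared with `a ∈ ℝ^{d²}`, as the derivative of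
`a ↦ W_ω(a) ψ` at `0` in the direction `a`; linear in `a` by construction, and meaningful on the
vectors `ψ` for which this derivative exists. -/
def fluct (a : Idx d → ℝ) (ψ : H ω) : H ω :=
  (-Complex.I) • fderiv ℝ (fun r => 𝒲.W ω r ψ) 0 a

variable {ω} {ψ : H ω}

/-- `W_ω(b)` preserves smoothness of vectors. -/
lemma contDiff_W_apply {n : WithTop ℕ∞} (h : ContDiff ℝ n fun r => 𝒲.W ω r ψ) (b : Idx d → ℝ) :
    ContDiff ℝ n fun r => 𝒲.W ω r (𝒲.W ω b ψ) := by
  have e : (fun r => 𝒲.W ω r (𝒲.W ω b ψ)) = fun r =>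
      Complex.exp (-(Complex.I / 2) * ((r ⬝ᵥ (M.sigma ω *ᵥ b) : ℝ) : ℂ)) • 𝒲.W ω (r + b) ψ :=
    funext fun r => 𝒲.W_apply_W ω r b ψ
  rw [e]
  refine ContDiff.smul ?_ (h.comp (contDiff_id.add contDiff_const))
  have h1 : ContDiff ℝ n fun r : Idx d → ℝ => r ⬝ᵥ (M.sigma ω *ᵥ b) :=
    ContDiff.sum fun i _ => (contDiff_apply ℝ ℝ i).mul contDiff_const
  exact (contDiff_const.mul (Complex.ofRealCLM.contDiff.comp h1)).cexp

lemma hasDerivAt_W_line (h : Differentiable ℝ fun r => 𝒲.W ω r ψ) (a b : Idx d → ℝ) :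
    HasDerivAt (fun t : ℝ => 𝒲.W ω (b + t • a) ψ) (fderiv ℝ (fun r => 𝒲.W ω r ψ) b a) 0 := by
  have h1 : HasDerivAt (fun t : ℝ => b + t • a) a 0 := by
    simpa using ((hasDerivAt_id (0 : ℝ)).smul_const a).const_add b
  have h2 : HasFDerivAt (fun r => 𝒲.W ω r ψ) (fderiv ℝ (fun r => 𝒲.W ω r ψ) b)
      (b + (0 : ℝ) • a) := by
    simpa using (h b).hasFDerivAt
  exact h2.comp_hasDerivAt 0 h1

lemma hasDerivAt_phase_line (a b : Idx d → ℝ) (c : ℝ)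
    (h : Differentiable ℝ fun r => 𝒲.W ω r ψ) :
    HasDerivAt (fun t : ℝ => Complex.exp (-(Complex.I / 2) * ((t * c : ℝ) : ℂ)) •
        𝒲.W ω (b + t • a) ψ)
      (fderiv ℝ (fun r => 𝒲.W ω r ψ) b a + (-(Complex.I / 2) * c) • 𝒲.W ω b ψ) 0 := by
  have h1 : HasDerivAt (fun t : ℝ => Complex.exp (-(Complex.I / 2) * ((t * c : ℝ) : ℂ)))
      (-(Complex.I / 2) * c) 0 := by
    have := (((hasDerivAt_id (0 : ℝ)).mul_const c).ofReal_comp.const_mul (-(Complex.I / 2))).cexp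
    simpa using this
  refine (h1.smul (𝒲.hasDerivAt_W_line h a b)).congr_deriv ?_
  simp

lemma F_eq_fluct (h : Differentiable ℝ fun r => 𝒲.W ω r ψ) (μ : Idx d) :
    𝒲.F ω μ ψ = 𝒲.fluct ω (Pi.single μ 1) ψ := by
  have := (𝒲.hasDerivAt_W_line h (Pi.single μ 1) 0).deriv
  simp only [zero_add] at this
  rw [F, this, fluct]

lemma fluct_sum {ι : Type*} (s : Finset ι) (c : ι → ℝ) (a : ι → Idx d → ℝ) (ψ : H ω) :
    𝒲.fluct ω (∑ k ∈ s, c k • a k) ψ = ∑ k ∈ s, (c k : ℂ) • 𝒲.fluct ω (a k) ψ := by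
  simp only [fluct, map_sum, map_smul, Finset.smul_sum]
  refine Finset.sum_congr rfl fun k _ => ?_
  rw [smul_comm, Complex.coe_smul]

lemma fluct_eq_sum_F (h : Differentiable ℝ fun r => 𝒲.W ω r ψ) (a : Idx d → ℝ) :
    𝒲.fluct ω a ψ = ∑ μ, (a μ : ℂ) • 𝒲.F ω μ ψ := by
  simp only [𝒲.F_eq_fluct h, ← fluct_sum]
  congr 1
  ext ν
  simp [Finset.sum_apply, Pi.single_apply]

lemma G_eq_fluct (h : Differentiable ℝ fun r => 𝒲.W ω r ψ)
    (R : Matrix (M.BlockIdx ω) (Idx d) ℝ) (α : M.BlockIdx (ω : Idx d → ℝ)) :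
    𝒲.G ω R α ψ = 𝒲.fluct ω (R α) ψ := by
  rw [𝒲.fluct_eq_sum_F h, G]

lemma fluct_W_apply (h : ContDiff ℝ 1 fun r => 𝒲.W ω r ψ) (a b : Idx d → ℝ) :
    𝒲.fluct ω a (𝒲.W ω b ψ) = (-Complex.I) • fderiv ℝ (fun r => 𝒲.W ω r ψ) b a
      - ((1 / 2 : ℂ) * (a ⬝ᵥ (M.sigma ω *ᵥ b) : ℝ)) • 𝒲.W ω b ψ := by
  have hd : Differentiable ℝ fun r => 𝒲.W ω r ψ := h.differentiable one_ne_zero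
  have h1 := 𝒲.hasDerivAt_W_line ((𝒲.contDiff_W_apply h b).differentiable one_ne_zero) a 0
  have h2 := 𝒲.hasDerivAt_phase_line a b (a ⬝ᵥ (M.sigma ω *ᵥ b)) hd
  have e : (fun t : ℝ => 𝒲.W ω (0 + t • a) (𝒲.W ω b ψ)) = fun t : ℝ =>
      Complex.exp (-(Complex.I / 2) * ((t * (a ⬝ᵥ (M.sigma ω *ᵥ b)) : ℝ) : ℂ)) •
        𝒲.W ω (b + t • a) ψ := by
    ext t
    rw [W_apply_W, zero_add, smul_dotProduct, add_comm, smul_eq_mul]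
  rw [e] at h1
  rw [fluct, h1.unique h2, smul_add, smul_smul, sub_eq_add_neg, ← neg_smul]
  congr 2
  linear_combination ((a ⬝ᵥ (M.sigma ω *ᵥ b) : ℝ) : ℂ) / 2 * Complex.I_sq

lemma W_apply_fluct (h : Differentiable ℝ fun r => 𝒲.W ω r ψ) (a b : Idx d → ℝ) :
    𝒲.W ω b (𝒲.fluct ω a ψ) = (-Complex.I) • fderiv ℝ (fun r => 𝒲.W ω r ψ) b a
      + ((1 / 2 : ℂ) * (a ⬝ᵥ (M.sigma ω *ᵥ b) : ℝ)) • 𝒲.W ω b ψ := by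
  have h1 := (((𝒲.W ω b).restrictScalars ℝ).hasFDerivAt (x := 𝒲.W ω ((0 : Idx d → ℝ) +
    (0 : ℝ) • a) ψ)).comp_hasDerivAt (0 : ℝ) (𝒲.hasDerivAt_W_line h a 0)
  have h2 := 𝒲.hasDerivAt_phase_line a b (b ⬝ᵥ (M.sigma ω *ᵥ a)) h
  have e : (⇑((𝒲.W ω b).restrictScalars ℝ) ∘ fun t : ℝ => 𝒲.W ω (0 + t • a) ψ) = fun t : ℝ =>
      Complex.exp (-(Complex.I / 2) * ((t * (b ⬝ᵥ (M.sigma ω *ᵥ a)) : ℝ) : ℂ)) •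
        𝒲.W ω (b + t • a) ψ := by
    ext t
    simp only [Function.comp, ContinuousLinearMap.coe_restrictScalars']
    rw [W_apply_W, zero_add, mulVec_smul, dotProduct_smul, smul_eq_mul]
  rw [e] at h1
  have h3 := h1.unique h2
  rw [ContinuousLinearMap.coe_restrictScalars'] at h3
  rw [fluct, map_smul, h3, smul_add, smul_smul, M.dotProduct_sigma_swap]
  congr 2
  push_cast
  linear_combination -((a ⬝ᵥ (M.sigma ω *ᵥ b) : ℝ) : ℂ) / 2 * Complex.I_sq

/-- The commutation relation `[a · F, W(b)] = -(a · σ b) W(b)`. -/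
lemma fluct_W_apply_comm (h : ContDiff ℝ 1 fun r => 𝒲.W ω r ψ) (a b : Idx d → ℝ) :
    𝒲.fluct ω a (𝒲.W ω b ψ) = 𝒲.W ω b (𝒲.fluct ω a ψ)
      - ((a ⬝ᵥ (M.sigma ω *ᵥ b) : ℝ) : ℂ) • 𝒲.W ω b ψ := by
  rw [𝒲.fluct_W_apply h, 𝒲.W_apply_fluct (h.differentiable one_ne_zero)]
  module

/-- The derivative of `b ↦ W(b) ψ`, with the fluctuation operator to the right of `W(b)`. -/
lemma fderiv_W_apply (h : Differentiable ℝ fun r => 𝒲.W ω r ψ) (a b : Idx d → ℝ) :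
    fderiv ℝ (fun r => 𝒲.W ω r ψ) b a = Complex.I • 𝒲.W ω b (𝒲.fluct ω a ψ)
      - (Complex.I / 2 * (a ⬝ᵥ (M.sigma ω *ᵥ b) : ℝ)) • 𝒲.W ω b ψ := by
  rw [𝒲.W_apply_fluct h, smul_add, smul_smul, smul_smul]
  have : Complex.I * -Complex.I = 1 := by simp
  rw [this]
  module

/-- Fluctuation operators map twice differentiable vectors to differentiable ones. -/
lemma contDiff_fluct (h : ContDiff ℝ 2 fun r => 𝒲.W ω r ψ) (a : Idx d → ℝ) :
    ContDiff ℝ 1 fun r => 𝒲.W ω r (𝒲.fluct ω a ψ) := by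
  have e : (fun r => 𝒲.W ω r (𝒲.fluct ω a ψ)) = fun r =>
      (-Complex.I) • fderiv ℝ (fun r => 𝒲.W ω r ψ) r a
      + ((1 / 2 : ℂ) * (a ⬝ᵥ (M.sigma ω *ᵥ r) : ℝ)) • 𝒲.W ω r ψ :=
    funext fun r => 𝒲.W_apply_fluct (h.differentiable two_ne_zero) a r
  rw [e]
  have h1 : ContDiff ℝ 1 (fderiv ℝ fun r => 𝒲.W ω r ψ) := h.fderiv_right (by norm_num)
  have h3 : ∀ i, ContDiff ℝ 1 fun r : Idx d → ℝ => (M.sigma ω *ᵥ r) i := fun i => by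
    change ContDiff ℝ 1 fun r : Idx d → ℝ => ∑ j, M.sigma ω i j * r j
    exact ContDiff.sum fun j _ => contDiff_const.mul (contDiff_apply ℝ ℝ j)
  have h2 : ContDiff ℝ 1 fun r : Idx d → ℝ => a ⬝ᵥ (M.sigma ω *ᵥ r) :=
    ContDiff.sum fun i _ => contDiff_const.mul (h3 i)
  exact ((h1.clm_apply contDiff_const).const_smul _).add
    ((contDiff_const.mul (Complex.ofRealCLM.contDiff.comp h2)).smul (h.of_le (by norm_num)))

lemma differentiable_W_smul (h : Differentiable ℝ fun r => 𝒲.W ω r ψ) (c : ℂ) :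
    Differentiable ℝ fun r => 𝒲.W ω r (c • ψ) := by
  simp only [map_smul]
  exact h.const_smul c

lemma differentiable_W_sub {φ : H ω} (h : Differentiable ℝ fun r => 𝒲.W ω r ψ)
    (h' : Differentiable ℝ fun r => 𝒲.W ω r φ) :
    Differentiable ℝ fun r => 𝒲.W ω r (ψ - φ) := by
  simp only [map_sub]
  exact h.sub h'

lemma fluct_sub_smul {φ : H ω} (h : Differentiable ℝ fun r => 𝒲.W ω r ψ)
    (h' : Differentiable ℝ fun r => 𝒲.W ω r φ) (c : ℂ) (a : Idx d → ℝ) :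
    𝒲.fluct ω a (ψ - c • φ) = 𝒲.fluct ω a ψ - c • 𝒲.fluct ω a φ := by
  have e : (fun r => 𝒲.W ω r (ψ - c • φ)) = (fun r => 𝒲.W ω r ψ) - c • fun r => 𝒲.W ω r φ := by
    ext r; simp
  rw [fluct, fluct, fluct, e, fderiv_sub (h 0) ((h' 0).const_smul c), fderiv_const_smul (h' 0)]
  simp only [_root_.sub_apply, _root_.smul_apply, smul_sub]
  rw [smul_comm]

lemma fluct_smul (h : Differentiable ℝ fun r => 𝒲.W ω r ψ) (c : ℂ) (a : Idx d → ℝ) :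
    𝒲.fluct ω a (c • ψ) = c • 𝒲.fluct ω a ψ := by
  have e : (fun r => 𝒲.W ω r (c • ψ)) = c • fun r => 𝒲.W ω r ψ := by
    ext r; simp
  rw [fluct, fluct, e, fderiv_const_smul (h 0), _root_.smul_apply, smul_comm]

end RegularWeylField

/-! ### The linear algebra behind the form of the generator -/

section LinearCombinations

variable {ι κ E : Type*} [Fintype ι] [Fintype κ] [AddCommGroup E] [Module ℂ E]

lemma sum_sum_smul_left (Z : Matrix ι κ ℂ) (a : ι → ℂ) (P : κ → E) :
    ∑ μ, ∑ ν, (Z μ ν * a μ) • P ν = Fintype.linearCombination ℂ P (a ᵥ* Z) := by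
  rw [Finset.sum_comm]
  simp only [Fintype.linearCombination_apply, vecMul, dotProduct, Finset.sum_smul, mul_comm]

lemma sum_sum_smul_right (Z : Matrix ι κ ℂ) (b : κ → ℂ) (P : ι → E) :
    ∑ μ, ∑ ν, (Z μ ν * b ν) • P μ = Fintype.linearCombination ℂ P (Z *ᵥ b) := by
  simp only [Fintype.linearCombination_apply, mulVec, dotProduct, Finset.sum_smul]

lemma sum_sum_smul_const (Z : Matrix ι κ ℂ) (a : ι → ℂ) (b : κ → ℂ) (w : E) :
    ∑ μ, ∑ ν, (Z μ ν * a μ * b ν) • w = (a ⬝ᵥ (Z *ᵥ b)) • w := by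
  simp only [mulVec, dotProduct, ← Finset.sum_smul, Finset.mul_sum]
  congr 1
  exact Finset.sum_congr rfl fun μ _ => Finset.sum_congr rfl fun ν _ => by ring

end LinearCombinations

lemma dotProduct_mulVec_eq_zero_of_antisymm {κ : Type*} [Fintype κ] {Z : Matrix κ κ ℂ}
    (hZ : Zᵀ = -Z) (a : κ → ℂ) : a ⬝ᵥ (Z *ᵥ a) = 0 := by
  have : a ⬝ᵥ (Z *ᵥ a) = -(a ⬝ᵥ (Z *ᵥ a)) := by
    conv_lhs => rw [dotProduct_mulVec, ← mulVec_transpose, hZ, neg_mulVec, neg_dotProduct,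
      dotProduct_comm]
  exact self_eq_neg.1 this

/-- Both sides are linear combinations of the vectors `P₀ ν`, `P₁ ν` and `w`. In the application
`w = W(r) ψ` and `P ν = W(r) G_ν ψ`, and `u = σ¹¹ s₁` collects the numbers `-[G_ν, W(r)] W(r)⁻¹`.
The left side is the sum of the classical, mixed and quantum terms of the generator after all
commutators have been carried out; the right side is the part of the time derivative that comes from
`X_t` and `Y_t`. The terms `(σ¹¹)⁻¹ D¹¹` and `D¹¹ (σ¹¹)⁻¹` of `H¹¹` and `K¹¹` combine in such a way
that only `D¹¹ (σ¹¹)⁻¹ u = D¹¹ s₁` survives. -/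
lemma generator_terms_eq {ι κ E : Type*} [Fintype ι] [Fintype κ] [DecidableEq κ] [AddCommGroup E]
    [Module ℂ E]
    {A11 B11 h11 D11 σ : Matrix κ κ ℂ} {B01 h01 D01 : Matrix ι κ ℂ} {B10 h10 D10 : Matrix κ ι ℂ}
    (D00 : Matrix ι ι ℂ) (hB11 : B11ᵀ = -B11) (hh11 : h11ᵀ = h11)
    (hD11 : D11ᵀ = -D11) (hσ : σᵀ = -σ) (hdet : IsUnit σ.det)
    (hB10 : B10ᵀ = -B01) (hh10 : h10ᵀ = h01) (hD10 : D10ᵀ = -D01) (hA11 : A11ᵀ = A11)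
    (s₀ : ι → ℂ) (s₁ u : κ → ℂ) (hu : u = σ *ᵥ s₁) (P₀ : ι → E) (P₁ : κ → E) (w : E)
    {H01 : Matrix ι κ ℂ} {H10 : Matrix κ ι ℂ} {H11 K11 : Matrix κ κ ℂ}
    (hH01 : H01 = (1 / 2 : ℂ) • (D01 * σ⁻¹) + (Complex.I / 2) • B01 + h01)
    (hH10 : H10 = (1 / 2 : ℂ) • (σ⁻¹ * D10) - (Complex.I / 2) • B10 + h10)
    (hH11 : H11 = h11 + (1 / 4 : ℂ) • (σ⁻¹ * D11 + D11 * σ⁻¹))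
    (hK11 : K11 = A11 + B11 + (Complex.I / 2) • (σ⁻¹ * D11 - D11 * σ⁻¹)) :
    (∑ μ, ∑ ν, D00 μ ν • (Complex.I * s₀ μ) • P₀ ν)
      + (∑ μ, ∑ ν, (D01 μ ν / 2) • (Complex.I * s₀ μ) • ((2 : ℂ) • P₁ ν - u ν • w))
      + (Complex.I • (∑ μ, ∑ ν, (H01 μ ν + H10 ν μ) • (-u ν) • P₀ μ)
        + Complex.I • (∑ μ, ∑ ν, H11 μ ν • (-(u μ • P₁ ν) - u ν • P₁ μ + (u μ * u ν) • w))
        + ∑ μ, ∑ ν, K11 μ ν • (1 / 2 : ℂ) • (u ν • P₁ μ - u μ • P₁ ν - (u μ * u ν) • w))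
    = (-(1 / 2) * (u ⬝ᵥ (A11 *ᵥ u))) • w
      + (∑ ν, (-Complex.I • (B01 *ᵥ u) - (2 : ℂ) • (h01 *ᵥ u) + D00ᵀ *ᵥ s₀ + D10ᵀ *ᵥ s₁) ν •
          Complex.I • P₀ ν)
      + ∑ ν, (-Complex.I • (B11 *ᵥ u) - (2 : ℂ) • (h11 *ᵥ u) + D01ᵀ *ᵥ s₀ + D11ᵀ *ᵥ s₁) ν •
          (Complex.I • P₁ ν - (Complex.I / 2 * u ν) • w) := by
  have hs : σ⁻¹ *ᵥ u = s₁ := by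
    rw [hu, mulVec_mulVec, nonsing_inv_mul _ hdet, one_mulVec]
  have hσi : σ⁻¹ᵀ = -σ⁻¹ := by
    rw [transpose_nonsing_inv, hσ]
    refine inv_eq_left_inv ?_
    rw [neg_mul_neg, nonsing_inv_mul _ hdet]
  -- the vectors and numbers that occur after the summations
  have hN : (H01 + H10ᵀ) *ᵥ u
      = D01 *ᵥ s₁ + Complex.I • (B01 *ᵥ u) + (2 : ℂ) • (h01 *ᵥ u) := by
    rw [hH01, hH10, transpose_add, transpose_sub, transpose_smul, transpose_smul, transpose_mul,
      hσi, hB10, hh10, hD10, Matrix.neg_mul, Matrix.mul_neg, neg_neg]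
    simp only [add_mulVec, sub_mulVec, smul_mulVec, ← mulVec_mulVec, hs, smul_neg, neg_mulVec]
    module
  have hHt : H11ᵀ = H11 := by
    rw [hH11]
    simp only [transpose_add, transpose_smul, transpose_mul, hσi, hD11, hh11, neg_mul_neg]
    rw [add_comm (D11 * _)]
  have hHu : H11 *ᵥ u + u ᵥ* H11
      = (2 : ℂ) • (h11 *ᵥ u) + (1 / 2 : ℂ) • (σ⁻¹ *ᵥ (D11 *ᵥ u) + D11 *ᵥ s₁) := by
    rw [← mulVec_transpose, hHt, hH11]
    simp only [add_mulVec, smul_mulVec, ← mulVec_mulVec, hs]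
    module
  have hcomm : (σ⁻¹ * D11 - D11 * σ⁻¹)ᵀ = -(σ⁻¹ * D11 - D11 * σ⁻¹) := by
    simp only [transpose_sub, transpose_mul, hσi, hD11, neg_mul_neg, neg_sub]
  have hKu : K11 *ᵥ u - u ᵥ* K11
      = (2 : ℂ) • (B11 *ᵥ u) + Complex.I • (σ⁻¹ *ᵥ (D11 *ᵥ u) - D11 *ᵥ s₁) := by
    rw [← mulVec_transpose, hK11, transpose_add, transpose_add, transpose_smul, hcomm, hA11, hB11]
    simp only [add_mulVec, sub_mulVec, smul_mulVec, neg_mulVec, smul_neg, ← mulVec_mulVec, hs]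
    module
  have huD : u ⬝ᵥ (σ⁻¹ *ᵥ (D11 *ᵥ u)) = u ⬝ᵥ (D11 *ᵥ s₁) := by
    rw [dotProduct_mulVec, ← mulVec_transpose, hσi, neg_mulVec, hs, dotProduct_mulVec,
      ← mulVec_transpose, hD11, neg_mulVec, mulVec_neg, neg_neg, dotProduct_comm]
  have huH : u ⬝ᵥ (H11 *ᵥ u) = u ⬝ᵥ (h11 *ᵥ u) + (1 / 2) * (u ⬝ᵥ (D11 *ᵥ s₁)) := by
    rw [hH11]
    simp only [add_mulVec, smul_mulVec, ← mulVec_mulVec, hs, dotProduct_add, dotProduct_smul, huD,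
      smul_eq_mul]
    ring
  have huB : u ⬝ᵥ (B11 *ᵥ u) = 0 := dotProduct_mulVec_eq_zero_of_antisymm hB11 u
  have huK : u ⬝ᵥ (K11 *ᵥ u) = u ⬝ᵥ (A11 *ᵥ u) := by
    rw [hK11, add_mulVec, add_mulVec, dotProduct_add, dotProduct_add, huB, smul_mulVec,
      dotProduct_smul, dotProduct_mulVec_eq_zero_of_antisymm hcomm]
    simp
  -- the sums of the left side
  have e1 : (∑ μ, ∑ ν, D00 μ ν • (Complex.I * s₀ μ) • P₀ ν)
      = Complex.I • Fintype.linearCombination ℂ P₀ (s₀ ᵥ* D00) := by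
    rw [← sum_sum_smul_left, Finset.smul_sum]
    simp only [Finset.smul_sum]
    exact Finset.sum_congr rfl fun μ _ => Finset.sum_congr rfl fun ν _ => by module
  have e2 : (∑ μ, ∑ ν, (D01 μ ν / 2) • (Complex.I * s₀ μ) • ((2 : ℂ) • P₁ ν - u ν • w))
      = Complex.I • Fintype.linearCombination ℂ P₁ (s₀ ᵥ* D01)
        - (Complex.I / 2) • (s₀ ⬝ᵥ (D01 *ᵥ u)) • w := by
    rw [← sum_sum_smul_left, ← sum_sum_smul_const, Finset.smul_sum, Finset.smul_sum,
      ← Finset.sum_sub_distrib]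
    simp only [Finset.smul_sum, ← Finset.sum_sub_distrib]
    exact Finset.sum_congr rfl fun μ _ => Finset.sum_congr rfl fun ν _ => by module
  have e3 : (∑ μ, ∑ ν, (H01 μ ν + H10 ν μ) • (-u ν) • P₀ μ)
      = -Fintype.linearCombination ℂ P₀ ((H01 + H10ᵀ) *ᵥ u) := by
    rw [← sum_sum_smul_right, ← Finset.sum_neg_distrib]
    simp only [← Finset.sum_neg_distrib, Matrix.add_apply, transpose_apply]
    exact Finset.sum_congr rfl fun μ _ => Finset.sum_congr rfl fun ν _ => by module
  have e4 : (∑ μ, ∑ ν, H11 μ ν • (-(u μ • P₁ ν) - u ν • P₁ μ + (u μ * u ν) • w))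
      = -Fintype.linearCombination ℂ P₁ (H11 *ᵥ u + u ᵥ* H11) + (u ⬝ᵥ (H11 *ᵥ u)) • w := by
    rw [map_add, ← sum_sum_smul_left, ← sum_sum_smul_right, ← sum_sum_smul_const,
      ← Finset.sum_add_distrib, ← Finset.sum_neg_distrib, ← Finset.sum_add_distrib]
    simp only [← Finset.sum_add_distrib, ← Finset.sum_neg_distrib]
    exact Finset.sum_congr rfl fun μ _ => Finset.sum_congr rfl fun ν _ => by module
  have e5 : (∑ μ, ∑ ν, K11 μ ν • (1 / 2 : ℂ) • (u ν • P₁ μ - u μ • P₁ ν - (u μ * u ν) • w))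
      = (1 / 2 : ℂ) • (Fintype.linearCombination ℂ P₁ (K11 *ᵥ u - u ᵥ* K11)
        - (u ⬝ᵥ (K11 *ᵥ u)) • w) := by
    rw [map_sub, ← sum_sum_smul_left, ← sum_sum_smul_right, ← sum_sum_smul_const,
      ← Finset.sum_sub_distrib, ← Finset.sum_sub_distrib, Finset.smul_sum]
    simp only [← Finset.sum_sub_distrib, Finset.smul_sum]
    exact Finset.sum_congr rfl fun μ _ => Finset.sum_congr rfl fun ν _ => by module
  -- the sums of the right side
  have f1 : ∀ c : ι → ℂ, (∑ ν, c ν • Complex.I • P₀ ν)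
      = Complex.I • Fintype.linearCombination ℂ P₀ c := fun c => by
    rw [Fintype.linearCombination_apply, Finset.smul_sum]
    exact Finset.sum_congr rfl fun ν _ => by module
  have f2 : ∀ c : κ → ℂ, (∑ ν, c ν • (Complex.I • P₁ ν - (Complex.I / 2 * u ν) • w))
      = Complex.I • Fintype.linearCombination ℂ P₁ c
        - (Complex.I / 2 * (u ⬝ᵥ c)) • w := fun c => by
    rw [Fintype.linearCombination_apply, Finset.smul_sum, dotProduct, Finset.mul_sum,
      Finset.sum_smul, ← Finset.sum_sub_distrib]
    exact Finset.sum_congr rfl fun ν _ => by module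
  rw [e1, e2, e3, e4, e5, f1, f2, hN, hHu, hKu, huH, huK, hD10, hD11, mulVec_transpose,
    mulVec_transpose]
  have hsD : u ⬝ᵥ (s₀ ᵥ* D01) = s₀ ⬝ᵥ (D01 *ᵥ u) := by
    rw [dotProduct_comm, dotProduct_mulVec]
  simp only [dotProduct_add, dotProduct_sub, dotProduct_smul, huB, hsD, map_add, map_sub, map_smul,
    neg_mulVec, map_neg, dotProduct_neg, smul_eq_mul, neg_smul]
  have hI : Complex.I * Complex.I = -1 := Complex.I_mul_I
  simp only [smul_add, smul_sub, smul_neg, smul_smul, hI]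
  have hI2 : Complex.I * (1 / 2) = Complex.I / 2 := by ring
  have hI3 : 1 / 2 * Complex.I = Complex.I / 2 := by ring
  simp only [hI2, hI3]
  module

/-! ### Rotation to commuting and non-commuting fluctuations -/

lemma cplx_mul {m n k : Type*} [Fintype n] (Z : Matrix m n ℝ) (Z' : Matrix n k ℝ) :
    cplx (Z * Z') = cplx Z * cplx Z' :=
  Matrix.map_mul (f := Complex.ofRealHom)

lemma cplx_transpose {m n : Type*} (Z : Matrix m n ℝ) : cplx Zᵀ = (cplx Z)ᵀ := rfl

lemma conjTranspose_cplx {m n : Type*} (Z : Matrix m n ℝ) : (cplx Z)ᴴ = (cplx Z)ᵀ := by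
  ext i j
  simp [cplx]

lemma cplx_one {n : Type*} [DecidableEq n] : cplx (1 : Matrix n n ℝ) = 1 := by
  ext i j
  by_cases h : i = j <;> simp [cplx, Matrix.one_apply, h]

lemma cplx_mulVec {m n : Type*} [Fintype n] (Z : Matrix m n ℝ) (a : n → ℝ) (i : m) :
    (((Z *ᵥ a) i : ℝ) : ℂ) = (cplx Z *ᵥ fun j => (a j : ℂ)) i := by
  simp [mulVec, dotProduct, cplx]

namespace MeanFieldModel

variable {d : ℕ} (M : MeanFieldModel d) {ω : Idx d → ℝ}

lemma transpose_A : M.Aᵀ = M.A := by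
  rw [A, transpose_smul, transpose_add, transpose_transpose, add_comm]

lemma transpose_B : M.Bᵀ = -M.B := by
  rw [B, transpose_smul, transpose_sub, transpose_transpose, ← smul_neg, neg_sub]

lemma transpose_hRe : M.hReᵀ = M.hRe := by
  ext μ ν
  have := congrArg Complex.re (M.h_hermitian.apply μ ν)
  simpa [hRe, cplx, rePart] using this

lemma transpose_QC_mulVec (ω : Idx d → ℝ) (a : Idx d → ℂ) : (M.QC ω)ᵀ *ᵥ a =
    -Complex.I • (M.B *ᵥ (M.sigmaC ω *ᵥ a)) - (2 : ℂ) • (M.hRe *ᵥ (M.sigmaC ω *ᵥ a))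
      + (M.DC ω)ᵀ *ᵥ a := by
  rw [QC, transpose_add, transpose_smul, transpose_mul, Btilde, transpose_add, transpose_smul,
    transpose_B, transpose_hRe, transpose_sigmaC]
  simp only [add_mulVec, smul_mulVec, ← mulVec_mulVec, neg_mulVec, mulVec_neg]
  have hI : Complex.I * (2 * Complex.I) = -2 := by
    linear_combination 2 * Complex.I_mul_I
  simp only [smul_add, smul_neg, smul_smul, neg_mul, hI]
  module

variable {M} {R : Matrix (M.BlockIdx ω) (Idx d) ℝ}

lemma rot_transpose (Z : Matrix (Idx d) (Idx d) ℂ) : (rot R Z)ᵀ = rot R Zᵀ := by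
  simp only [rot, transpose_mul, transpose_transpose, Matrix.mul_assoc]

lemma rot_neg (Z : Matrix (Idx d) (Idx d) ℂ) : rot R (-Z) = -rot R Z := by
  simp [rot]

namespace IsBlockRotation

variable (hR : M.IsBlockRotation ω R)
include hR

lemma cplx_transpose_mul : (cplx R)ᵀ * cplx R = 1 := by
  rw [← cplx_transpose, ← cplx_mul, hR.2.1, cplx_one]

lemma rot_mul (Z Z' : Matrix (Idx d) (Idx d) ℂ) : rot R (Z * Z') = rot R Z * rot R Z' := by
  simp only [rot, Matrix.mul_assoc]
  rw [← Matrix.mul_assoc (cplx R)ᵀ (cplx R), hR.cplx_transpose_mul, Matrix.one_mul]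

lemma rot_mulVec (Z : Matrix (Idx d) (Idx d) ℂ) (a : Idx d → ℂ) :
    cplx R *ᵥ (Z *ᵥ a) = rot R Z *ᵥ (cplx R *ᵥ a) := by
  rw [rot, mulVec_mulVec, mulVec_mulVec, Matrix.mul_assoc _ _ (cplx R), hR.cplx_transpose_mul,
    Matrix.mul_one]

lemma rot_sigmaC : rot R (M.sigmaC ω) = fromBlocks 0 0 0 (sigma11 R) := by
  obtain ⟨-, -, τ, -, h⟩ := hR
  have h1 : rot R (cplx (M.sigma ω)) = fromBlocks 0 0 0 (cplx τ) := by
    rw [rot, ← cplx_transpose, ← cplx_mul, ← cplx_mul, h]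
    ext (i | i) (j | j) <;> simp [cplx]
  rw [sigma11, ← M.cplx_sigma ω, h1, toBlocks_fromBlocks₂₂]

lemma isUnit_det_sigma11 : IsUnit (sigma11 R).det := by
  obtain ⟨-, -, τ, hτ, h⟩ := hR
  have h1 : sigma11 R = cplx τ := by
    rw [sigma11, rot, ← cplx_transpose, ← cplx_mul, ← cplx_mul, h]
    ext i j
    simp [cplx, toBlocks₂₂]
  have h2 : (cplx τ).det = ((τ.det : ℝ) : ℂ) := (RingHom.map_det Complex.ofRealHom τ).symm
  rw [h1, h2, isUnit_iff_ne_zero]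
  exact_mod_cast hτ.ne_zero

lemma transpose_sigma11 : (sigma11 R)ᵀ = -sigma11 R := by
  have h : (rot R (M.sigmaC ω))ᵀ = -rot R (M.sigmaC ω) := by
    rw [rot_transpose, transpose_sigmaC, rot_neg]
  rw [hR.rot_sigmaC, fromBlocks_transpose, fromBlocks_neg] at h
  exact (fromBlocks_inj.1 h).2.2.2

end IsBlockRotation

lemma rot_toBlocks_transpose_of_antisymm {Z : Matrix (Idx d) (Idx d) ℂ} (hZ : Zᵀ = -Z) :
    (rot R Z).toBlocks₂₂ᵀ = -(rot R Z).toBlocks₂₂ ∧ (rot R Z).toBlocks₂₁ᵀ = -(rot R Z).toBlocks₁₂ := by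
  have h : (rot R Z)ᵀ = -rot R Z := by rw [rot_transpose, hZ, rot_neg]
  exact ⟨by ext i j; exact congrFun (congrFun h (Sum.inr i)) (Sum.inr j),
    by ext i j; exact congrFun (congrFun h (Sum.inl i)) (Sum.inr j)⟩

lemma rot_toBlocks_transpose_of_symm {Z : Matrix (Idx d) (Idx d) ℂ} (hZ : Zᵀ = Z) :
    (rot R Z).toBlocks₂₂ᵀ = (rot R Z).toBlocks₂₂ ∧ (rot R Z).toBlocks₂₁ᵀ = (rot R Z).toBlocks₁₂ := by
  have h : (rot R Z)ᵀ = rot R Z := by rw [rot_transpose, hZ]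
  exact ⟨by ext i j; exact congrFun (congrFun h (Sum.inr i)) (Sum.inr j),
    by ext i j; exact congrFun (congrFun h (Sum.inl i)) (Sum.inr j)⟩

lemma rot_mulVec_elim_zero (Z : Matrix (Idx d) (Idx d) ℂ) (u : Fin (M.d₁ ω) → ℂ) :
    rot R Z *ᵥ Sum.elim (0 : Fin (M.d₀ ω) → ℂ) u =
      Sum.elim ((rot R Z).toBlocks₁₂ *ᵥ u) ((rot R Z).toBlocks₂₂ *ᵥ u) := by
  conv_lhs => rw [← fromBlocks_toBlocks (rot R Z), fromBlocks_mulVec]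
  simp

end MeanFieldModel

/-! ### The generator on differentiable vectors -/

namespace RegularWeylField

open MeanFieldModel

variable {d : ℕ} {M : MeanFieldModel d} {H : M.averages → Type*}
  [∀ ω, NormedAddCommGroup (H ω)] [∀ ω, InnerProductSpace ℂ (H ω)] [∀ ω, CompleteSpace (H ω)]
  {𝓗 : MeasurableHilbertField H} (𝒲 : RegularWeylField M 𝓗)
  (f : (Idx d → ℝ) → ℂ) (r : (Idx d → ℝ) → Idx d → ℝ) {ω : M.averages}
  (R : Matrix (M.BlockIdx (ω : Idx d → ℝ)) (Idx d) ℝ) {ψ : H ω}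

lemma dG_apply (μ : Fin (M.d₀ ω)) (φ : H ω) :
    𝒲.dG f r ω R μ φ = (Complex.I * ((R *ᵥ r ω) (Sum.inl μ) : ℝ)) • 𝒲.Wf f r ω φ := by
  have h1 : HasDerivAt (fun y : ℝ =>
      Complex.exp (Complex.I * ((y * (R *ᵥ r ω) (Sum.inl μ) : ℝ) : ℂ)) • 𝒲.Wf f r ω)
      ((Complex.I * ((R *ᵥ r ω) (Sum.inl μ) : ℝ)) • 𝒲.Wf f r ω) 0 := by
    have h2 := (((hasDerivAt_id (0 : ℝ)).mul_const
      ((R *ᵥ r ω) (Sum.inl μ))).ofReal_comp.const_mul Complex.I).cexp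
    refine (h2.smul_const (𝒲.Wf f r ω)).congr_deriv ?_
    simp
  rw [dG, h1.deriv]
  rfl

lemma G_Wf_apply (h : ContDiff ℝ 1 fun a => 𝒲.W ω a ψ) (α : M.BlockIdx (ω : Idx d → ℝ)) :
    𝒲.G ω R α (𝒲.Wf f r ω ψ) = f ω • (𝒲.W ω (r ω) (𝒲.G ω R α ψ)
      - ((R α ⬝ᵥ (M.sigma ω *ᵥ r ω) : ℝ) : ℂ) • 𝒲.W ω (r ω) ψ) := by
  have hW := (𝒲.contDiff_W_apply h (r ω)).differentiable one_ne_zero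
  have hfW : Differentiable ℝ fun a => 𝒲.W ω a (𝒲.Wf f r ω ψ) :=
    𝒲.differentiable_W_smul hW (f ω)
  rw [𝒲.G_eq_fluct hfW, 𝒲.G_eq_fluct (h.differentiable one_ne_zero), Wf,
    _root_.smul_apply, 𝒲.fluct_smul hW, 𝒲.fluct_W_apply_comm h]

lemma contDiff_G (h : ContDiff ℝ 2 fun a => 𝒲.W ω a ψ) (α : M.BlockIdx (ω : Idx d → ℝ)) :
    ContDiff ℝ 1 fun a => 𝒲.W ω a (𝒲.G ω R α ψ) := by
  rw [𝒲.G_eq_fluct (h.differentiable two_ne_zero)]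
  exact 𝒲.contDiff_fluct h _

lemma G_G_Wf_apply (h : ContDiff ℝ 2 fun a => 𝒲.W ω a ψ) (α β : M.BlockIdx (ω : Idx d → ℝ)) :
    𝒲.G ω R α (𝒲.G ω R β (𝒲.Wf f r ω ψ)) = f ω • (𝒲.W ω (r ω) (𝒲.G ω R α (𝒲.G ω R β ψ))
      - ((R α ⬝ᵥ (M.sigma ω *ᵥ r ω) : ℝ) : ℂ) • 𝒲.W ω (r ω) (𝒲.G ω R β ψ)
      - ((R β ⬝ᵥ (M.sigma ω *ᵥ r ω) : ℝ) : ℂ) • (𝒲.W ω (r ω) (𝒲.G ω R α ψ)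
        - ((R α ⬝ᵥ (M.sigma ω *ᵥ r ω) : ℝ) : ℂ) • 𝒲.W ω (r ω) ψ)) := by
  have h1 : ContDiff ℝ 1 fun a => 𝒲.W ω a ψ := h.of_le (by norm_num)
  have hG := 𝒲.contDiff_G R h β
  have d1 := (𝒲.contDiff_W_apply h1 (r ω)).differentiable one_ne_zero
  have d2 := (𝒲.contDiff_W_apply hG (r ω)).differentiable one_ne_zero
  have d3 : Differentiable ℝ fun a => 𝒲.W ω a (𝒲.W ω (r ω) (𝒲.G ω R β ψ)
      - ((R β ⬝ᵥ (M.sigma ω *ᵥ r ω) : ℝ) : ℂ) • 𝒲.W ω (r ω) ψ) :=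
    𝒲.differentiable_W_sub d2 (𝒲.differentiable_W_smul d1 _)
  have d4 := 𝒲.differentiable_W_smul d3 (f ω)
  rw [𝒲.G_Wf_apply f r R h1, 𝒲.G_eq_fluct d4, 𝒲.fluct_smul d3, 𝒲.fluct_sub_smul d2 d1,
    𝒲.fluct_W_apply_comm hG, 𝒲.fluct_W_apply_comm h1,
    𝒲.G_eq_fluct (hG.differentiable one_ne_zero) R α,
    𝒲.G_eq_fluct (h1.differentiable one_ne_zero) R α]

/-- The classical, mixed and quantum terms of the generator together are the part of the time
derivative of the extended dynamics that comes from the matrices `X_t` and `Y_t`. -/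
lemma Lcc_add_Lcq_add_Lqq (hR : M.IsBlockRotation ω R) (h : 𝒲.IsRegularVector ω ψ) :
    𝒲.Lcc f r ω R ψ + 𝒲.Lcq f r ω R ψ + 𝒲.Lqq f r ω R ψ =
      f ω • ((-(1 / 2) * ((r ω ⬝ᵥ ((M.sigma ω * rePart M.A * (M.sigma ω)ᵀ) *ᵥ r ω) : ℝ) : ℂ)) •
          𝒲.W ω (r ω) ψ
        + fderiv ℝ (fun a => 𝒲.W ω a ψ) (r ω) ((M.Q ω)ᵀ *ᵥ r ω)) := by
  have h2 : ContDiff ℝ 2 fun a => 𝒲.W ω a ψ := h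
  have h1 : ContDiff ℝ 1 fun a => 𝒲.W ω a ψ := h2.of_le (by norm_num)
  have hW : Differentiable ℝ fun a => 𝒲.W ω a (𝒲.Wf f r ω ψ) :=
    𝒲.differentiable_W_smul ((𝒲.contDiff_W_apply h1 (r ω)).differentiable one_ne_zero) (f ω)
  set w : H ω := 𝒲.W ω (r ω) ψ with hw
  set P : M.BlockIdx (ω : Idx d → ℝ) → H ω := fun α => 𝒲.W ω (r ω) (𝒲.G ω R α ψ) with hP
  set rc : Idx d → ℂ := fun i => (r ω i : ℂ) with hrc
  set s : M.BlockIdx (ω : Idx d → ℝ) → ℂ := cplx R *ᵥ rc with hs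
  set u : Fin (M.d₁ ω) → ℂ := sigma11 R *ᵥ (s ∘ Sum.inr) with hu
  -- the vector `σ s` in the rotated frame
  have hσs : cplx R *ᵥ (M.sigmaC ω *ᵥ rc) = Sum.elim (0 : Fin (M.d₀ ω) → ℂ) u := by
    rw [hR.rot_mulVec, hR.rot_sigmaC, fromBlocks_mulVec]
    simp [hu, hs]
  have hRu : ∀ α, ((R α ⬝ᵥ (M.sigma ω *ᵥ r ω) : ℝ) : ℂ) = Sum.elim (0 : Fin (M.d₀ ω) → ℂ) u α := by
    intro α
    have e1 : ((R α ⬝ᵥ (M.sigma ω *ᵥ r ω) : ℝ) : ℂ) = (((R * M.sigma ω) *ᵥ r ω) α : ℝ) := by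
      rw [← mulVec_mulVec]; rfl
    rw [e1, cplx_mulVec, cplx_mul, M.cplx_sigma, ← mulVec_mulVec, hσs]
  have hu0 : ∀ μ, ((R (Sum.inl μ) ⬝ᵥ (M.sigma ω *ᵥ r ω) : ℝ) : ℂ) = 0 := fun μ => by
    rw [hRu]; rfl
  have hu1 : ∀ μ, ((R (Sum.inr μ) ⬝ᵥ (M.sigma ω *ᵥ r ω) : ℝ) : ℂ) = u μ := fun μ => by
    rw [hRu]; rfl
  have hs0 : ∀ μ, (((R *ᵥ r ω) μ : ℝ) : ℂ) = s μ := fun μ => by rw [cplx_mulVec]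
  -- the individual terms
  have ecc : 𝒲.Lcc f r ω R ψ = f ω • ∑ μ, ∑ ν, D00 R μ ν • (Complex.I * s (Sum.inl μ)) •
      P (Sum.inl ν) := by
    simp only [Lcc, Finset.smul_sum]
    refine Finset.sum_congr rfl fun μ _ => Finset.sum_congr rfl fun ν _ => ?_
    have hW' := 𝒲.differentiable_W_smul hW (Complex.I * s (Sum.inl μ))
    rw [dG_apply, hs0, 𝒲.G_eq_fluct hW', 𝒲.fluct_smul hW, ← 𝒲.G_eq_fluct hW R,
      𝒲.G_Wf_apply f r R h1, hu0, zero_smul, sub_zero]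
    simp only [hP]
    module
  have ecq : 𝒲.Lcq f r ω R ψ = f ω • ∑ μ, ∑ ν, (D01 R μ ν / 2) • (Complex.I * s (Sum.inl μ)) •
      ((2 : ℂ) • P (Sum.inr ν) - u ν • w) := by
    simp only [Lcq, Finset.smul_sum]
    refine Finset.sum_congr rfl fun μ _ => Finset.sum_congr rfl fun ν _ => ?_
    have hW' := 𝒲.differentiable_W_smul hW (Complex.I * s (Sum.inl μ))
    rw [anticomm, dG_apply, dG_apply, hs0, 𝒲.G_eq_fluct hW', 𝒲.fluct_smul hW,
      ← 𝒲.G_eq_fluct hW R, 𝒲.G_Wf_apply f r R h1, hu1, Wf, _root_.smul_apply]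
    simp only [hP, hw]
    module
  have eqq : 𝒲.Lqq f r ω R ψ = f ω •
      (Complex.I • (∑ μ, ∑ ν, (H01 R μ ν + H10 R ν μ) • (-u ν) • P (Sum.inl μ))
        + Complex.I • (∑ μ, ∑ ν, H11 R μ ν •
          (-(u μ • P (Sum.inr ν)) - u ν • P (Sum.inr μ) + (u μ * u ν) • w))
        + ∑ μ, ∑ ν, K11 R μ ν • (1 / 2 : ℂ) •
          (u ν • P (Sum.inr μ) - u μ • P (Sum.inr ν) - (u μ * u ν) • w)) := by
    simp only [Lqq, smul_add]
    congr 1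
    · congr 1
      · rw [smul_comm (f ω) Complex.I, Finset.smul_sum (r := f ω)]
        simp only [Finset.smul_sum (r := f ω)]
        congr 1
        refine Finset.sum_congr rfl fun μ _ => Finset.sum_congr rfl fun ν _ => ?_
        have e1 : comm (𝒲.G ω R (Sum.inr ν)) (𝒲.Wf f r ω) ψ = (-u ν) • 𝒲.Wf f r ω ψ := by
          rw [comm, 𝒲.G_Wf_apply f r R h1, hu1, Wf, _root_.smul_apply, _root_.smul_apply]
          module
        have hW' := 𝒲.differentiable_W_smul hW (-u ν)
        rw [e1, 𝒲.G_eq_fluct hW', 𝒲.fluct_smul hW, ← 𝒲.G_eq_fluct hW R,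
          𝒲.G_Wf_apply f r R h1, hu0, zero_smul, sub_zero]
        simp only [hP]
        module
      · rw [smul_comm (f ω) Complex.I, Finset.smul_sum (r := f ω)]
        simp only [Finset.smul_sum (r := f ω)]
        congr 1
        refine Finset.sum_congr rfl fun μ _ => Finset.sum_congr rfl fun ν _ => ?_
        simp only [comm, Function.comp]
        rw [𝒲.G_G_Wf_apply f r R h2, hu1, hu1, Wf, _root_.smul_apply]
        simp only [hP, hw]
        module
    · rw [Finset.smul_sum]
      simp only [Finset.smul_sum (r := f ω)]
      refine Finset.sum_congr rfl fun μ _ => Finset.sum_congr rfl fun ν _ => ?_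
      simp only [anticomm, Function.comp]
      rw [𝒲.G_G_Wf_apply f r R h2, 𝒲.G_Wf_apply f r R (𝒲.contDiff_G R h2 _), hu1, hu1, Wf,
        _root_.smul_apply]
      simp only [hP, hw]
      module
  rw [ecc, ecq, eqq, ← smul_add, ← smul_add]
  congr 1
  have hB := rot_toBlocks_transpose_of_antisymm (R := R) M.transpose_B
  have hD := rot_toBlocks_transpose_of_antisymm (R := R) (Z := cplx (M.D ω))
    (by rw [M.cplx_D, transpose_DC])
  have hA := rot_toBlocks_transpose_of_symm (R := R) M.transpose_A
  have hh := rot_toBlocks_transpose_of_symm (R := R) M.transpose_hRe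
  refine (generator_terms_eq (D00 R) hB.1 hh.1 hD.1 hR.transpose_sigma11 hR.isUnit_det_sigma11
    hB.2 hh.2 hD.2 hA.1 (s ∘ Sum.inl) (s ∘ Sum.inr) u hu (P ∘ Sum.inl) (P ∘ Sum.inr) w
    (H01 := H01 R) (H10 := H10 R) (H11 := H11 R) (K11 := K11 R) rfl rfl rfl rfl).trans ?_
  have hA' : ((r ω ⬝ᵥ ((M.sigma ω * rePart M.A * (M.sigma ω)ᵀ) *ᵥ r ω) : ℝ) : ℂ)
      = u ⬝ᵥ ((rot R M.A).toBlocks₂₂ *ᵥ u) := by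
    have e1 : ((r ω ⬝ᵥ ((M.sigma ω * rePart M.A * (M.sigma ω)ᵀ) *ᵥ r ω) : ℝ) : ℂ)
        = rc ⬝ᵥ (cplx (M.sigma ω * rePart M.A * (M.sigma ω)ᵀ) *ᵥ rc) := by
      simp only [dotProduct, Complex.ofReal_sum, Complex.ofReal_mul, cplx_mulVec]
      rfl
    rw [e1, cplx_mul, cplx_mul, M.cplx_A, cplx_transpose, M.cplx_sigma, transpose_sigmaC,
      ← mulVec_mulVec, ← mulVec_mulVec, dotProduct_mulVec, ← mulVec_transpose, transpose_sigmaC,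
      neg_mulVec, neg_dotProduct, mulVec_neg, dotProduct_neg, neg_neg]
    have e2 : ∀ a b : Idx d → ℂ, a ⬝ᵥ b = (cplx R *ᵥ a) ⬝ᵥ (cplx R *ᵥ b) := fun a b => by
      rw [dotProduct_mulVec, ← mulVec_transpose, mulVec_mulVec, hR.cplx_transpose_mul, one_mulVec]
    rw [e2, hσs, hR.rot_mulVec, hσs, rot_mulVec_elim_zero, sumElim_dotProduct_sumElim]
    simp
  have hQ : ∀ α, (((R *ᵥ ((M.Q ω)ᵀ *ᵥ r ω)) α : ℝ) : ℂ)
      = (-Complex.I • (rot R M.B *ᵥ Sum.elim (0 : Fin (M.d₀ ω) → ℂ) u)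
        - (2 : ℂ) • (rot R M.hRe *ᵥ Sum.elim (0 : Fin (M.d₀ ω) → ℂ) u)
        + (rot R (cplx (M.D ω)))ᵀ *ᵥ s) α := by
    intro α
    have e1 : (fun j => ((((M.Q ω)ᵀ *ᵥ r ω) j : ℝ) : ℂ)) = (M.QC ω)ᵀ *ᵥ rc := by
      ext j
      rw [cplx_mulVec, cplx_transpose, M.cplx_Q]
    rw [cplx_mulVec, e1, transpose_QC_mulVec, mulVec_add, mulVec_sub, mulVec_smul, mulVec_smul,
      hR.rot_mulVec M.B, hR.rot_mulVec M.hRe, hR.rot_mulVec (M.DC ω)ᵀ, hσs, ← rot_transpose,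
      M.cplx_D]
  have hRQ : (M.Q ω)ᵀ *ᵥ r ω = ∑ α, (R *ᵥ ((M.Q ω)ᵀ *ᵥ r ω)) α • R α := by
    have e1 : (M.Q ω)ᵀ *ᵥ r ω = Rᵀ *ᵥ (R *ᵥ ((M.Q ω)ᵀ *ᵥ r ω)) := by
      rw [mulVec_mulVec, hR.2.1, one_mulVec]
    conv_lhs => rw [e1, mulVec_eq_sum]
    simp only [op_smul_eq_smul]
    rfl
  rw [hA', hRQ, map_sum, add_assoc, Fintype.sum_sum_type]
  have hterm : ∀ α, fderiv ℝ (fun a => 𝒲.W ω a ψ) (r ω) ((R *ᵥ ((M.Q ω)ᵀ *ᵥ r ω)) α • R α)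
      = (((R *ᵥ ((M.Q ω)ᵀ *ᵥ r ω)) α : ℝ) : ℂ) • (Complex.I • P α
        - (Complex.I / 2 * ((R α ⬝ᵥ (M.sigma ω *ᵥ r ω) : ℝ) : ℂ)) • w) := by
    intro α
    have hd := h1.differentiable one_ne_zero
    rw [map_smul, 𝒲.fderiv_W_apply hd, ← 𝒲.G_eq_fluct hd, Complex.coe_smul]
  have hDt : (rot R (cplx (M.D ω)))ᵀ *ᵥ s = Sum.elim
      ((D00 R)ᵀ *ᵥ (s ∘ Sum.inl) + (D10 R)ᵀ *ᵥ (s ∘ Sum.inr))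
      ((D01 R)ᵀ *ᵥ (s ∘ Sum.inl) + (D11 R)ᵀ *ᵥ (s ∘ Sum.inr)) := by
    conv_lhs => rw [← fromBlocks_toBlocks (rot R (cplx (M.D ω))), fromBlocks_transpose,
      fromBlocks_mulVec]
    rfl
  simp only [hterm, hQ, hu0, hu1, mul_zero, zero_smul, sub_zero, hDt, rot_mulVec_elim_zero,
    Pi.add_apply, Pi.sub_apply, Pi.smul_apply, Sum.elim_inl, Sum.elim_inr, ← add_assoc]
  rfl

end RegularWeylField

/-! ### Existence of the block rotation -/

namespace MeanFieldModel

variable {d : ℕ} (M : MeanFieldModel d)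

/-- The rows of `R` are an orthonormal basis of `ker σ(ω)` followed by one of its orthogonal
complement. -/
theorem exists_isBlockRotation (ω : Idx d → ℝ) : ∃ R, M.IsBlockRotation ω R := by
  classical
  set Z := M.sigma ω with hZ
  let K : Submodule ℝ (EuclideanSpace ℝ (Idx d)) := LinearMap.ker (toEuclideanLin Z)
  have hmemK : ∀ y : EuclideanSpace ℝ (Idx d), y ∈ K ↔ Z *ᵥ y.ofLp = 0 := fun y => by
    rw [LinearMap.mem_ker, toLpLin_apply, WithLp.toLp_eq_zero]
  have hKdim : Module.finrank ℝ K = M.d₀ ω := by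
    refine LinearEquiv.finrank_eq ((WithLp.linearEquiv 2 ℝ (Idx d → ℝ)).ofSubmodules _ _ ?_)
    ext y
    rw [Submodule.mem_map_equiv, hmemK, LinearMap.mem_ker, toLin'_apply]
    rfl
  have hd : M.d₀ ω ≤ d ^ 2 := by
    have := Submodule.finrank_le (LinearMap.ker (toLin' (M.sigma ω)))
    simpa [d₀] using this
  have hKdim' : Module.finrank ℝ Kᗮ = M.d₁ ω := by
    have := K.finrank_add_finrank_orthogonal
    rw [hKdim, finrank_euclideanSpace, Fintype.card_fin] at this
    rw [d₁]; omega
  let b₀ : OrthonormalBasis (Fin (M.d₀ ω)) ℝ K :=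
    (stdOrthonormalBasis ℝ K).reindex (finCongr hKdim)
  let b₁ : OrthonormalBasis (Fin (M.d₁ ω)) ℝ Kᗮ :=
    (stdOrthonormalBasis ℝ Kᗮ).reindex (finCongr hKdim')
  let row : M.BlockIdx ω → EuclideanSpace ℝ (Idx d) :=
    Sum.elim (fun i => (b₀ i : EuclideanSpace ℝ (Idx d))) fun j => b₁ j
  have hrow : ∀ α β, (row β).ofLp ⬝ᵥ (row α).ofLp = if α = β then 1 else 0 := by
    intro α β
    have e : (row β).ofLp ⬝ᵥ (row α).ofLp = ⟪row α, row β⟫_ℝ := by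
      rw [EuclideanSpace.inner_eq_star_dotProduct]; rfl
    rw [e]
    rcases α with i | i <;> rcases β with j | j
    · simpa [row] using (orthonormal_iff_ite.1 b₀.orthonormal) i j
    · simpa [row] using (Submodule.mem_orthogonal _ _).1 (b₁ j).2 _ (b₀ i).2
    · simpa [row] using (Submodule.mem_orthogonal' _ _).1 (b₁ i).2 _ (b₀ j).2
    · simpa [row] using (orthonormal_iff_ite.1 b₁.orthonormal) i j
  let R : Matrix (M.BlockIdx ω) (Idx d) ℝ := of fun α => (row α).ofLp
  have h1 : R * Rᵀ = 1 := by
    ext α β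
    rw [mul_apply', Matrix.one_apply, ← hrow α β, dotProduct_comm]
    rfl
  have hcard : Fintype.card (M.BlockIdx ω) = Fintype.card (Idx d) := by
    rw [Fintype.card_sum, Fintype.card_fin, Fintype.card_fin, Fintype.card_fin, d₁]
    omega
  have h2 : Rᵀ * R = 1 := (mul_eq_one_comm_of_card_eq _ _ _ hcard).1 h1
  have hker : ∀ i, Z *ᵥ R (Sum.inl i) = 0 := fun i => (hmemK _).1 (b₀ i).2
  have hent : ∀ α β, (R * Z * Rᵀ) α β = R α ⬝ᵥ (Z *ᵥ R β) := fun α β => by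
    rw [Matrix.mul_assoc, mul_apply']
    rfl
  have hblock : R * Z * Rᵀ = fromBlocks 0 0 0 (R * Z * Rᵀ).toBlocks₂₂ := by
    ext (i | i) (j | j)
    · rw [hent, hker]; simp
    · rw [hent, M.dotProduct_sigma_swap, hker]; simp
    · rw [hent, hker]; simp
    · rfl
  refine ⟨R, h1, h2, _, ?_, hblock⟩
  rw [← isUnit_iff_isUnit_det, ← mulVec_injective_iff_isUnit]
  refine (injective_iff_map_eq_zero (mulVecLin (R * Z * Rᵀ).toBlocks₂₂)).2 fun a ha => ?_
  rw [mulVecLin_apply] at ha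
  -- `y` lies in the kernel, hence is orthogonal to the last rows of `R`
  set y : Idx d → ℝ := Rᵀ *ᵥ Sum.elim (0 : Fin (M.d₀ ω) → ℝ) a with hy
  have hRy : R *ᵥ y = Sum.elim (0 : Fin (M.d₀ ω) → ℝ) a := by rw [hy, mulVec_mulVec, h1, one_mulVec]
  have hRZy : R *ᵥ (Z *ᵥ y) = 0 := by
    rw [hy, mulVec_mulVec, mulVec_mulVec, hblock, fromBlocks_mulVec]
    ext (i | i) <;> simp [ha]
  have hZy : Z *ᵥ y = 0 := by
    have := congrArg (fun z => Rᵀ *ᵥ z) hRZy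
    simpa [mulVec_mulVec, ← Matrix.mul_assoc, h2] using this
  ext j
  have e1 : a j = (R *ᵥ y) (Sum.inr j) := by rw [hRy]; rfl
  have e2 : ⟪WithLp.toLp 2 y, (b₁ j : EuclideanSpace ℝ (Idx d))⟫_ℝ = 0 :=
    (Submodule.mem_orthogonal _ _).1 (b₁ j).2 _ ((hmemK _).2 hZy)
  rw [EuclideanSpace.inner_eq_star_dotProduct] at e2
  rw [e1]
  exact e2

end MeanFieldModel

/-! ### Hermiticity and positivity of `K¹¹` -/

namespace MeanFieldModel

variable {d : ℕ} {M : MeanFieldModel d} {ω : Idx d → ℝ} {R : Matrix (M.BlockIdx ω) (Idx d) ℝ}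

lemma rot_conjTranspose (Z : Matrix (Idx d) (Idx d) ℂ) : (rot R Z)ᴴ = rot R Zᴴ := by
  simp only [rot, conjTranspose_mul, conjTranspose_cplx, ← cplx_transpose, transpose_transpose,
    Matrix.mul_assoc]

lemma A_add_B : M.A + M.B = M.C := by
  rw [A, B]
  module

lemma K11_eq : K11 R = (rot R M.C).toBlocks₂₂
    + (Complex.I / 2) • ((sigma11 R)⁻¹ * D11 R - D11 R * (sigma11 R)⁻¹) := by
  rw [K11, ← A_add_B (M := M)]
  congr 1
  rw [rot, rot, rot, Matrix.mul_add, Matrix.add_mul]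
  rfl

lemma conjTranspose_toBlocks₂₂_rot_cplx {Z : Matrix (Idx d) (Idx d) ℝ} (hZ : Zᵀ = -Z) :
    (rot R (cplx Z)).toBlocks₂₂ᴴ = -(rot R (cplx Z)).toBlocks₂₂ := by
  have h1 : (cplx Z)ᴴ = -cplx Z := by
    rw [conjTranspose_cplx, ← cplx_transpose, hZ]
    ext i j
    simp [cplx]
  have h : (rot R (cplx Z))ᴴ = -rot R (cplx Z) := by rw [rot_conjTranspose, h1, rot_neg]
  ext i j
  exact congrFun (congrFun h (Sum.inr i)) (Sum.inr j)

lemma transpose_D (M : MeanFieldModel d) (ω : Idx d → ℝ) : (M.D ω)ᵀ = -M.D ω := by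
  ext μ ν
  have := congrFun (congrFun (M.transpose_DC ω) μ) ν
  simpa [D, rePart] using congrArg Complex.re this

lemma IsBlockRotation.isHermitian_K11 (hR : M.IsBlockRotation ω R) : (K11 R).IsHermitian := by
  have hσ : (sigma11 R)ᴴ = -sigma11 R := conjTranspose_toBlocks₂₂_rot_cplx (M.transpose_sigma ω)
  have hD : (D11 R)ᴴ = -D11 R := conjTranspose_toBlocks₂₂_rot_cplx (M.transpose_D ω)
  have hσi : (sigma11 R)⁻¹ᴴ = -(sigma11 R)⁻¹ := by
    rw [conjTranspose_nonsing_inv, hσ]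
    refine inv_eq_left_inv ?_
    rw [neg_mul_neg, nonsing_inv_mul _ hR.isUnit_det_sigma11]
  have hC : (rot R M.C).toBlocks₂₂ᴴ = (rot R M.C).toBlocks₂₂ := by
    have h : (rot R M.C)ᴴ = rot R M.C := by
      rw [rot_conjTranspose, M.C_posSemidef.isHermitian.eq]
    ext i j
    exact congrFun (congrFun h (Sum.inr i)) (Sum.inr j)
  rw [IsHermitian, K11_eq, conjTranspose_add, hC, conjTranspose_smul, conjTranspose_sub,
    conjTranspose_mul, conjTranspose_mul, hσi, hD, neg_mul_neg, neg_mul_neg]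
  have : star (Complex.I / 2) = -(Complex.I / 2) := by
    simp [neg_div]
  rw [this]
  module

/-- Multiplication of `K¹¹` by `(σ¹¹)²` from both sides removes the inverse of `σ¹¹`, so that the
result can be rotated back: positivity of `K¹¹` is a statement on `σ`, `D` and `C` in the original
basis, whatever the choice of `R`. -/
lemma IsBlockRotation.posSemidef_of_K11 (hR : M.IsBlockRotation ω R) (hK : (K11 R).PosSemidef) :
    (M.sigmaC ω * (M.sigmaC ω * (M.C * (M.sigmaC ω * M.sigmaC ω)))
      + (Complex.I / 2) • (M.sigmaC ω * (M.DC ω * (M.sigmaC ω * M.sigmaC ω))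
        - M.sigmaC ω * (M.sigmaC ω * (M.DC ω * M.sigmaC ω)))).PosSemidef := by
  set T := M.sigmaC ω * (M.sigmaC ω * (M.C * (M.sigmaC ω * M.sigmaC ω)))
      + (Complex.I / 2) • (M.sigmaC ω * (M.DC ω * (M.sigmaC ω * M.sigmaC ω))
        - M.sigmaC ω * (M.sigmaC ω * (M.DC ω * M.sigmaC ω))) with hT
  set τ := sigma11 R with hτ
  have hτH : τᴴ = -τ := conjTranspose_toBlocks₂₂_rot_cplx (M.transpose_sigma ω)
  have hdet : IsUnit τ.det := hR.isUnit_det_sigma11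
  have h1 : rot R T = fromBlocks 0 0 0 (τ * (τ * (K11 R * (τ * τ)))) := by
    have e1 : rot R T = rot R (M.sigmaC ω) * (rot R (M.sigmaC ω) * (rot R M.C *
        (rot R (M.sigmaC ω) * rot R (M.sigmaC ω))))
        + (Complex.I / 2) • (rot R (M.sigmaC ω) * (rot R (M.DC ω) *
          (rot R (M.sigmaC ω) * rot R (M.sigmaC ω))) - rot R (M.sigmaC ω) *
            (rot R (M.sigmaC ω) * (rot R (M.DC ω) * rot R (M.sigmaC ω)))) := by
      simp only [← hR.rot_mul]
      simp only [hT, rot, Matrix.mul_add, Matrix.add_mul, Matrix.mul_sub, Matrix.sub_mul,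
        Matrix.mul_smul, Matrix.smul_mul]
    have hD : D11 R = (rot R (M.DC ω)).toBlocks₂₂ := by rw [D11, M.cplx_D]
    rw [e1, hR.rot_sigmaC, K11_eq, hD, ← fromBlocks_toBlocks (rot R M.C),
      ← fromBlocks_toBlocks (rot R (M.DC ω))]
    simp only [fromBlocks_multiply, toBlocks_fromBlocks₂₂, Matrix.zero_mul, Matrix.mul_zero,
      add_zero, zero_add, sub_eq_add_neg, fromBlocks_neg, fromBlocks_add, fromBlocks_smul, neg_zero,
      smul_zero]
    congr 1
    simp only [Matrix.mul_add, Matrix.add_mul, Matrix.mul_smul, Matrix.smul_mul, Matrix.mul_neg,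
      Matrix.neg_mul, ← Matrix.mul_assoc]
    rw [← hτ]
    simp only [Matrix.mul_assoc, mul_nonsing_inv_cancel_left _ _ hdet,
      nonsing_inv_mul_cancel_left _ _ hdet]
  have h2 : rot R T = (fromCols (0 : Matrix _ (Fin (M.d₀ ω)) ℂ) (τ * τ))ᴴ * K11 R *
      fromCols (0 : Matrix _ (Fin (M.d₀ ω)) ℂ) (τ * τ) := by
    rw [h1, conjTranspose_fromCols_eq_fromRows_conjTranspose, fromRows_mul, fromRows_mul_fromCols,
      conjTranspose_mul, hτH, neg_mul_neg]
    simp [Matrix.mul_assoc]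
  have h3 : T = (cplx R)ᴴ * rot R T * cplx R := by
    rw [conjTranspose_cplx, rot]
    simp only [Matrix.mul_assoc]
    rw [hR.cplx_transpose_mul, Matrix.mul_one, ← Matrix.mul_assoc, hR.cplx_transpose_mul,
      Matrix.one_mul]
  rw [h3, h2]
  exact (hK.conjTranspose_mul_mul_same _).conjTranspose_mul_mul_same _

end MeanFieldModel

/-! ### A model for which `K¹¹` is not positive semidefinite -/

/-- The Hermitian matrices `z E_{ij} + z̄ E_{ji}`, `z = (1 + i) / 2`, as `(i, j)` runs through all
pairs of indices: an orthonormal basis with coefficients in `ℚ(i)`, in which the commutator with a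
diagonal matrix acts as the exchange of `i` and `j`. -/
def hermUnit {d : ℕ} (p : Fin d × Fin d) : Matrix (Fin d) (Fin d) ℂ :=
  single p.1 p.2 ((1 + Complex.I) / 2) + single p.2 p.1 ((1 - Complex.I) / 2)

section hermUnit

variable {d : ℕ}

lemma isHermitian_hermUnit (p : Fin d × Fin d) : (hermUnit p).IsHermitian := by
  rw [IsHermitian, hermUnit, conjTranspose_add, conjTranspose_single, conjTranspose_single, add_comm]
  congr 2 <;> simp [sub_eq_add_neg]

lemma trace_hermUnit_mul (p : Fin d × Fin d) (Z : Matrix (Fin d) (Fin d) ℂ) :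
    (hermUnit p * Z).trace =
      (1 + Complex.I) / 2 * Z p.2 p.1 + (1 - Complex.I) / 2 * Z p.1 p.2 := by
  rw [hermUnit, Matrix.add_mul, trace_add, trace_single_mul, trace_single_mul, smul_eq_mul,
    smul_eq_mul]

lemma trace_hermUnit_mul_hermUnit (p q : Fin d × Fin d) :
    (hermUnit p * hermUnit q).trace = if p = q then 1 else 0 := by
  obtain ⟨i, j⟩ := p
  obtain ⟨k, l⟩ := q
  have hz : (1 + Complex.I) / 2 * ((1 + Complex.I) / 2)
      + (1 - Complex.I) / 2 * ((1 - Complex.I) / 2) = 0 := by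
    linear_combination (1 / 2) * Complex.I_sq
  have hz' : (1 + Complex.I) / 2 * ((1 - Complex.I) / 2)
      + (1 - Complex.I) / 2 * ((1 + Complex.I) / 2) = 1 := by
    linear_combination (-1 / 2) * Complex.I_sq
  rw [trace_hermUnit_mul]
  simp only [hermUnit, Matrix.add_apply, single_apply, Prod.mk.injEq]
  by_cases h1 : i = k ∧ j = l <;> by_cases h2 : k = j ∧ l = i
  · obtain ⟨rfl, rfl⟩ := h1
    obtain ⟨rfl, -⟩ := h2
    simp only [and_self, if_true]
    linear_combination hz + hz'
  · have h3 : ¬ (k = i ∧ l = j) ↔ False := by simp [h1.1, h1.2]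
    have h4 : ¬ (l = j ∧ k = i) ↔ False := by simp [h1.1, h1.2]
    have h5 : ¬ (l = i ∧ k = j) := fun h => h2 ⟨h.2, h.1⟩
    rw [if_neg h2, if_pos (not_not.1 h4.1), if_pos (not_not.1 h3.1), if_neg h5, if_pos h1]
    linear_combination hz'
  · have h3 : ¬ (k = i ∧ l = j) := fun h => h1 ⟨h.1.symm, h.2.symm⟩
    have h4 : ¬ (l = j ∧ k = i) := fun h => h3 ⟨h.2, h.1⟩
    rw [if_pos h2, if_neg h4, if_neg h3, if_pos ⟨h2.2, h2.1⟩, if_neg h1]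
    linear_combination hz
  · have h3 : ¬ (k = i ∧ l = j) := fun h => h1 ⟨h.1.symm, h.2.symm⟩
    have h4 : ¬ (l = j ∧ k = i) := fun h => h3 ⟨h.2, h.1⟩
    have h5 : ¬ (l = i ∧ k = j) := fun h => h2 ⟨h.2, h.1⟩
    rw [if_neg h2, if_neg h4, if_neg h3, if_neg h5, if_neg h1]
    simp

lemma hermUnit_diag (i : Fin d) : hermUnit (i, i) = single i i 1 := by
  rw [hermUnit, ← single_add]
  congr 1
  ring

lemma hermUnit_comm_diagonal (x : Fin d → ℂ) (p : Fin d × Fin d) :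
    hermUnit p * diagonal x - diagonal x * hermUnit p
      = (Complex.I * (x p.2 - x p.1)) • hermUnit p.swap := by
  ext a b
  simp only [hermUnit, Matrix.sub_apply, mul_diagonal, diagonal_mul, Matrix.add_apply, single_apply,
    Matrix.smul_apply, smul_eq_mul, Prod.fst_swap, Prod.snd_swap]
  split_ifs with h1 h2 h2
  · obtain ⟨rfl, rfl⟩ := h1
    obtain ⟨h2, -⟩ := h2
    rw [h2]; ring
  · obtain ⟨rfl, rfl⟩ := h1
    linear_combination (x p.2 - x p.1) / 2 * Complex.I_sq
  · obtain ⟨rfl, rfl⟩ := h2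
    linear_combination -(x p.2 - x p.1) / 2 * Complex.I_sq
  · ring

end hermUnit

namespace NonPositiveModel

open MeanFieldModel

/-- Pairs of indices of a three-level system as labels of the basis. -/
def idx : Fin 3 × Fin 3 ≃ Idx 3 := finProdFinEquiv

/-- A three-level system with the depolarizing dissipator `C = 1/4` and with the linear
Hamiltonian `E₀₁ + E₁₀`. -/
def model : MeanFieldModel 3 where
  v μ := hermUnit (idx.symm μ)
  v_hermitian μ := isHermitian_hermUnit _
  v_orthonormal μ ν := by
    rw [trace_hermUnit_mul_hermUnit]
    simp only [idx.symm.injective.eq_iff]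
  ε μ := if idx.symm μ = (0, 1) ∨ idx.symm μ = (1, 0) then 1 else 0
  h := 0
  h_hermitian := isHermitian_zero
  C := (1 / 4 : ℂ) • 1
  C_posSemidef := PosSemidef.one.smul (by simp)

/-- The populations of the density matrix. They are distinct, so that `σ` is invertible on the
off-diagonal labels, and their differences from the last one are distinct as well. -/
def pop : Fin 3 → ℝ := ![2 / 3, 1 / 3, 0]

/-- The averages of the diagonal density matrix with the given populations. -/
def avg (μ : Idx 3) : ℝ := if (idx.symm μ).1 = (idx.symm μ).2 then pop (idx.symm μ).1 else 0

lemma avg_mem : avg ∈ model.averages := by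
  refine ⟨diagonal fun i => (pop i : ℂ), PosSemidef.diagonal fun i => ?_, ?_, fun μ => ?_⟩
  · fin_cases i <;> simp [pop, Complex.le_def]; norm_num
  · rw [trace_diagonal, Fin.sum_univ_three]
    simp [pop]
    norm_num
  · rw [trace_mul_comm]
    change _ = (hermUnit (idx.symm μ) * _).trace
    rw [trace_hermUnit_mul, avg]
    by_cases h : (idx.symm μ).1 = (idx.symm μ).2
    · simp only [h, if_true, diagonal_apply_eq]
      ring
    · rw [if_neg h, diagonal_apply_ne _ h, diagonal_apply_ne _ (Ne.symm h)]
      simp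

lemma sum_avg : ∑ μ, (avg μ : ℂ) • model.v μ = diagonal fun i => (pop i : ℂ) := by
  change ∑ μ, (avg μ : ℂ) • hermUnit (idx.symm μ) = _
  rw [← idx.sum_comp, Fintype.sum_prod_type]
  simp only [avg, Equiv.symm_apply_apply]
  have : ∀ i : Fin 3, ∑ j, (((if i = j then pop i else 0 : ℝ)) : ℂ) • hermUnit (i, j)
      = single i i (pop i : ℂ) := fun i => by
    rw [Finset.sum_eq_single i (fun j _ hj => by simp [Ne.symm hj]) (by simp), hermUnit_diag]
    simp
  rw [Finset.sum_congr rfl fun i _ => this i]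
  exact sum_single_eq_diagonal _

lemma sum_ε : ∑ μ, (model.ε μ : ℂ) • model.v μ = single 0 1 1 + single 1 0 1 := by
  change ∑ μ, ((if idx.symm μ = (0, 1) ∨ idx.symm μ = (1, 0) then 1 else 0 : ℝ) : ℂ) •
    hermUnit (idx.symm μ) = _
  rw [← idx.sum_comp]
  simp only [Equiv.symm_apply_apply]
  rw [Finset.sum_eq_add (0, 1) (1, 0) (by decide) (fun p _ hp => by simp [hp.1, hp.2])
    (by simp) (by simp)]
  ext i j
  fin_cases i <;> fin_cases j <;> simp [hermUnit] <;> ring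

/-- Sums of structure constants are commutator expectations. -/
lemma sum_J (M : MeanFieldModel 3) (μ ν : Idx 3) (c : Idx 3 → ℂ) :
    ∑ α, c α * M.J μ ν α = ((M.v μ * M.v ν - M.v ν * M.v μ) * ∑ α, c α • M.v α).trace := by
  simp only [MeanFieldModel.J, Finset.mul_sum, trace_sum, Matrix.mul_smul, trace_smul, smul_eq_mul]

lemma sigmaC_apply (p q : Fin 3 × Fin 3) : model.sigmaC avg (idx p) (idx q)
    = if p = q.swap then (pop q.2 - pop q.1 : ℂ) else 0 := by
  have e : ∑ α, model.J (idx p) (idx q) α * (avg α : ℂ)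
      = ∑ α, (avg α : ℂ) * model.J (idx p) (idx q) α :=
    Finset.sum_congr rfl fun α _ => mul_comm _ _
  rw [sigmaC, of_apply, e, sum_J, sum_avg]
  change -Complex.I * ((hermUnit (idx.symm (idx p)) * hermUnit (idx.symm (idx q))
    - hermUnit (idx.symm (idx q)) * hermUnit (idx.symm (idx p))) * _).trace = _
  rw [Equiv.symm_apply_apply, Equiv.symm_apply_apply]
  set Δ := diagonal fun i => (pop i : ℂ)
  have hc : ((hermUnit p * hermUnit q - hermUnit q * hermUnit p) * Δ).trace
      = (hermUnit p * (hermUnit q * Δ - Δ * hermUnit q)).trace := by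
    rw [Matrix.sub_mul, Matrix.mul_sub, trace_sub, trace_sub, Matrix.mul_assoc, Matrix.mul_assoc,
      trace_mul_comm (hermUnit q), Matrix.mul_assoc]
  rw [hc, hermUnit_comm_diagonal, Matrix.mul_smul, trace_smul, trace_hermUnit_mul_hermUnit]
  split_ifs
  · linear_combination (pop q.1 - pop q.2 : ℂ) * Complex.I_sq
  · simp

lemma DC_apply (p q : Fin 3 × Fin 3) (ω : Idx 3 → ℝ) : model.DC ω (idx p) (idx q)
    = Complex.I * ((hermUnit p * hermUnit q - hermUnit q * hermUnit p)
      * (single 0 1 1 + single 1 0 1)).trace := by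
  have hB : model.Btilde = 0 := by
    have h1 : model.B = 0 := by
      change (1 / 2 : ℂ) • ((1 / 4 : ℂ) • (1 : Matrix (Idx 3) (Idx 3) ℂ)
        - ((1 / 4 : ℂ) • (1 : Matrix (Idx 3) (Idx 3) ℂ))ᵀ) = 0
      simp
    have h2 : model.hRe = 0 := by
      ext i j
      simp [hRe, cplx, rePart, model]
    rw [Btilde, h1, h2]; simp
  rw [DC, of_apply, hB, sum_J, sum_ε]
  simp only [Matrix.zero_apply, mul_zero, zero_mul, Finset.sum_const_zero, zero_add]
  change Complex.I * ((hermUnit (idx.symm (idx p)) * hermUnit (idx.symm (idx q))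
    - hermUnit (idx.symm (idx q)) * hermUnit (idx.symm (idx p))) * _).trace = _
  rw [Equiv.symm_apply_apply, Equiv.symm_apply_apply]

lemma sigmaC_mul_apply (Z : Matrix (Idx 3) (Idx 3) ℂ) (p : Fin 3 × Fin 3) (ν : Idx 3) :
    (model.sigmaC avg * Z) (idx p) ν = (pop p.1 - pop p.2 : ℂ) * Z (idx p.swap) ν := by
  rw [Matrix.mul_apply, ← idx.sum_comp, Finset.sum_eq_single p.swap]
  · rw [sigmaC_apply]; simp
  · intro q _ hq
    rw [sigmaC_apply, if_neg, zero_mul]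
    rintro rfl
    simp at hq
  · simp

lemma mul_sigmaC_apply (Z : Matrix (Idx 3) (Idx 3) ℂ) (q : Fin 3 × Fin 3) (μ : Idx 3) :
    (Z * model.sigmaC avg) μ (idx q) = Z μ (idx q.swap) * (pop q.2 - pop q.1 : ℂ) := by
  rw [Matrix.mul_apply, ← idx.sum_comp, Finset.sum_eq_single q.swap]
  · rw [sigmaC_apply]; simp
  · intro p _ hp
    rw [sigmaC_apply, if_neg hp, mul_zero]
  · simp

/-- The Hamiltonian makes `D¹¹` couple the labels `(0, 2)`, `(2, 0)` to the labels `(1, 2)`,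
`(2, 1)`. On these, `σ¹¹` has the different weights `2/3` and `1/3`, so that `[(σ¹¹)⁻¹, D¹¹]` does
not vanish; its off-diagonal contribution outweighs the diagonal `C = 1/4`. -/
theorem not_posSemidef_K11 {R : Matrix (model.BlockIdx avg) (Idx 3) ℝ}
    (hR : model.IsBlockRotation avg R) : ¬ (K11 R).PosSemidef := by
  intro hK
  have hT := hR.posSemidef_of_K11 hK
  set T := model.sigmaC avg * (model.sigmaC avg * (model.C * (model.sigmaC avg * model.sigmaC avg)))
      + (Complex.I / 2) • (model.sigmaC avg * (model.DC avg * (model.sigmaC avg * model.sigmaC avg))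
        - model.sigmaC avg * (model.sigmaC avg * (model.DC avg * model.sigmaC avg))) with hTdef
  have entry : ∀ p q, T (idx p) (idx q) =
      (pop p.1 - pop p.2 : ℂ) * (pop q.2 - pop q.1) *
      ((pop p.1 - pop p.2 : ℂ) * (pop q.2 - pop q.1) * (if p = q then 1 / 4 else 0)
      + Complex.I / 2 * ((pop p.1 - pop p.2) * model.DC avg (idx p) (idx q.swap)
        - (pop q.2 - pop q.1) * model.DC avg (idx p.swap) (idx q))) := by
    intro p q
    have hC : model.C (idx p) (idx q) = if p = q then 1 / 4 else 0 := by
      change ((1 / 4 : ℂ) • (1 : Matrix (Idx 3) (Idx 3) ℂ)) (idx p) (idx q) = _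
      rw [Matrix.smul_apply, Matrix.one_apply]
      simp only [idx.injective.eq_iff]
      split_ifs <;> simp
    rw [hTdef]
    simp only [Matrix.add_apply, Matrix.smul_apply, Matrix.sub_apply, sigmaC_mul_apply,
      ← Matrix.mul_assoc, mul_sigmaC_apply]
    simp only [Matrix.mul_assoc, sigmaC_mul_apply, Prod.swap_swap, Prod.fst_swap, Prod.snd_swap,
      smul_eq_mul, hC]
    ring
  -- the vector `e₀₂ + i e₁₂`
  have h0 := hT.dotProduct_mulVec_nonneg
    (Pi.single (idx (0, 2)) 1 + Complex.I • Pi.single (idx (1, 2)) 1)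
  have hform : star (Pi.single (idx (0, 2)) 1 + Complex.I • Pi.single (idx (1, 2)) 1 : Idx 3 → ℂ) ⬝ᵥ
      (T *ᵥ (Pi.single (idx (0, 2)) 1 + Complex.I • Pi.single (idx (1, 2)) 1))
      = T (idx (0, 2)) (idx (0, 2)) + Complex.I * T (idx (0, 2)) (idx (1, 2))
        - Complex.I * T (idx (1, 2)) (idx (0, 2)) + T (idx (1, 2)) (idx (1, 2)) := by
    rw [star_add, star_smul, mulVec_add, mulVec_smul, add_dotProduct, dotProduct_add,
      dotProduct_add, ← Pi.single_star, ← Pi.single_star]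
    simp only [star_one, smul_dotProduct, dotProduct_smul, single_one_dotProduct, mulVec_single_one,
      col_apply, smul_eq_mul, Complex.star_def, Complex.conj_I]
    linear_combination -T (idx (1, 2)) (idx (1, 2)) * Complex.I_sq
  rw [hform] at h0
  simp only [entry, DC_apply] at h0
  have hval : ∀ p q : Fin 3 × Fin 3, ((hermUnit p * hermUnit q - hermUnit q * hermUnit p)
      * (single 0 1 1 + single 1 0 1)).trace
      = (hermUnit p * hermUnit q - hermUnit q * hermUnit p) 1 0
        + (hermUnit p * hermUnit q - hermUnit q * hermUnit p) 0 1 := by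
    intro p q
    rw [Matrix.mul_add, trace_add, trace_mul_single, trace_mul_single]
    simp
  simp only [hval] at h0
  simp [hermUnit, pop, Matrix.mul_apply, Complex.le_def, single_apply] at h0
  norm_num at h0

theorem exists_K11_not_posSemidef : ∃ (d : ℕ) (M : MeanFieldModel d) (ω : M.averages)
    (R : Matrix (M.BlockIdx ω) (Idx d) ℝ),
    M.IsBlockRotation ω R ∧ (K11 R).IsHermitian ∧ ¬ (K11 R).PosSemidef := by
  obtain ⟨R, hR⟩ := model.exists_isBlockRotation avg
  exact ⟨3, model, ⟨avg, avg_mem⟩, R, hR, hR.isHermitian_K11, not_posSemidef_K11 hR⟩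

end NonPositiveModel

/-! ### Uniform estimates for ordinary differential equations near a compact set -/

/-- A `C¹` function is uniformly Lipschitz near the points of a compact set. -/
lemma exists_uniform_lipschitz_near_compact {E E' : Type*} [NormedAddCommGroup E] [NormedSpace ℝ E]
    [ProperSpace E] [NormedAddCommGroup E'] [NormedSpace ℝ E'] {f : E → E'} {U K : Set E}
    (hU : IsOpen U) (hf : ContDiffOn ℝ 1 f U) (hK : IsCompact K) (hKU : K ⊆ U) :
    ∃ δ > 0, ∃ L ≥ 0, ∀ p ∈ K, ‖f p‖ ≤ L ∧ ∀ y, dist y p ≤ δ → y ∈ U ∧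
      ‖f y - f p‖ ≤ L * ‖y - p‖ := by
  obtain ⟨δ, hδ, hsub⟩ := hK.exists_cthickening_subset_open hU hKU
  have hcf : ContinuousOn (fderiv ℝ f) (Metric.cthickening δ K) :=
    (hf.continuousOn_fderiv_of_isOpen hU le_rfl).mono hsub
  obtain ⟨C₁, hC₁⟩ := (hK.cthickening).exists_bound_of_continuousOn hcf
  obtain ⟨C₂, hC₂⟩ := hK.exists_bound_of_continuousOn (hf.continuousOn.mono hKU)
  refine ⟨δ, hδ, max 0 (max C₁ C₂), le_max_left _ _, fun p hp => ⟨(hC₂ p hp).trans ?_, fun y hy => ?_⟩⟩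
  · exact (le_max_right _ _).trans (le_max_right _ _)
  have hball : Metric.closedBall p δ ⊆ Metric.cthickening δ K :=
    Metric.closedBall_subset_cthickening hp δ
  refine ⟨hsub (hball hy), (convex_closedBall p δ).norm_image_sub_le_of_norm_fderiv_le (𝕜 := ℝ)
    (fun a ha => ?_) (fun a ha => ?_) (Metric.mem_closedBall_self hδ.le) hy⟩
  · exact (hf.contDiffAt (hU.mem_nhds (hsub (hball ha)))).differentiableAt one_ne_zero
  · exact (hC₁ a (hball ha)).trans ((le_max_left _ _).trans (le_max_right _ _))

/-- For a `C¹` vector field, the solutions that start in a compact set move with bounded speed and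
separate in a Lipschitz way for a time that is uniform in the starting point. -/
lemma exists_uniform_flow_bounds {E : Type*} [NormedAddCommGroup E] [NormedSpace ℝ E]
    [ProperSpace E] {v : E → E} (hv : ContDiff ℝ 1 v) {K : Set E} (hK : IsCompact K) :
    ∃ T > 0, ∃ C ≥ 0, ∃ L : ℝ, ∀ z z' : ℝ → E,
      (∀ t, 0 ≤ t → HasDerivWithinAt z (v (z t)) (Ici 0) t) →
      (∀ t, 0 ≤ t → HasDerivWithinAt z' (v (z' t)) (Ici 0) t) → z 0 ∈ K → z' 0 ∈ K →
      ∀ t ∈ Icc 0 T, ‖z t - z 0‖ ≤ C * t ∧ dist (z t) (z' t) ≤ L * dist (z 0) (z' 0) := by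
  obtain ⟨ρ, hρ⟩ := hK.isBounded.subset_closedBall 0
  set S : Set E := Metric.closedBall 0 (ρ + 1) with hS
  have hSc : IsCompact S := isCompact_closedBall _ _
  obtain ⟨C, hC⟩ := hSc.exists_bound_of_continuousOn hv.continuous.continuousOn
  obtain ⟨Λ, hΛ⟩ := hSc.exists_bound_of_continuousOn
    (hv.continuous_fderiv one_ne_zero).continuousOn
  have hlip : LipschitzOnWith (max Λ 0).toNNReal v S := by
    refine (convex_closedBall _ _).lipschitzOnWith_of_nnnorm_fderiv_le (𝕜 := ℝ)
      (fun a _ => hv.differentiable one_ne_zero a) fun a ha => ?_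
    rw [← NNReal.coe_le_coe, coe_nnnorm, Real.coe_toNNReal _ (le_max_right _ _)]
    exact (hΛ a ha).trans (le_max_left _ _)
  set c : ℝ := max C 0 + 1 with hc
  have hc0 : 0 < c := by positivity
  have hmono : ∀ z : ℝ → E, (∀ t, 0 ≤ t → HasDerivWithinAt z (v (z t)) (Ici 0) t) →
      ∀ t, 0 ≤ t → HasDerivWithinAt z (v (z t)) (Ici t) t := fun z hz t ht =>
    (hz t ht).mono (Ici_subset_Ici.2 ht)
  have hcont : ∀ z : ℝ → E, (∀ t, 0 ≤ t → HasDerivWithinAt z (v (z t)) (Ici 0) t) →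
      ContinuousOn z (Icc 0 c⁻¹) := fun z hz t ht =>
    ((hz t ht.1).continuousWithinAt).mono Icc_subset_Ici_self
  have hSball : ∀ a ∈ K, ∀ b, ‖b - a‖ ≤ 1 → b ∈ S := fun a ha b hb => by
    have h1 := mem_closedBall_zero_iff.1 (hρ ha)
    have h2 := norm_le_norm_add_norm_sub' b a
    exact mem_closedBall_zero_iff.2 (by linarith)
  have hspeed : ∀ z : ℝ → E, (∀ t, 0 ≤ t → HasDerivWithinAt z (v (z t)) (Ici 0) t) → z 0 ∈ K →
      ∀ t ∈ Icc 0 c⁻¹, ‖z t - z 0‖ ≤ c * t := by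
    intro z hz hz0
    refine image_norm_le_of_norm_deriv_right_lt_deriv_boundary' (f := fun t => z t - z 0)
      (f' := fun t => v (z t)) (B' := fun _ => c) ((hcont z hz).sub continuousOn_const)
      (fun t ht => (hmono z hz t ht.1).sub_const _) (by simp) (by fun_prop)
      (fun t _ => by simpa using ((hasDerivAt_id t).const_mul c).hasDerivWithinAt) ?_
    intro t ht he
    have h1 : c * t ≤ 1 := by
      calc c * t ≤ c * c⁻¹ := by gcongr; exact ht.2.le
        _ = 1 := mul_inv_cancel₀ hc0.ne'
    have h2 := hC (z t) (hSball _ hz0 _ (he.trans_le h1))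
    exact h2.trans_lt ((le_max_left _ _).trans_lt (lt_add_one _))
  have hstay : ∀ z : ℝ → E, (∀ t, 0 ≤ t → HasDerivWithinAt z (v (z t)) (Ici 0) t) → z 0 ∈ K →
      ∀ t ∈ Ico 0 c⁻¹, z t ∈ S := by
    intro z hz hz0 t ht
    refine hSball _ hz0 _ ((hspeed z hz hz0 t ⟨ht.1, ht.2.le⟩).trans ?_)
    calc c * t ≤ c * c⁻¹ := by gcongr; exact ht.2.le
      _ = 1 := mul_inv_cancel₀ hc0.ne'
  refine ⟨c⁻¹, inv_pos.2 hc0, c, hc0.le, Real.exp ((max Λ 0).toNNReal * c⁻¹),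
    fun z z' hz hz' hz0 hz0' t ht => ⟨hspeed z hz hz0 t ht, ?_⟩⟩
  have := dist_le_of_trajectories_ODE_of_mem (v := fun _ => v) (s := fun _ => S) (fun _ _ => hlip)
    (hcont z hz) (fun t ht => hmono z hz t ht.1) (hstay z hz hz0) (hcont z' hz')
    (fun t ht => hmono z' hz' t ht.1) (hstay z' hz' hz0') le_rfl t ht
  rw [sub_zero, mul_comm] at this
  refine this.trans ?_
  gcongr
  exact ht.2

/-- The right derivative at `0` of `t ↦ ∫₀ᵗ I(t, s) ds` is `I(0, 0)`. -/
lemma hasDerivWithinAt_integral_of_continuousOn {I : ℝ → ℝ → ℝ} {T : ℝ} (hT : 0 < T)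
    (hI : ContinuousOn (fun p : ℝ × ℝ => I p.1 p.2) (Icc 0 T ×ˢ Icc 0 T)) :
    HasDerivWithinAt (fun t => ∫ s in (0 : ℝ)..t, I t s) (I 0 0) (Ici 0) 0 := by
  rw [hasDerivWithinAt_iff_isLittleO, Asymptotics.isLittleO_iff]
  intro ε hε
  have h0 : ((0 : ℝ), (0 : ℝ)) ∈ Icc 0 T ×ˢ Icc 0 T := ⟨⟨le_rfl, hT.le⟩, ⟨le_rfl, hT.le⟩⟩
  obtain ⟨η, hη, hη'⟩ := Metric.continuousWithinAt_iff.1 (hI _ h0) ε hε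
  have hmem : Iio (min η T) ∈ 𝓝 (0 : ℝ) := Iio_mem_nhds (lt_min hη hT)
  filter_upwards [inter_mem_nhdsWithin (Ici (0 : ℝ)) hmem] with t ht
  have ht0 : 0 ≤ t := ht.1
  have htη : t < η := lt_of_lt_of_le ht.2 (min_le_left _ _)
  have htT : t < T := lt_of_lt_of_le ht.2 (min_le_right _ _)
  have hint : IntervalIntegrable (fun s => I t s) volume 0 t := by
    refine ContinuousOn.intervalIntegrable ?_
    rw [uIcc_of_le ht0]
    exact hI.comp (f := fun s : ℝ => (t, s)) (by fun_prop)
      fun s hs => ⟨⟨ht0, htT.le⟩, ⟨hs.1, hs.2.trans htT.le⟩⟩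
  have e : (∫ s in (0 : ℝ)..t, I t s) - t * I 0 0 = ∫ s in (0 : ℝ)..t, (I t s - I 0 0) := by
    rw [intervalIntegral.integral_sub hint (by simp), intervalIntegral.integral_const]
    simp
  have hb := intervalIntegral.norm_integral_le_of_norm_le_const (a := 0) (b := t)
    (f := fun s => I t s - I 0 0) (C := ε) fun s hs => by
      rw [uIoc_of_le ht0] at hs
      have h1 : ((t, s) : ℝ × ℝ) ∈ Icc 0 T ×ˢ Icc 0 T :=
        ⟨⟨ht0, htT.le⟩, ⟨hs.1.le, hs.2.trans htT.le⟩⟩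
      have h2 : dist ((t, s) : ℝ × ℝ) (0, 0) < η := by
        rw [Prod.dist_eq, Real.dist_0_eq_abs, Real.dist_0_eq_abs, abs_of_nonneg ht0,
          abs_of_pos hs.1]
        exact max_lt htη (hs.2.trans_lt htη)
      exact (hη' h1 h2).le
  simpa [e, smul_eq_mul] using hb

open scoped MatrixOrder in
lemma exists_eq_conjTranspose_mul_self {n : Type*} [Fintype n] {ρ : Matrix n n ℂ}
    (hρ : ρ.PosSemidef) : ∃ b, ρ = bᴴ * b := by
  classical
  exact CStarAlgebra.nonneg_iff_eq_star_mul_self.mp hρ.nonneg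

/-! ### The macroscopic averages and the matrices of the mesoscopic dynamics -/

namespace MeanFieldModel

variable {d : ℕ} (M : MeanFieldModel d)

/-- Density matrices are the matrices `bᴴ b` with `b` on a sphere, so that the set of the macroscopic
averages is compact. -/
lemma isCompact_averages : IsCompact M.averages := by
  set S : Set (Matrix (Fin d) (Fin d) ℂ) := {b | (bᴴ * b).trace = 1} with hS
  have hScl : IsClosed S := isClosed_eq
    (continuous_id.matrix_conjTranspose.matrix_mul continuous_id).matrix_trace continuous_const
  have hbox : S ⊆ Set.pi univ fun _ => Set.pi univ fun _ => Metric.closedBall (0 : ℂ) 1 := by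
    intro b hb i _ j _
    have h1 : ∑ j, ∑ i, ‖b i j‖ ^ 2 = 1 := by
      have h2 : (((∑ j, ∑ i, ‖b i j‖ ^ 2 : ℝ)) : ℂ) = 1 := by
        rw [← show (bᴴ * b).trace = 1 from hb]
        simp only [trace, diag_apply, Matrix.mul_apply, conjTranspose_apply, Complex.ofReal_sum,
          Complex.ofReal_pow, Complex.star_def, Complex.conj_mul']
      exact_mod_cast h2
    have h3 : ‖b i j‖ ^ 2 ≤ 1 := by
      rw [← h1]
      refine le_trans ?_ (Finset.single_le_sum (f := fun j => ∑ i, ‖b i j‖ ^ 2)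
        (fun _ _ => by positivity) (Finset.mem_univ j))
      exact Finset.single_le_sum (f := fun i => ‖b i j‖ ^ 2)
        (fun _ _ => by positivity) (Finset.mem_univ i)
    rw [mem_closedBall_zero_iff]
    exact (sq_le_one_iff₀ (norm_nonneg _)).1 h3
  have hSc : IsCompact S := (isCompact_univ_pi fun _ => isCompact_univ_pi fun _ =>
    isCompact_closedBall _ _).of_isClosed_subset hScl hbox
  have himg : M.averages = (fun (b : Matrix (Fin d) (Fin d) ℂ) (μ : Idx d) =>
      ((bᴴ * b * M.v μ).trace).re) '' S := by
    ext ω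
    constructor
    · rintro ⟨ρ, hρ, htr, hω⟩
      obtain ⟨b, rfl⟩ := exists_eq_conjTranspose_mul_self hρ
      exact ⟨b, htr, funext fun μ => (congrArg Complex.re (hω μ)).symm⟩
    · rintro ⟨b, hb, rfl⟩
      refine ⟨bᴴ * b, posSemidef_conjTranspose_mul_self b, hb, fun μ => ?_⟩
      refine Complex.conj_eq_iff_re.1 ?_
      change star _ = _
      rw [← trace_conjTranspose, conjTranspose_mul, conjTranspose_mul, conjTranspose_conjTranspose,
        (M.v_hermitian μ).eq, trace_mul_comm]
  rw [himg]
  refine hSc.image (continuous_pi fun μ => Complex.continuous_re.comp ?_)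
  exact ((continuous_id.matrix_conjTranspose.matrix_mul continuous_id).matrix_mul
    continuous_const).matrix_trace

lemma contDiff_sigma (i j : Idx d) : ContDiff ℝ 1 fun ω => M.sigma ω i j := by
  refine Complex.reCLM.contDiff.comp (contDiff_const.mul ?_)
  exact ContDiff.sum fun α _ => contDiff_const.mul
    (Complex.ofRealCLM.contDiff.comp (contDiff_apply ℝ ℝ α))

lemma contDiff_DC (i j : Idx d) : ContDiff ℝ 1 fun ω => M.DC ω i j := by
  refine ContDiff.add ?_ contDiff_const
  exact ContDiff.sum fun μ _ => ContDiff.sum fun ν _ => contDiff_const.mul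
    (Complex.ofRealCLM.contDiff.comp (contDiff_apply ℝ ℝ ν))

lemma contDiff_omegaDot : ContDiff ℝ 1 M.omegaDot := by
  refine contDiff_pi.2 fun i => ?_
  change ContDiff ℝ 1 fun ω => ∑ j, M.D ω i j * ω j
  exact ContDiff.sum fun j _ => (Complex.reCLM.contDiff.comp (M.contDiff_DC i j)).mul
    (contDiff_apply ℝ ℝ j)

lemma contDiff_Q (i j : Idx d) : ContDiff ℝ 1 fun ω => M.Q ω i j := by
  refine Complex.reCLM.contDiff.comp (ContDiff.add ?_ (M.contDiff_DC i j))
  have h : (fun ω : Idx d → ℝ => ((-Complex.I) • (M.sigmaC ω * M.Btilde)) i j)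
      = fun ω => -Complex.I * ∑ k, (M.sigma ω i k : ℂ) * M.Btilde k j := by
    ext ω
    rw [← M.cplx_sigma ω, Matrix.smul_apply, Matrix.mul_apply]
    rfl
  rw [h]
  exact contDiff_const.mul (ContDiff.sum fun k _ =>
    (Complex.ofRealCLM.contDiff.comp (M.contDiff_sigma i k)).mul contDiff_const)

end MeanFieldModel

/-! ### Small times, uniformly in the initial averages -/

namespace MeanFieldModel

variable {d : ℕ} (M : MeanFieldModel d)

lemma norm_apply_apply_le (Z : Idx d → Idx d → ℝ) (i j : Idx d) : ‖Z i j‖ ≤ ‖Z‖ :=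
  (norm_le_pi_norm (Z i) j).trans (norm_le_pi_norm Z i)

/-- The integrand of `Y_t` as a function of `ω_s`, `X_t` and `X_s`. -/
def diffusionKernel (y : Idx d → ℝ) (Z Z' : Matrix (Idx d) (Idx d) ℝ) : Matrix (Idx d) (Idx d) ℝ :=
  (Z * Z'⁻¹) * (M.sigma y * rePart M.A * (M.sigma y)ᵀ) * (Z * Z'⁻¹)ᵀ

lemma continuous_sigma : Continuous M.sigma :=
  continuous_matrix fun i j => (M.contDiff_sigma i j).continuous

lemma continuousOn_diffusionKernel : ContinuousOn
    (fun p : (Idx d → ℝ) × Matrix (Idx d) (Idx d) ℝ × Matrix (Idx d) (Idx d) ℝ =>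
      M.diffusionKernel p.1 p.2.1 p.2.2) {p | p.2.2.det ≠ 0} := by
  intro p hp
  refine ContinuousAt.continuousWithinAt ?_
  have hinv : ContinuousAt (fun p : (Idx d → ℝ) × Matrix (Idx d) (Idx d) ℝ ×
      Matrix (Idx d) (Idx d) ℝ => p.2.2⁻¹) p := by
    refine ContinuousAt.comp (f := fun p : (Idx d → ℝ) × Matrix (Idx d) (Idx d) ℝ ×
      Matrix (Idx d) (Idx d) ℝ => p.2.2) (g := Inv.inv) (continuousAt_matrix_inv _ ?_) (by fun_prop)
    rw [Ring.inverse_eq_inv']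
    exact continuousAt_inv₀ hp
  have h1 : ContinuousAt (fun p : (Idx d → ℝ) × Matrix (Idx d) (Idx d) ℝ ×
      Matrix (Idx d) (Idx d) ℝ => p.2.1 * p.2.2⁻¹) p :=
    ContinuousAt.mul (M := Matrix (Idx d) (Idx d) ℝ) (by fun_prop) hinv
  have h2 : ContinuousAt (fun p : (Idx d → ℝ) × Matrix (Idx d) (Idx d) ℝ ×
      Matrix (Idx d) (Idx d) ℝ => M.sigma p.1 * rePart M.A * (M.sigma p.1)ᵀ) p := by
    have := M.continuous_sigma.comp (continuous_fst (X := Idx d → ℝ)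
      (Y := Matrix (Idx d) (Idx d) ℝ × Matrix (Idx d) (Idx d) ℝ))
    exact ((this.matrix_mul continuous_const).matrix_mul this.matrix_transpose).continuousAt
  have h3 : ContinuousAt (fun p : (Idx d → ℝ) × Matrix (Idx d) (Idx d) ℝ ×
      Matrix (Idx d) (Idx d) ℝ => (p.2.1 * p.2.2⁻¹)ᵀ) p :=
    (continuous_id.matrix_transpose).continuousAt.comp h1
  exact ContinuousAt.mul (M := Matrix (Idx d) (Idx d) ℝ)
    (ContinuousAt.mul (M := Matrix (Idx d) (Idx d) ℝ) h1 h2) h3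

lemma diffusionKernel_one (y : Idx d → ℝ) :
    M.diffusionKernel y 1 1 = M.sigma y * rePart M.A * (M.sigma y)ᵀ := by
  simp [diffusionKernel]

variable {M} {x : M.averages → ℝ → Idx d → ℝ} {X : M.averages → ℝ → Matrix (Idx d) (Idx d) ℝ}

/-- Averages and time-ordered exponential together solve one autonomous equation with a smooth
vector field and a compact set of initial values. -/
lemma exists_small_time_x_X (hx : ∀ ω : M.averages, M.IsMacroTrajectory ω (x ω))
    (hX : ∀ ω : M.averages, IsTimeOrderedExp (fun t => M.Q (x ω t)) (X ω)) :
    ∃ T > 0, ∃ C ≥ 0, ∀ t ∈ Icc 0 T, Continuous (fun ω => x ω t) ∧ Continuous (fun ω => X ω t) ∧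
      ∀ ω : M.averages, ‖x ω t - ω‖ ≤ C * t ∧
        ∀ i j, ‖X ω t i j - (1 : Matrix (Idx d) (Idx d) ℝ) i j‖ ≤ C * t := by
  set v : (Idx d → ℝ) × (Idx d → Idx d → ℝ) → (Idx d → ℝ) × (Idx d → Idx d → ℝ) :=
    fun p => (M.omegaDot p.1, fun i j => ∑ k, M.Q p.1 i k * p.2 k j) with hv
  have hvC : ContDiff ℝ 1 v := by
    refine (M.contDiff_omegaDot.comp contDiff_fst).prodMk
      (contDiff_pi.2 fun i => contDiff_pi.2 fun j => ContDiff.sum fun k _ => ?_)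
    have h1 : ContDiff ℝ 1 fun Z : Idx d → Idx d → ℝ => Z k j := contDiff_apply_apply ℝ ℝ k j
    exact ((M.contDiff_Q i k).comp contDiff_fst).mul (h1.comp contDiff_snd)
  set one : Idx d → Idx d → ℝ := fun i j => (1 : Matrix (Idx d) (Idx d) ℝ) i j with hone
  obtain ⟨T, hT, C, hC, L, hL⟩ := exists_uniform_flow_bounds hvC
    (M.isCompact_averages.prod (isCompact_singleton (x := one)))
  set z : M.averages → ℝ → (Idx d → ℝ) × (Idx d → Idx d → ℝ) :=
    fun ω t => (x ω t, fun i j => X ω t i j) with hz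
  have hsol : ∀ ω t, 0 ≤ t → HasDerivWithinAt (z ω) (v (z ω t)) (Ici 0) t := fun ω t ht =>
    ((hx ω).2 t ht).prodMk (hasDerivWithinAt_pi.2 fun i => hasDerivWithinAt_pi.2 fun j =>
      (hX ω).2 t ht i j)
  have hz0 : ∀ ω, z ω 0 = ((ω : Idx d → ℝ), one) := fun ω => by
    simp only [hz, (hx ω).1, (hX ω).1, hone]
  have hzK : ∀ ω, z ω 0 ∈ M.averages ×ˢ {one} := fun ω => by
    rw [hz0]; exact ⟨ω.2, rfl⟩
  refine ⟨T, hT, C, hC, fun t ht => ?_⟩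
  have hcont : Continuous fun ω => z ω t := by
    refine (LipschitzWith.of_dist_le' (K := L) fun ω ω' => ?_).continuous
    refine ((hL (z ω) (z ω') (hsol ω) (hsol ω') (hzK ω) (hzK ω') t ht).2).trans_eq ?_
    rw [hz0, hz0, Prod.dist_eq, dist_self, max_eq_left dist_nonneg]
    rfl
  refine ⟨continuous_fst.comp hcont, continuous_matrix fun i j => ?_, fun ω => ?_⟩
  · exact (continuous_apply_apply i j).comp (continuous_snd.comp hcont)
  · have h1 := (hL (z ω) (z ω) (hsol ω) (hsol ω) (hzK ω) (hzK ω) t ht).1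
    rw [hz0] at h1
    refine ⟨(norm_fst_le (z ω t - ((ω : Idx d → ℝ), one))).trans h1, fun i j => ?_⟩
    have h2 := (norm_snd_le (z ω t - ((ω : Idx d → ℝ), one))).trans h1
    exact (norm_apply_apply_le (z ω t - ((ω : Idx d → ℝ), one)).2 i j).trans h2

lemma exists_det_ne_zero_near_one : ∃ δ > 0, ∀ Z : Matrix (Idx d) (Idx d) ℝ,
    (∀ i j, ‖Z i j - (1 : Matrix (Idx d) (Idx d) ℝ) i j‖ ≤ δ) → Z.det ≠ 0 := by
  have hopen : IsOpen {Z : Idx d → Idx d → ℝ | (of Z).det ≠ 0} := by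
    refine isOpen_ne_fun ?_ continuous_const
    exact (Continuous.matrix_det (A := fun Z : Idx d → Idx d → ℝ => of Z) continuous_id)
  obtain ⟨ε, hε, h⟩ := Metric.isOpen_iff.1 hopen
    (fun i j => (1 : Matrix (Idx d) (Idx d) ℝ) i j) (by
      change (1 : Matrix (Idx d) (Idx d) ℝ).det ≠ 0
      simp)
  refine ⟨ε / 2, half_pos hε, fun Z hZ => h (a := fun i j => Z i j) ?_⟩
  refine lt_of_le_of_lt ?_ (half_lt_self hε)
  refine (dist_pi_le_iff (half_pos hε).le).2 fun i => (dist_pi_le_iff (half_pos hε).le).2 fun j => ?_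
  rw [dist_eq_norm]
  exact hZ i j

/-- The integrand of `Y_t` is uniformly bounded for small times, when `X_s` is still close to `1` and
thus invertible; its value at time `0` is `σ A σᵗʳ`. -/
lemma exists_small_time_Y (hx : ∀ ω : M.averages, M.IsMacroTrajectory ω (x ω))
    (hX : ∀ ω : M.averages, IsTimeOrderedExp (fun t => M.Q (x ω t)) (X ω)) :
    ∃ T > 0, ∃ C ≥ 0, (∀ t ∈ Icc 0 T, ∀ i j, Continuous (fun ω => M.Y (x ω) (X ω) t i j) ∧
        ∀ ω : M.averages, ‖M.Y (x ω) (X ω) t i j‖ ≤ C * t) ∧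
      ∀ (ω : M.averages) i j, HasDerivWithinAt (fun t => M.Y (x ω) (X ω) t i j)
        ((M.sigma ω * rePart M.A * (M.sigma ω)ᵀ) i j) (Ici 0) 0 := by
  obtain ⟨T₁, hT₁, C₁, hC₁, h₁⟩ := exists_small_time_x_X hx hX
  obtain ⟨δ, hδ, hdet⟩ := exists_det_ne_zero_near_one (d := d)
  obtain ⟨ρ, hρ⟩ := M.isCompact_averages.isBounded.subset_closedBall 0
  set T : ℝ := min T₁ (δ / (C₁ + 1)) with hT
  have hT0 : 0 < T := lt_min hT₁ (by positivity)
  have hCT : ∀ t ∈ Icc 0 T, C₁ * t ≤ δ := fun t ht => by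
    calc C₁ * t ≤ (C₁ + 1) * (δ / (C₁ + 1)) :=
          mul_le_mul (by linarith) (ht.2.trans (min_le_right _ _)) ht.1 (by linarith)
      _ = δ := by field_simp
  have hsub : ∀ t ∈ Icc 0 T, t ∈ Icc 0 T₁ := fun t ht => ⟨ht.1, ht.2.trans (min_le_left _ _)⟩
  set BX : Set (Matrix (Idx d) (Idx d) ℝ) := univ.pi fun i => univ.pi fun j =>
    Metric.closedBall ((1 : Matrix (Idx d) (Idx d) ℝ) i j) δ with hBX
  have hBXdet : ∀ Z ∈ BX, Z.det ≠ 0 := fun Z hZ => hdet Z fun i j => by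
    have := hZ i trivial j trivial
    rwa [Metric.mem_closedBall, dist_eq_norm] at this
  have hXB : ∀ ω, ∀ t ∈ Icc 0 T, X ω t ∈ BX := fun ω t ht i _ j _ => by
    rw [Metric.mem_closedBall, dist_eq_norm]
    exact (((h₁ t (hsub t ht)).2.2 ω).2 i j).trans (hCT t ht)
  have hxB : ∀ ω, ∀ t ∈ Icc 0 T, x ω t ∈ Metric.closedBall (0 : Idx d → ℝ) (ρ + δ) :=
    fun ω t ht => by
      have e1 := mem_closedBall_zero_iff.1 (hρ ω.2)
      have e2 := ((h₁ t (hsub t ht)).2.2 ω).1.trans (hCT t ht)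
      have e3 := norm_le_norm_add_norm_sub' (x ω t) ω
      exact mem_closedBall_zero_iff.2 (by linarith)
  set N : Set ((Idx d → ℝ) × Matrix (Idx d) (Idx d) ℝ × Matrix (Idx d) (Idx d) ℝ) :=
    Metric.closedBall (0 : Idx d → ℝ) (ρ + δ) ×ˢ (BX ×ˢ BX) with hN
  have hBXc : IsCompact BX := isCompact_univ_pi fun _ => isCompact_univ_pi fun _ =>
    isCompact_closedBall _ _
  have hNc : IsCompact N := (isCompact_closedBall _ _).prod (hBXc.prod hBXc)
  have hNsub : N ⊆ {p | p.2.2.det ≠ 0} := fun p hp => hBXdet _ hp.2.2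
  have hk : ∀ i j, ContinuousOn (fun p : (Idx d → ℝ) × Matrix (Idx d) (Idx d) ℝ ×
      Matrix (Idx d) (Idx d) ℝ => M.diffusionKernel p.1 p.2.1 p.2.2 i j) N := fun i j =>
    (continuous_id.matrix_elem i j).comp_continuousOn (M.continuousOn_diffusionKernel.mono hNsub)
  obtain ⟨C, hC⟩ := hNc.exists_bound_of_continuousOn
    (f := fun p (i j : Idx d) => M.diffusionKernel p.1 p.2.1 p.2.2 i j)
    (continuousOn_pi.2 fun i => continuousOn_pi.2 fun j => hk i j)
  have hmemN : ∀ ω, ∀ t ∈ Icc 0 T, ∀ s ∈ Icc 0 T, (x ω s, X ω t, X ω s) ∈ N :=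
    fun ω t ht s hs => ⟨hxB ω s hs, hXB ω t ht, hXB ω s hs⟩
  have hbound : ∀ ω, ∀ t ∈ Icc 0 T, ∀ s ∈ Icc 0 T, ∀ i j,
      ‖M.diffusionKernel (x ω s) (X ω t) (X ω s) i j‖ ≤ max C 0 := fun ω t ht s hs i j => by
    have h2 := hC (x ω s, X ω t, X ω s) (hmemN ω t ht s hs)
    have h3 := norm_apply_apply_le (fun i j => M.diffusionKernel (x ω s) (X ω t) (X ω s) i j) i j
    exact (h3.trans h2).trans (le_max_left _ _)
  have hxc : ∀ ω, ContinuousOn (x ω) (Icc 0 T) := fun ω t ht =>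
    (((hx ω).2 t ht.1).continuousWithinAt).mono Icc_subset_Ici_self
  have hXc : ∀ ω, ContinuousOn (X ω) (Icc 0 T) := fun ω =>
    continuousOn_pi.2 fun i => continuousOn_pi.2 fun j => fun t ht =>
      (((hX ω).2 t ht.1 i j).continuousWithinAt).mono Icc_subset_Ici_self
  have hjoint : ∀ ω i j, ContinuousOn
      (fun p : ℝ × ℝ => M.diffusionKernel (x ω p.2) (X ω p.1) (X ω p.2) i j)
      (Icc 0 T ×ˢ Icc 0 T) := by
    intro ω i j
    have h2 : ContinuousOn (fun p : ℝ × ℝ => (x ω p.2, X ω p.1, X ω p.2)) (Icc 0 T ×ˢ Icc 0 T) :=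
      ((hxc ω).comp continuousOn_snd fun p hp => hp.2).prodMk
        (((hXc ω).comp continuousOn_fst fun p hp => hp.1).prodMk
          ((hXc ω).comp continuousOn_snd fun p hp => hp.2))
    have h3 := (hk i j).comp h2 fun p hp => hmemN ω p.1 hp.1 p.2 hp.2
    exact h3
  refine ⟨T, hT0, max C 0, le_max_right _ _, fun t ht i j => ⟨?_, fun ω => ?_⟩, fun ω i j => ?_⟩
  · have hIoc : ∀ s ∈ uIoc 0 t, s ∈ Icc 0 T := fun s hs => by
      rw [uIoc_of_le ht.1] at hs
      exact ⟨hs.1.le, hs.2.trans ht.2⟩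
    change Continuous fun ω => ∫ s in (0 : ℝ)..t, M.diffusionKernel (x ω s) (X ω t) (X ω s) i j
    refine intervalIntegral.continuous_of_dominated_interval (bound := fun _ => max C 0)
      (fun ω => ?_) (fun ω => Eventually.of_forall fun s hs => ?_) intervalIntegrable_const
      (Eventually.of_forall fun s hs => ?_)
    · refine ContinuousOn.aestronglyMeasurable ?_ measurableSet_uIoc
      have h3 : ContinuousOn (fun s : ℝ => (t, s)) (uIoc 0 t) := by fun_prop
      have h4 := (hjoint ω i j).comp h3 fun s hs => ⟨ht, hIoc s hs⟩
      exact h4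
    · exact hbound ω t ht s (hIoc s hs) i j
    · have hs' := hIoc s hs
      have h2 : Continuous fun ω => (x ω s, X ω t, X ω s) :=
        (h₁ s (hsub s hs')).1.prodMk ((h₁ t (hsub t ht)).2.1.prodMk (h₁ s (hsub s hs')).2.1)
      have h3 := (hk i j).comp_continuous h2 fun ω => hmemN ω t ht s hs'
      exact h3
  · have := intervalIntegral.norm_integral_le_of_norm_le_const (a := 0) (b := t)
      (f := fun s => M.diffusionKernel (x ω s) (X ω t) (X ω s) i j) (C := max C 0) fun s hs => by
        rw [uIoc_of_le ht.1] at hs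
        exact hbound ω t ht s ⟨hs.1.le, hs.2.trans ht.2⟩ i j
    rw [sub_zero, abs_of_nonneg ht.1] at this
    exact this
  · have := hasDerivWithinAt_integral_of_continuousOn
      (I := fun t s => M.diffusionKernel (x ω s) (X ω t) (X ω s) i j) hT0 (hjoint ω i j)
    rw [(hX ω).1, (hx ω).1, diffusionKernel_one] at this
    exact this

/-- The scalar factor of `Φ^ext_t [W^f_r]`, so that
`Φ^ext_t [W^f_r](ω) = weight t ω • W_ω(label t ω)`. -/
def weight (M : MeanFieldModel d) (f : (Idx d → ℝ) → ℂ) (r : (Idx d → ℝ) → Idx d → ℝ)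
    (x : ℝ → Idx d → ℝ) (X : ℝ → Matrix (Idx d) (Idx d) ℝ) (t : ℝ) : ℂ :=
  f (x t) * Complex.exp (-(1 / 2) * ((r (x t) ⬝ᵥ (M.Y x X t *ᵥ r (x t)) : ℝ) : ℂ))

/-- The argument of the Weyl operator in `Φ^ext_t [W^f_r]`. -/
def label (r : (Idx d → ℝ) → Idx d → ℝ) (x : ℝ → Idx d → ℝ)
    (X : ℝ → Matrix (Idx d) (Idx d) ℝ) (t : ℝ) : Idx d → ℝ :=
  (X t)ᵀ *ᵥ r (x t)

lemma Y_zero (M : MeanFieldModel d) (x : ℝ → Idx d → ℝ) (X : ℝ → Matrix (Idx d) (Idx d) ℝ) :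
    M.Y x X 0 = 0 := by
  ext i j
  simp [Y]

/-- Weight and label of `Φ^ext_t [W^f_r]` depend continuously on the initial averages and change at
most at a uniform speed for small times. -/
lemma exists_small_time_weight_label (hx : ∀ ω : M.averages, M.IsMacroTrajectory ω (x ω))
    (hX : ∀ ω : M.averages, IsTimeOrderedExp (fun t => M.Q (x ω t)) (X ω))
    {f : (Idx d → ℝ) → ℂ} {r : (Idx d → ℝ) → Idx d → ℝ} (hf : IsC1On f M.averages)
    (hr : IsC1On r M.averages) :
    ∃ T > 0, ∃ C ≥ 0, ∀ t ∈ Icc 0 T, Continuous (fun ω => M.weight f r (x ω) (X ω) t) ∧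
      Continuous (fun ω => label r (x ω) (X ω) t) ∧ ∀ ω : M.averages,
        ‖M.weight f r (x ω) (X ω) t - M.weight f r (x ω) (X ω) 0‖ ≤ C * t ∧
        ‖label r (x ω) (X ω) t - label r (x ω) (X ω) 0‖ ≤ C * t ∧
        ‖M.weight f r (x ω) (X ω) 0‖ ≤ C ∧ ‖label r (x ω) (X ω) 0‖ ≤ C := by
  obtain ⟨U₁, hU₁, hS₁, hf⟩ := hf
  obtain ⟨U₂, hU₂, hS₂, hr⟩ := hr
  obtain ⟨T₁, hT₁, C₁, hC₁, h₁⟩ := exists_small_time_x_X hx hX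
  obtain ⟨T₂, hT₂, C₂, hC₂, h₂, -⟩ := exists_small_time_Y hx hX
  -- weight and label as a function of averages, time-ordered exponential and `Y`
  set Θ : (Idx d → ℝ) × (Idx d → Idx d → ℝ) × (Idx d → Idx d → ℝ) → ℂ × (Idx d → ℝ) := fun p =>
    (f p.1 * Complex.exp (-(1 / 2) * ((∑ i, r p.1 i * ∑ j, p.2.2 i j * r p.1 j : ℝ) : ℂ)),
      fun j => ∑ i, p.2.1 i j * r p.1 i) with hΘ
  set V : Set ((Idx d → ℝ) × (Idx d → Idx d → ℝ) × (Idx d → Idx d → ℝ)) :=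
    (U₁ ∩ U₂) ×ˢ univ with hV
  have hVo : IsOpen V := (hU₁.inter hU₂).prod isOpen_univ
  have hΘC : ContDiffOn ℝ 1 Θ V := by
    have hf' : ContDiffOn ℝ 1 (fun p : (Idx d → ℝ) × (Idx d → Idx d → ℝ) × (Idx d → Idx d → ℝ) =>
        f p.1) V := hf.comp contDiff_fst.contDiffOn fun p hp => hp.1.1
    have hr' : ∀ i, ContDiffOn ℝ 1
        (fun p : (Idx d → ℝ) × (Idx d → Idx d → ℝ) × (Idx d → Idx d → ℝ) => r p.1 i) V := fun i =>
      (contDiffOn_pi.1 hr i).comp contDiff_fst.contDiffOn fun p hp => hp.1.2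
    have hZ : ∀ i j, ContDiffOn ℝ 1
        (fun p : (Idx d → ℝ) × (Idx d → Idx d → ℝ) × (Idx d → Idx d → ℝ) => p.2.1 i j) V :=
      fun i j => ((contDiff_apply_apply ℝ ℝ i j).comp (contDiff_fst.comp contDiff_snd)).contDiffOn
    have hY : ∀ i j, ContDiffOn ℝ 1
        (fun p : (Idx d → ℝ) × (Idx d → Idx d → ℝ) × (Idx d → Idx d → ℝ) => p.2.2 i j) V :=
      fun i j => ((contDiff_apply_apply ℝ ℝ i j).comp (contDiff_snd.comp contDiff_snd)).contDiffOn
    have hq : ContDiffOn ℝ 1 (fun p : (Idx d → ℝ) × (Idx d → Idx d → ℝ) × (Idx d → Idx d → ℝ) =>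
        ∑ i, r p.1 i * ∑ j, p.2.2 i j * r p.1 j) V :=
      ContDiffOn.sum fun i _ => (hr' i).mul (ContDiffOn.sum fun j _ => (hY i j).mul (hr' j))
    refine ContDiffOn.prodMk (hf'.mul (ContDiffOn.cexp (contDiffOn_const.mul
      (Complex.ofRealCLM.contDiff.comp_contDiffOn hq)))) (contDiffOn_pi.2 fun j => ?_)
    exact ContDiffOn.sum fun i _ => (hZ i j).mul (hr' i)
  set one : Idx d → Idx d → ℝ := fun i j => (1 : Matrix (Idx d) (Idx d) ℝ) i j with hone
  have hK : IsCompact (M.averages ×ˢ ({(one, 0)} : Set ((Idx d → Idx d → ℝ) × (Idx d → Idx d → ℝ)))) :=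
    M.isCompact_averages.prod isCompact_singleton
  obtain ⟨δ, hδ, L, hL0, hL⟩ := exists_uniform_lipschitz_near_compact hVo hΘC hK
    fun p hp => ⟨⟨hS₁ hp.1, hS₂ hp.1⟩, trivial⟩
  set p : M.averages → ℝ → (Idx d → ℝ) × (Idx d → Idx d → ℝ) × (Idx d → Idx d → ℝ) := fun ω t =>
    (x ω t, (fun i j => X ω t i j), fun i j => M.Y (x ω) (X ω) t i j) with hp
  have hΘp : ∀ ω t, Θ (p ω t) = (M.weight f r (x ω) (X ω) t, label r (x ω) (X ω) t) :=
    fun ω t => rfl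
  have hp0 : ∀ ω, p ω 0 = ((ω : Idx d → ℝ), one, 0) := fun ω => by
    simp only [hp, (hx ω).1, (hX ω).1, Y_zero, hone]
    rfl
  have hpK : ∀ ω, p ω 0 ∈ M.averages ×ˢ
      ({(one, 0)} : Set ((Idx d → Idx d → ℝ) × (Idx d → Idx d → ℝ))) := fun ω => by
    rw [hp0]; exact ⟨ω.2, rfl⟩
  set C₃ := max C₁ C₂ with hC₃
  have hC₃0 : 0 ≤ C₃ := hC₁.trans (le_max_left _ _)
  set T := min (min T₁ T₂) (δ / (C₃ + 1)) with hT
  have hsub₁ : ∀ t ∈ Icc 0 T, t ∈ Icc 0 T₁ := fun t ht =>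
    ⟨ht.1, ht.2.trans ((min_le_left _ _).trans (min_le_left _ _))⟩
  have hsub₂ : ∀ t ∈ Icc 0 T, t ∈ Icc 0 T₂ := fun t ht =>
    ⟨ht.1, ht.2.trans ((min_le_left _ _).trans (min_le_right _ _))⟩
  have hCT : ∀ t ∈ Icc 0 T, C₃ * t ≤ δ := fun t ht => by
    calc C₃ * t ≤ (C₃ + 1) * (δ / (C₃ + 1)) :=
          mul_le_mul (by linarith) (ht.2.trans (min_le_right _ _)) ht.1 (by linarith)
      _ = δ := by field_simp
  have hspeed : ∀ t ∈ Icc 0 T, ∀ ω, ‖p ω t - p ω 0‖ ≤ C₃ * t := by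
    intro t ht ω
    have hn : 0 ≤ C₃ * t := mul_nonneg hC₃0 ht.1
    have hx1 := (h₁ t (hsub₁ t ht)).2.2 ω
    have hle1 : C₁ * t ≤ C₃ * t := mul_le_mul_of_nonneg_right (le_max_left _ _) ht.1
    have hle2 : C₂ * t ≤ C₃ * t := mul_le_mul_of_nonneg_right (le_max_right _ _) ht.1
    rw [hp0]
    refine max_le (hx1.1.trans hle1) (max_le ?_ ?_)
    · exact (pi_norm_le_iff_of_nonneg hn).2 fun i => (pi_norm_le_iff_of_nonneg hn).2 fun j =>
        (hx1.2 i j).trans hle1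
    · refine (pi_norm_le_iff_of_nonneg hn).2 fun i => (pi_norm_le_iff_of_nonneg hn).2 fun j => ?_
      have := (h₂ t (hsub₂ t ht) i j).2 ω
      simpa [hp] using this.trans hle2
  have hnear : ∀ t ∈ Icc 0 T, ∀ ω, p ω t ∈ V ∧ ‖Θ (p ω t) - Θ (p ω 0)‖ ≤ L * ‖p ω t - p ω 0‖ :=
    fun t ht ω => (hL _ (hpK ω)).2 _ (by
      rw [dist_eq_norm]; exact (hspeed t ht ω).trans (hCT t ht))
  refine ⟨T, lt_min (lt_min hT₁ hT₂) (by positivity), max (L * C₃) L,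
    hL0.trans (le_max_right _ _), fun t ht => ?_⟩
  have hpc : Continuous fun ω => p ω t := by
    refine (h₁ t (hsub₁ t ht)).1.prodMk (Continuous.prodMk ?_ ?_)
    · exact (h₁ t (hsub₁ t ht)).2.1
    · exact continuous_pi fun i => continuous_pi fun j => (h₂ t (hsub₂ t ht) i j).1
  have hΘc : Continuous fun ω => Θ (p ω t) :=
    hΘC.continuousOn.comp_continuous hpc fun ω => (hnear t ht ω).1
  simp only [hΘp] at hΘc
  refine ⟨continuous_fst.comp hΘc, continuous_snd.comp hΘc, fun ω => ?_⟩
  have hd : ‖Θ (p ω t) - Θ (p ω 0)‖ ≤ max (L * C₃) L * t := by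
    calc ‖Θ (p ω t) - Θ (p ω 0)‖ ≤ L * (C₃ * t) := (hnear t ht ω).2.trans
          (mul_le_mul_of_nonneg_left (hspeed t ht ω) hL0)
      _ = L * C₃ * t := by ring
      _ ≤ _ := mul_le_mul_of_nonneg_right (le_max_left _ _) ht.1
  have h0 : ‖Θ (p ω 0)‖ ≤ max (L * C₃) L := (hL _ (hpK ω)).1.trans (le_max_right _ _)
  exact ⟨(norm_fst_le (Θ (p ω t) - Θ (p ω 0))).trans hd,
    (norm_snd_le (Θ (p ω t) - Θ (p ω 0))).trans hd, (norm_fst_le (Θ (p ω 0))).trans h0,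
    (norm_snd_le (Θ (p ω 0))).trans h0⟩

end MeanFieldModel

/-! ### The derivative on a single Weyl algebra -/

namespace RegularWeylField

open MeanFieldModel

variable {d : ℕ} {M : MeanFieldModel d} {H : M.averages → Type*}
  [∀ ω, NormedAddCommGroup (H ω)] [∀ ω, InnerProductSpace ℂ (H ω)] [∀ ω, CompleteSpace (H ω)]
  {𝓗 : MeasurableHilbertField H} (𝒲 : RegularWeylField M 𝓗)
  {x : M.averages → ℝ → Idx d → ℝ} {X : M.averages → ℝ → Matrix (Idx d) (Idx d) ℝ}
  {f : (Idx d → ℝ) → ℂ} {r : (Idx d → ℝ) → Idx d → ℝ}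

lemma PhiExt_apply (t : ℝ) (ω : M.averages) (ψ : H ω) : 𝒲.PhiExt x X t f r ω ψ =
    M.weight f r (x ω) (X ω) t • 𝒲.W ω (label r (x ω) (X ω) t) ψ := by
  rw [PhiExt, PhiW, _root_.smul_apply, _root_.smul_apply, smul_smul]
  rfl

lemma PhiExt_zero (hx : ∀ ω : M.averages, M.IsMacroTrajectory ω (x ω))
    (hX : ∀ ω : M.averages, IsTimeOrderedExp (fun t => M.Q (x ω t)) (X ω))
    (ω : M.averages) (ψ : H ω) : 𝒲.PhiExt x X 0 f r ω ψ = 𝒲.Wf f r ω ψ := by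
  rw [PhiExt_apply, weight, label, Y_zero, (hX ω).1, (hx ω).1, Wf]
  simp

lemma _root_.HybridFluctuations.IsC1On.differentiableAt {E E' : Type*} [NormedAddCommGroup E]
    [NormedSpace ℝ E] [NormedAddCommGroup E'] [NormedSpace ℝ E'] {g : E → E'} {s : Set E}
    (hg : IsC1On g s) {a : E} (ha : a ∈ s) : DifferentiableAt ℝ g a := by
  obtain ⟨U, hU, hsU, h⟩ := hg
  exact (h.contDiffAt (hU.mem_nhds (hsU ha))).differentiableAt one_ne_zero

lemma hasDerivWithinAt_comp_trajectory {E' : Type*} [NormedAddCommGroup E'] [NormedSpace ℝ E']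
    {g : (Idx d → ℝ) → E'} {ω : M.averages} (hx : M.IsMacroTrajectory ω (x ω))
    (hg : DifferentiableAt ℝ g ω) :
    HasDerivWithinAt (fun t => g (x ω t)) (fderiv ℝ g ω (M.omegaDot ω)) (Ici 0) 0 := by
  have h1 := hx.2 0 le_rfl
  have h2 : HasFDerivAt g (fderiv ℝ g ω) (x ω 0) := by rw [hx.1]; exact hg.hasFDerivAt
  rw [hx.1] at h1
  exact h2.comp_hasDerivWithinAt 0 h1

lemma hasDerivWithinAt_weight (hx : ∀ ω : M.averages, M.IsMacroTrajectory ω (x ω))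
    (hX : ∀ ω : M.averages, IsTimeOrderedExp (fun t => M.Q (x ω t)) (X ω))
    (hf : IsC1On f M.averages) (hr : IsC1On r M.averages) (ω : M.averages) :
    HasDerivWithinAt (M.weight f r (x ω) (X ω)) (fderiv ℝ f ω (M.omegaDot ω) + f ω * (-(1 / 2) *
      ((r ω ⬝ᵥ ((M.sigma ω * rePart M.A * (M.sigma ω)ᵀ) *ᵥ r ω) : ℝ) : ℂ))) (Ici 0) 0 := by
  obtain ⟨-, -, -, -, -, hY⟩ := exists_small_time_Y hx hX
  have h1 := hasDerivWithinAt_comp_trajectory (hx ω) (hf.differentiableAt ω.2)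
  have h2 := hasDerivWithinAt_pi.1
    (hasDerivWithinAt_comp_trajectory (hx ω) (hr.differentiableAt ω.2))
  -- only the derivative of `Y` contributes, as `Y` vanishes at time `0`
  have h3 : HasDerivWithinAt (fun t => r (x ω t) ⬝ᵥ (M.Y (x ω) (X ω) t *ᵥ r (x ω t)))
      (r ω ⬝ᵥ ((M.sigma ω * rePart M.A * (M.sigma ω)ᵀ) *ᵥ r ω)) (Ici 0) 0 := by
    have h4 := HasDerivWithinAt.fun_sum (u := Finset.univ) fun i _ => (h2 i).mul
      (HasDerivWithinAt.fun_sum (u := Finset.univ) fun j _ => (hY ω i j).mul (h2 j))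
    refine h4.congr_deriv ?_
    simp only [Pi.mul_apply, Y_zero, (hx ω).1, Matrix.zero_apply, zero_mul, Finset.sum_const_zero,
      mul_zero, add_zero, zero_add]
    rfl
  have h5 := h1.mul ((h3.ofReal_comp.const_mul (-(1 / 2) : ℂ)).cexp)
  refine h5.congr_deriv ?_
  simp only [Y_zero, (hx ω).1]
  simp

lemma hasDerivWithinAt_label (hx : ∀ ω : M.averages, M.IsMacroTrajectory ω (x ω))
    (hX : ∀ ω : M.averages, IsTimeOrderedExp (fun t => M.Q (x ω t)) (X ω))
    (hr : IsC1On r M.averages) (ω : M.averages) :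
    HasDerivWithinAt (label r (x ω) (X ω))
      ((M.Q ω)ᵀ *ᵥ r ω + fderiv ℝ r ω (M.omegaDot ω)) (Ici 0) 0 := by
  have h2 := hasDerivWithinAt_pi.1
    (hasDerivWithinAt_comp_trajectory (hx ω) (hr.differentiableAt ω.2))
  refine hasDerivWithinAt_pi.2 fun j => ?_
  have h3 := HasDerivWithinAt.fun_sum (u := Finset.univ) fun i _ =>
    ((hX ω).2 0 le_rfl i j).mul (h2 i)
  refine h3.congr_deriv ?_
  simp only [(hX ω).1, (hx ω).1, Matrix.mul_one, Finset.sum_add_distrib, Matrix.one_apply, ite_mul,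
    one_mul, zero_mul, Finset.sum_ite_eq', Finset.mem_univ, if_true, Pi.add_apply]
  rfl

/-- The right derivative at `0` of the extended dynamics on regular vectors. -/
theorem hasDerivWithinAt_PhiExt (hx : ∀ ω : M.averages, M.IsMacroTrajectory ω (x ω))
    (hX : ∀ ω : M.averages, IsTimeOrderedExp (fun t => M.Q (x ω t)) (X ω))
    (hf : IsC1On f M.averages) (hr : IsC1On r M.averages) {ω : M.averages}
    {R : Matrix (M.BlockIdx (ω : Idx d → ℝ)) (Idx d) ℝ} (hR : M.IsBlockRotation ω R) {ψ : H ω}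
    (hψ : 𝒲.IsRegularVector ω ψ) :
    HasDerivWithinAt (fun t : ℝ => 𝒲.PhiExt x X t f r ω ψ) (𝒲.L f r ω R ψ) (Ici 0) 0 := by
  have hd : Differentiable ℝ fun a => 𝒲.W ω a ψ :=
    (show ContDiff ℝ 2 fun a => 𝒲.W ω a ψ from hψ).differentiable two_ne_zero
  have hw0 : M.weight f r (x ω) (X ω) 0 = f ω := by
    rw [weight, Y_zero, (hx ω).1]; simp
  have hl0 : label r (x ω) (X ω) 0 = r ω := by
    rw [label, (hX ω).1, (hx ω).1]; simp
  have h1 := hasDerivWithinAt_weight hx hX hf hr ω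
  have h2 := hasDerivWithinAt_label hx hX hr ω
  have h3 : HasFDerivAt (fun a => 𝒲.W ω a ψ) (fderiv ℝ (fun a => 𝒲.W ω a ψ) (r ω))
      (label r (x ω) (X ω) 0) := by
    rw [hl0]; exact (hd _).hasFDerivAt
  have h4 := h1.smul (h3.comp_hasDerivWithinAt 0 h2)
  have hdrift : 𝒲.Ldrift f r ω ψ = fderiv ℝ f ω (M.omegaDot ω) • 𝒲.W ω (r ω) ψ
      + f ω • fderiv ℝ (fun a => 𝒲.W ω a ψ) (r ω) (fderiv ℝ r ω (M.omegaDot ω)) := by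
    have h5 := (hd (r ω)).hasFDerivAt.comp (ω : Idx d → ℝ) (hr.differentiableAt ω.2).hasFDerivAt
    have h6 := (hf.differentiableAt ω.2).hasFDerivAt.smul h5
    have h7 := h6.fderiv
    change fderiv ℝ (f • ((fun a => 𝒲.W ω a ψ) ∘ r)) (ω : Idx d → ℝ) (M.omegaDot ω) = _
    rw [h7]
    simp only [_root_.add_apply, _root_.smul_apply, ContinuousLinearMap.smulRight_apply,
      ContinuousLinearMap.comp_apply, Function.comp]
    rw [add_comm]
  have e : (fun t : ℝ => 𝒲.PhiExt x X t f r ω ψ) = M.weight f r (x ω) (X ω) •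
      ((fun a => 𝒲.W ω a ψ) ∘ label r (x ω) (X ω)) := by
    ext t
    rw [PhiExt_apply]
    rfl
  rw [e, L, add_assoc, add_assoc, ← add_assoc (𝒲.Lcc f r ω R ψ),
    𝒲.Lcc_add_Lcq_add_Lqq f r R hR hψ, hdrift]
  refine h4.congr_deriv ?_
  simp only [Function.comp, hw0, hl0, map_add]
  module

end RegularWeylField

/-! ### Differentiation in the direct integral -/

namespace MeasurableHilbertField

variable {S : Type*} [MeasurableSpace S] {H : S → Type*} [∀ s, NormedAddCommGroup (H s)]
  [∀ s, InnerProductSpace ℂ (H s)] (𝓗 : MeasurableHilbertField H)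

lemma measurable_inner {ξ η : ∀ s, H s} (hξ : ξ ∈ 𝓗.sections) (hη : η ∈ 𝓗.sections) :
    Measurable fun s => ⟪ξ s, η s⟫_ℂ := by
  have h1 := 𝓗.measurable_norm _ (add_mem hξ hη)
  have h2 := 𝓗.measurable_norm _ (sub_mem hξ hη)
  have h3 := 𝓗.measurable_norm _ (sub_mem hξ (𝓗.sections.smul_mem Complex.I hη))
  have h4 := 𝓗.measurable_norm _ (add_mem hξ (𝓗.sections.smul_mem Complex.I hη))
  simp only [inner_eq_sum_norm_sq_div_four]
  simp only [Pi.add_apply, Pi.sub_apply, Pi.smul_apply] at h1 h2 h3 h4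
  exact ((((Complex.measurable_ofReal.comp h1).pow_const 2).sub
    ((Complex.measurable_ofReal.comp h2).pow_const 2)).add
    ((((Complex.measurable_ofReal.comp h3).pow_const 2).sub
      ((Complex.measurable_ofReal.comp h4).pow_const 2)).mul_const _)).div_const _

lemma mem_sections_of_tendsto {ξ : ℕ → ∀ s, H s} {η : ∀ s, H s} (hξ : ∀ n, ξ n ∈ 𝓗.sections)
    (h : ∀ s, Tendsto (fun n => ξ n s) atTop (𝓝 (η s))) : η ∈ 𝓗.sections := by
  refine 𝓗.mem_of_measurable_inner η fun ζ hζ => ?_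
  refine measurable_of_tendsto_metrizable (fun n => 𝓗.measurable_inner hζ (hξ n)) ?_
  exact tendsto_pi_nhds.2 fun s => (continuous_const.inner continuous_id).continuousAt.tendsto.comp
    (h s)

lemma real_smul_mem {ξ : ∀ s, H s} (hξ : ξ ∈ 𝓗.sections) (c : ℝ) :
    (fun s => c • ξ s) ∈ 𝓗.sections := by
  have e : (fun s => c • ξ s) = (c : ℂ) • ξ := funext fun s => (Complex.coe_smul c (ξ s)).symm
  rw [e]
  exact 𝓗.sections.smul_mem (c : ℂ) hξ

lemma lintegral_sq_lt_top_iff {m : Measure S} {ξ : ∀ s, H s} (hξ : ξ ∈ 𝓗.sections) :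
    ∫⁻ s, ‖ξ s‖ₑ ^ 2 ∂m < ∞ ↔ MemLp (fun s => ‖ξ s‖) 2 m := by
  have h1 : AEStronglyMeasurable (fun s => ‖ξ s‖) m :=
    (𝓗.measurable_norm ξ hξ).aestronglyMeasurable
  rw [MemLp, and_iff_right h1,
    eLpNorm_lt_top_iff_lintegral_rpow_enorm_lt_top two_ne_zero ENNReal.ofNat_ne_top]
  simp

/-- Pointwise differentiability of a family of sections implies differentiability in the norm of the
direct integral, if the difference quotients have a square integrable bound. -/
lemma tendsto_of_hasDerivWithinAt {m : Measure S} {Φ : ℝ → ∀ s, H s} {Λ : ∀ s, H s} {T : ℝ}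
    (hT : 0 < T) {g : S → ℝ} (hg : MemLp g 2 m) (hΦ : ∀ t ∈ Icc 0 T, Φ t ∈ 𝓗.sections)
    (h0 : 𝓗.MemDirectIntegral m (Φ 0)) (hb : ∀ t ∈ Icc 0 T, ∀ s, ‖Φ t s - Φ 0 s‖ ≤ t * g s)
    (hd : ∀ s, HasDerivWithinAt (fun t => Φ t s) (Λ s) (Ici 0) 0) :
    (∀ᶠ t : ℝ in 𝓝[>] 0, 𝓗.MemDirectIntegral m (Φ t)) ∧ 𝓗.MemDirectIntegral m Λ ∧
      Tendsto (fun t : ℝ => ∫⁻ s, ‖(t⁻¹ : ℝ) • (Φ t s - Φ 0 s) - Λ s‖ₑ ^ 2 ∂m) (𝓝[>] 0) (𝓝 0) := by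
  have hslope : ∀ s, Tendsto (fun t : ℝ => (t⁻¹ : ℝ) • (Φ t s - Φ 0 s)) (𝓝[>] 0) (𝓝 (Λ s)) := by
    intro s
    have h1 := (hasDerivWithinAt_iff_tendsto_slope' (by simp)).1 ((hd s).mono Ioi_subset_Ici_self)
    refine h1.congr fun t => ?_
    rw [slope_def_module, sub_zero]
  have hev : ∀ᶠ t : ℝ in 𝓝[>] 0, t ∈ Ioc 0 T := Ioc_mem_nhdsGT hT
  have hquot : ∀ t ∈ Ioc 0 T, ∀ s, ‖(t⁻¹ : ℝ) • (Φ t s - Φ 0 s)‖ ≤ g s := fun t ht s => by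
    rw [norm_smul, norm_inv, Real.norm_of_nonneg ht.1.le, inv_mul_le_iff₀ ht.1]
    exact hb t ⟨ht.1.le, ht.2⟩ s
  have hΛg : ∀ s, ‖Λ s‖ ≤ g s := fun s =>
    le_of_tendsto (hslope s).norm (hev.mono fun t ht => hquot t ht s)
  have hqs : ∀ t ∈ Icc 0 T, (fun s => (t⁻¹ : ℝ) • (Φ t s - Φ 0 s)) ∈ 𝓗.sections := fun t ht =>
    𝓗.real_smul_mem (sub_mem (hΦ t ht) h0.1) _
  have hΛs : Λ ∈ 𝓗.sections := by
    have hseq : Tendsto (fun n : ℕ => T / (n + 1 : ℝ)) atTop (𝓝[>] 0) := by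
      refine tendsto_nhdsWithin_iff.2 ⟨?_, Eventually.of_forall fun n => by
        simp only [mem_Ioi]; positivity⟩
      simpa [div_eq_mul_inv] using
        (tendsto_one_div_add_atTop_nhds_zero_nat (𝕜 := ℝ)).const_mul T
    refine 𝓗.mem_sections_of_tendsto (ξ := fun n s => ((T / (n + 1 : ℝ))⁻¹ : ℝ) •
      (Φ (T / (n + 1 : ℝ)) s - Φ 0 s)) (fun n => hqs _ ⟨by positivity, ?_⟩)
      fun s => (hslope s).comp hseq
    exact div_le_self hT.le (by linarith [n.cast_nonneg (α := ℝ)])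
  refine ⟨hev.mono fun t ht => ?_, ⟨hΛs, ?_⟩, ?_⟩
  · have ht' : t ∈ Icc 0 T := ⟨ht.1.le, ht.2⟩
    refine ⟨hΦ t ht', (𝓗.lintegral_sq_lt_top_iff (hΦ t ht')).2 ?_⟩
    have h1 := ((𝓗.lintegral_sq_lt_top_iff h0.1).1 h0.2).add (hg.const_mul t)
    refine h1.mono' (𝓗.measurable_norm _ (hΦ t ht')).aestronglyMeasurable
      (Eventually.of_forall fun s => ?_)
    rw [norm_norm]
    have h2 := norm_le_norm_add_norm_sub' (Φ t s) (Φ 0 s)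
    exact h2.trans (add_le_add le_rfl (hb t ht' s))
  · refine (𝓗.lintegral_sq_lt_top_iff hΛs).2 (hg.mono'
      (𝓗.measurable_norm _ hΛs).aestronglyMeasurable (Eventually.of_forall fun s => ?_))
    rw [norm_norm]
    exact hΛg s
  · have hbound : ∫⁻ s, ‖2 * g s‖ₑ ^ 2 ∂m ≠ ∞ := by
      have h1 := (hg.const_mul 2).2
      rw [eLpNorm_lt_top_iff_lintegral_rpow_enorm_lt_top two_ne_zero ENNReal.ofNat_ne_top] at h1
      simpa using h1.ne
    have h1 := tendsto_lintegral_filter_of_dominated_convergence (μ := m) (l := 𝓝[>] (0 : ℝ))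
      (F := fun t s => ‖(t⁻¹ : ℝ) • (Φ t s - Φ 0 s) - Λ s‖ₑ ^ 2) (f := fun _ => 0)
      (fun s => ‖2 * g s‖ₑ ^ 2)
      (hev.mono fun t ht => ?_) (hev.mono fun t ht => Eventually.of_forall fun s => ?_) hbound
      (Eventually.of_forall fun s => ?_)
    · simpa using h1
    · have h2 := 𝓗.measurable_norm _ (sub_mem (hqs t ⟨ht.1.le, ht.2⟩) hΛs)
      have h3 : Measurable fun s => ‖(t⁻¹ : ℝ) • (Φ t s - Φ 0 s) - Λ s‖ₑ ^ 2 := by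
        simpa [ofReal_norm] using h2.ennreal_ofReal.pow_const 2
      exact h3
    · gcongr
      refine enorm_le_iff_norm_le.2 ?_
      have h2 := (norm_sub_le ((t⁻¹ : ℝ) • (Φ t s - Φ 0 s)) (Λ s)).trans
        (add_le_add (hquot t ht s) (hΛg s))
      refine h2.trans ?_
      rw [Real.norm_eq_abs]
      exact (le_of_eq (two_mul _).symm).trans (le_abs_self _)
    · have h2 : Tendsto (fun t : ℝ => (t⁻¹ : ℝ) • (Φ t s - Φ 0 s) - Λ s) (𝓝[>] 0) (𝓝 0) := by
        simpa using (hslope s).sub_const (Λ s)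
      have h3 := (continuous_enorm.tendsto (0 : H s)).comp h2
      simpa [Function.comp_def] using ((ENNReal.continuous_pow 2).tendsto _).comp h3

end MeasurableHilbertField

/-! ### The extended dynamics on the direct integral -/

namespace MeanFieldModel

variable {d : ℕ} (M : MeanFieldModel d)

lemma exists_abs_dotProduct_sigma_le : ∃ c ≥ 0, ∀ (ω : M.averages) (a b : Idx d → ℝ),
    |a ⬝ᵥ (M.sigma ω *ᵥ b)| ≤ c * ‖a‖ * ‖b‖ := by
  have hcont : Continuous fun ω => ∑ i, ∑ j, |M.sigma ω i j| :=
    continuous_finsetSum _ fun i _ => continuous_finsetSum _ fun j _ =>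
      (M.contDiff_sigma i j).continuous.abs
  obtain ⟨c, hc⟩ := M.isCompact_averages.exists_bound_of_continuousOn hcont.continuousOn
  refine ⟨max c 0, le_max_right _ _, fun ω a b => ?_⟩
  calc |a ⬝ᵥ (M.sigma ω *ᵥ b)| = |∑ i, ∑ j, a i * (M.sigma ω i j * b j)| := by
        simp only [dotProduct, mulVec, Finset.mul_sum]
    _ ≤ ∑ i, ∑ j, |M.sigma ω i j| * (‖a‖ * ‖b‖) := by
        refine (Finset.abs_sum_le_sum_abs _ _).trans (Finset.sum_le_sum fun i _ =>
          (Finset.abs_sum_le_sum_abs _ _).trans (Finset.sum_le_sum fun j _ => ?_))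
        rw [abs_mul, abs_mul, mul_left_comm]
        gcongr
        · exact norm_le_pi_norm a i
        · exact norm_le_pi_norm b j
    _ = (∑ i, ∑ j, |M.sigma ω i j|) * (‖a‖ * ‖b‖) := by
        simp only [Finset.sum_mul]
    _ ≤ max c 0 * (‖a‖ * ‖b‖) := by
        gcongr
        exact (le_abs_self _).trans ((hc ω ω.2).trans (le_max_left _ _))
    _ = max c 0 * ‖a‖ * ‖b‖ := (mul_assoc _ _ _).symm

end MeanFieldModel

namespace RegularWeylField

open MeanFieldModel

variable {d : ℕ} {M : MeanFieldModel d} {H : M.averages → Type*}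
  [∀ ω, NormedAddCommGroup (H ω)] [∀ ω, InnerProductSpace ℂ (H ω)] [∀ ω, CompleteSpace (H ω)]
  {𝓗 : MeasurableHilbertField H} (𝒲 : RegularWeylField M 𝓗)
  {x : M.averages → ℝ → Idx d → ℝ} {X : M.averages → ℝ → Matrix (Idx d) (Idx d) ℝ}
  {f : (Idx d → ℝ) → ℂ} {r : (Idx d → ℝ) → Idx d → ℝ}

/-- `ω ↦ W_ω(b(ω)) ξ(ω)` is jointly measurable because `a ↦ W_ω(a) ξ(ω)` is continuous. -/
lemma smul_W_mem_sections {ξ : ∀ ω, H ω} (hξ : ξ ∈ 𝓗.sections)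
    (hc : ∀ ω, Continuous fun a => 𝒲.W ω a (ξ ω)) {g : M.averages → ℂ} (hg : Measurable g)
    {b : M.averages → Idx d → ℝ} (hb : Measurable b) :
    (fun ω => g ω • 𝒲.W ω (b ω) (ξ ω)) ∈ 𝓗.sections := by
  refine 𝓗.mem_of_measurable_inner _ fun ζ hζ => ?_
  have h1 : Measurable (Function.uncurry fun (a : Idx d → ℝ) (ω : M.averages) =>
      ⟪ζ ω, 𝒲.W ω a (ξ ω)⟫_ℂ) :=
    measurable_uncurry_of_continuous_of_measurable
      (fun ω => continuous_const.inner (hc ω))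
      (fun a => 𝓗.measurable_inner hζ (𝒲.W_measurable a ξ hξ))
  have h2 := hg.mul (h1.comp (hb.prodMk measurable_id))
  simp only [inner_smul_right]
  exact h2

/-- On bounded sets, `a ↦ W_ω(a) ψ` has a Lipschitz constant that is uniform in `ω`, up to the
graph norm of the fluctuation operators. -/
lemma exists_norm_W_sub_le (ρ : ℝ) : ∃ K ≥ 0, ∀ (ω : M.averages) (ψ : H ω),
    (Differentiable ℝ fun a => 𝒲.W ω a ψ) → ∀ a b : Idx d → ℝ, ‖a‖ ≤ ρ → ‖b‖ ≤ ρ →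
      ‖𝒲.W ω b ψ - 𝒲.W ω a ψ‖ ≤ K * (‖ψ‖ + ∑ μ, ‖𝒲.F ω μ ψ‖) * ‖b - a‖ := by
  obtain ⟨c, hc, hσ⟩ := M.exists_abs_dotProduct_sigma_le
  refine ⟨1 + c * |ρ|, by positivity, fun ω ψ hd a b ha hb => ?_⟩
  set S := ∑ μ, ‖𝒲.F ω μ ψ‖ with hS
  have hS0 : 0 ≤ S := by positivity
  have hfluct : ∀ e, ‖𝒲.fluct ω e ψ‖ ≤ S * ‖e‖ := fun e => by
    rw [𝒲.fluct_eq_sum_F hd, hS, Finset.sum_mul]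
    refine norm_sum_le_of_le _ fun μ _ => ?_
    rw [norm_smul, mul_comm, Complex.norm_real]
    gcongr
    exact norm_le_pi_norm e μ
  have hderiv : ∀ y ∈ Metric.closedBall (0 : Idx d → ℝ) ρ,
      ‖fderiv ℝ (fun a => 𝒲.W ω a ψ) y‖ ≤ (1 + c * |ρ|) * (‖ψ‖ + S) := fun y hy => by
    rw [mem_closedBall_zero_iff] at hy
    refine ContinuousLinearMap.opNorm_le_bound _ (by positivity) fun e => ?_
    rw [𝒲.fderiv_W_apply hd]
    refine (norm_sub_le _ _).trans ?_
    rw [norm_smul, norm_smul, norm_W_apply, norm_W_apply, norm_mul, Complex.norm_real,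
      Complex.norm_I, one_mul, norm_div, Complex.norm_I, Complex.norm_ofNat, Real.norm_eq_abs]
    have h1 : |e ⬝ᵥ (M.sigma ω *ᵥ y)| ≤ c * ‖e‖ * |ρ| :=
      (hσ ω e y).trans (by gcongr; exact hy.trans (le_abs_self _))
    calc ‖𝒲.fluct ω e ψ‖ + 1 / 2 * |e ⬝ᵥ (M.sigma ω *ᵥ y)| * ‖ψ‖
        ≤ S * ‖e‖ + 1 * (c * ‖e‖ * |ρ|) * ‖ψ‖ := by
          gcongr
          · exact hfluct e
          · norm_num
      _ ≤ S * ‖e‖ + 1 * (c * ‖e‖ * |ρ|) * ‖ψ‖ + (‖ψ‖ * ‖e‖ + c * |ρ| * S * ‖e‖) :=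
          le_add_of_nonneg_right (by positivity)
      _ = (1 + c * |ρ|) * (‖ψ‖ + S) * ‖e‖ := by ring
  exact (convex_closedBall (0 : Idx d → ℝ) ρ).norm_image_sub_le_of_norm_fderiv_le (𝕜 := ℝ)
    (fun y _ => hd y) hderiv (mem_closedBall_zero_iff.2 ha) (mem_closedBall_zero_iff.2 hb)

/-- The extended dynamics on the direct integral is differentiable in norm at time `0` on the core
vectors. -/
theorem tendsto_PhiExt (hx : ∀ ω : M.averages, M.IsMacroTrajectory ω (x ω))
    (hX : ∀ ω : M.averages, IsTimeOrderedExp (fun t => M.Q (x ω t)) (X ω))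
    (hf : IsC1On f M.averages) (hr : IsC1On r M.averages)
    {R : ∀ ω : M.averages, Matrix (M.BlockIdx (ω : Idx d → ℝ)) (Idx d) ℝ}
    (hR : ∀ ω : M.averages, M.IsBlockRotation ω (R ω)) {m : Measure M.averages}
    {ψ : ∀ ω, H ω} (hψ : 𝒲.IsCore m ψ) :
    𝓗.MemDirectIntegral m (fun ω => 𝒲.Wf f r ω (ψ ω)) ∧
    (∀ᶠ t : ℝ in 𝓝[>] 0, 𝓗.MemDirectIntegral m (fun ω => 𝒲.PhiExt x X t f r ω (ψ ω))) ∧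
    𝓗.MemDirectIntegral m (fun ω => 𝒲.L f r ω (R ω) (ψ ω)) ∧
    Tendsto (fun t : ℝ => ∫⁻ ω, ‖(t⁻¹ : ℝ) •
      (𝒲.PhiExt x X t f r ω (ψ ω) - 𝒲.Wf f r ω (ψ ω)) - 𝒲.L f r ω (R ω) (ψ ω)‖ₑ ^ 2 ∂m)
      (𝓝[>] 0) (𝓝 0) := by
  obtain ⟨hreg, hψm, hF⟩ := hψ
  obtain ⟨T, hT, C, hC, hwl⟩ := exists_small_time_weight_label hx hX hf hr
  obtain ⟨K, hK, hW⟩ := 𝒲.exists_norm_W_sub_le (C + C * T)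
  have hd : ∀ ω, Differentiable ℝ fun a => 𝒲.W ω a (ψ ω) := fun ω =>
    (show ContDiff ℝ 2 fun a => 𝒲.W ω a (ψ ω) from hreg ω).differentiable two_ne_zero
  have h0T : (0 : ℝ) ∈ Icc 0 T := ⟨le_rfl, hT.le⟩
  set S : M.averages → ℝ := fun ω => ‖ψ ω‖ + ∑ μ, ‖𝒲.F ω μ (ψ ω)‖ with hS
  have hψL : MemLp (fun ω => ‖ψ ω‖) 2 m := (𝓗.lintegral_sq_lt_top_iff hψm.1).1 hψm.2
  have hSL : MemLp S 2 m := hψL.add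
    (memLp_finsetSum _ fun μ _ => (𝓗.lintegral_sq_lt_top_iff (hF μ).1).1 (hF μ).2)
  have hS0 : ∀ ω, 0 ≤ S ω := fun ω => by positivity
  have hψS : ∀ ω, ‖ψ ω‖ ≤ S ω := fun ω => le_add_of_nonneg_right (by positivity)
  have hmem : ∀ t ∈ Icc 0 T, (fun ω => 𝒲.PhiExt x X t f r ω (ψ ω)) ∈ 𝓗.sections := fun t ht => by
    simp only [PhiExt_apply]
    exact 𝒲.smul_W_mem_sections hψm.1 (fun ω => (hd ω).continuous) (hwl t ht).1.measurable
      (hwl t ht).2.1.measurable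
  have h0 : 𝓗.MemDirectIntegral m (fun ω => 𝒲.PhiExt x X 0 f r ω (ψ ω)) := by
    refine ⟨hmem 0 h0T, (𝓗.lintegral_sq_lt_top_iff (hmem 0 h0T)).2 ?_⟩
    refine (hψL.const_mul C).mono' (𝓗.measurable_norm _ (hmem 0 h0T)).aestronglyMeasurable
      (Eventually.of_forall fun ω => ?_)
    rw [norm_norm, PhiExt_apply, norm_smul, norm_W_apply]
    gcongr
    exact ((hwl 0 h0T).2.2 ω).2.2.1
  have hb : ∀ t ∈ Icc 0 T, ∀ ω, ‖𝒲.PhiExt x X t f r ω (ψ ω) - 𝒲.PhiExt x X 0 f r ω (ψ ω)‖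
      ≤ t * ((C + C * (K * C)) * S ω) := fun t ht ω => by
    obtain ⟨hw, hl, hw0, hl0⟩ := (hwl t ht).2.2 ω
    set w := M.weight f r (x ω) (X ω) with hwdef
    set l := label r (x ω) (X ω) with hldef
    have hlt : ‖l t‖ ≤ C + C * T := by
      have h1 := norm_le_norm_add_norm_sub' (l t) (l 0)
      have h2 : C * t ≤ C * T := mul_le_mul_of_nonneg_left ht.2 hC
      linarith
    have hl0' : ‖l 0‖ ≤ C + C * T := hl0.trans (le_add_of_nonneg_right (by positivity))
    have h1 := hW ω (ψ ω) (hd ω) (l 0) (l t) hl0' hlt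
    have e : 𝒲.PhiExt x X t f r ω (ψ ω) - 𝒲.PhiExt x X 0 f r ω (ψ ω)
        = (w t - w 0) • 𝒲.W ω (l t) (ψ ω)
          + w 0 • (𝒲.W ω (l t) (ψ ω) - 𝒲.W ω (l 0) (ψ ω)) := by
      rw [PhiExt_apply, PhiExt_apply]
      module
    rw [e]
    refine (norm_add_le _ _).trans ?_
    rw [norm_smul, norm_smul, norm_W_apply]
    have ht0 := ht.1
    have hSω := hS0 ω
    calc ‖w t - w 0‖ * ‖ψ ω‖ + ‖w 0‖ * ‖𝒲.W ω (l t) (ψ ω) - 𝒲.W ω (l 0) (ψ ω)‖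
        ≤ (C * t) * S ω + C * (K * S ω * (C * t)) := by
          gcongr
          · exact hψS ω
          · exact h1.trans (by gcongr)
      _ = t * ((C + C * (K * C)) * S ω) := by ring
  have key := 𝓗.tendsto_of_hasDerivWithinAt (Φ := fun t ω => 𝒲.PhiExt x X t f r ω (ψ ω)) hT
    (hSL.const_mul (C + C * (K * C))) hmem h0 hb
    fun ω => 𝒲.hasDerivWithinAt_PhiExt hx hX hf hr (hR ω) (hreg ω)
  simp only [𝒲.PhiExt_zero hx hX] at key h0
  exact ⟨h0, key⟩

end RegularWeylField

end

end HybridFluctuations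

theorem theorem5 {d : ℕ} (M : HybridFluctuations.MeanFieldModel d)
    {H : M.averages → Type*}
    [∀ ω, NormedAddCommGroup (H ω)] [∀ ω, InnerProductSpace ℂ (H ω)] [∀ ω, CompleteSpace (H ω)]
    (𝓗 : HybridFluctuations.MeasurableHilbertField H)
    (𝒲 : HybridFluctuations.RegularWeylField M 𝓗)
    (m : MeasureTheory.Measure M.averages)
    (x : M.averages → ℝ → HybridFluctuations.Idx d → ℝ)
    (hx : ∀ ω : M.averages, M.IsMacroTrajectory ω (x ω))
    (X : M.averages → ℝ →
      Matrix (HybridFluctuations.Idx d) (HybridFluctuations.Idx d) ℝ)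
    (hX : ∀ ω : M.averages,
      HybridFluctuations.MeanFieldModel.IsTimeOrderedExp (fun t => M.Q (x ω t)) (X ω)) :
    (∀ ω : M.averages, ∃ R, M.IsBlockRotation ω R) ∧
    (∀ R : ∀ ω : M.averages, Matrix (M.BlockIdx ω) (HybridFluctuations.Idx d) ℝ,
      (∀ ω : M.averages, M.IsBlockRotation ω (R ω)) →
      ∀ (f : (HybridFluctuations.Idx d → ℝ) → ℂ)
        (r : (HybridFluctuations.Idx d → ℝ) → HybridFluctuations.Idx d → ℝ),
        HybridFluctuations.IsC1On f M.averages →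
        HybridFluctuations.IsC1On r M.averages →
        (∀ (ω : M.averages) (ψ : H ω), 𝒲.IsRegularVector ω ψ →
          HasDerivWithinAt (fun t : ℝ => 𝒲.PhiExt x X t f r ω ψ)
            (𝒲.L f r ω (R ω) ψ) (Set.Ici 0) 0) ∧
        (∀ ψ : ∀ ω, H ω, 𝒲.IsCore m ψ →
          𝓗.MemDirectIntegral m (fun ω => 𝒲.Wf f r ω (ψ ω)) ∧
          (∀ᶠ t : ℝ in nhdsWithin 0 (Set.Ioi 0),
            𝓗.MemDirectIntegral m (fun ω => 𝒲.PhiExt x X t f r ω (ψ ω))) ∧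
          𝓗.MemDirectIntegral m (fun ω => 𝒲.L f r ω (R ω) (ψ ω)) ∧
          Filter.Tendsto
            (fun t : ℝ => ∫⁻ ω, ‖(t⁻¹ : ℝ) •
              (𝒲.PhiExt x X t f r ω (ψ ω) - 𝒲.Wf f r ω (ψ ω))
                - 𝒲.L f r ω (R ω) (ψ ω)‖ₑ ^ 2 ∂m)
            (nhdsWithin 0 (Set.Ioi 0)) (nhds 0))) ∧
    (∃ (d' : ℕ) (M' : HybridFluctuations.MeanFieldModel d') (ω' : M'.averages)
        (R' : Matrix (M'.BlockIdx ω') (HybridFluctuations.Idx d') ℝ),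
        M'.IsBlockRotation ω' R' ∧
        (HybridFluctuations.MeanFieldModel.K11 R').IsHermitian ∧
        ¬ (HybridFluctuations.MeanFieldModel.K11 R').PosSemidef) :=
  ⟨fun ω => M.exists_isBlockRotation ω, fun _ hR _ _ hf hr =>
    ⟨fun ω _ hψ => 𝒲.hasDerivWithinAt_PhiExt hx hX hf hr (hR ω) hψ,
      fun _ hψ => 𝒲.tendsto_PhiExt hx hX hf hr hR hψ⟩,
    HybridFluctuations.NonPositiveModel.exists_K11_not_posSemidef⟩
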